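/- **Setting.** Let $J\ge 1$, let $n_1,\dots,n_J\ge 1$ be integers with $n=n_1+\dots+n_J$, and let $a_1,\dots,a_J$ and $\lambda_1,\dots,\lambda_J$ be complex numbers; the $a_j$ are not all equal (but not supposed distinct). Consider a linear differential system $$x^2\frac{dY}{dx}=A(x)Y,\qquad A(x)\in M_n(\mathbb C\{x\}),\quad A(0)\neq 0,$$ with a formal fundamental solution $\widetilde Y(x)=\widetilde F(x)\,x^{L}e^{Q(1/x)}$, where $\widetilde F\in GL_n(\mathbb C((x)))$, $L=\bigoplus_{j=1}^J(\lambda_jI_{n_j}+J_{n_j})$ with $J_{m}$ the nilpotent upper Jordan block of size $m$, and $Q(1/x)=\bigoplus_{j=1}^J\frac{-a_j}{x}I_{n_j}$ (single level equal to one). Equivalently, $\widetilde F$ is invertible and $x^2\widetilde F'+\widetilde F A_0=A\widetilde F$ with $A_0(x)=\bigoplus_j a_jI_{n_j}+xL$. Put $$\boldsymbol\Omega=\{a_j-a_k : 1\le j,k\le J\}\ni 0 .$$ **Definitions.** The points of the Riemann surface $\mathcal R_{\boldsymbol\Omega}$ are the homotopy classes, with fixed extremities, of paths that issue from $0$ and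 lie in $\mathbb C\setminus\boldsymbol\Omega$ except for their start at $0$, together with the class of the constant path $0$; its complex structure is pulled back by the end-point projection to $\mathbb C$ (so $0$ is a regular point on the first sheet only). For $\nu>0$ smaller than half the minimal distance between distinct elements of $\boldsymbol\Omega$, a $\nu$-sectorial region of $\mathcal R_{\boldsymbol\Omega}$ is the union of an open disc centred at $0$ on the first sheet, a tubular neighbourhood of a piecewise-$\mathcal C^1$ path starting in this disc, and an open sector at infinity of bounded opening (possibly larger than $2\pi$) containing the end of the path, where the disc has distance greater than $\nu$ from $\boldsymbol\Omega\setminus\{0\}$ and the tube and the sector have distance greater than $\nu$ from $\boldsymbol\Omega$. The Borel transform of $\widetilde f=\sum_{m\ge -N}f_mx^m\in\mathbb C((x))$ is $\widehat f(\xi)=\sum_{m\ge1}f_m\frac{\xi^{m-1}}{(m-1)!}$, up to a linear combination of derivatives of the Dirac $\delta$ at $0$. The series $\widetilde f$ is *summable-resurgent with singular support $\boldsymbol\Omega,0$* if $\widehat f$ converges near $\xi=0$, continues to an analytic function on all of $\mathcal R_{\boldsymbol\Omega}$, and this function grows at most exponentially at infinity on every $\nu$-sectorial region of $\mathcal R_{\boldsymbol\Omega}$,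 for every such $\nu$ (the bound may depend on the region). **Statement.** Every entry of the full matrix $\widetilde F(x)$ is summable-resurgent with singular support $\boldsymbol\Omega,0$. -/

import Mathlib

open scoped unitInterval PowerSeries LaurentSeries

noncomputable section

namespace LevelOne

/-! ### Level-one systems and their formal fundamental solutions -/

/-- A formal power series belongs to `ℂ{x}`: its radius of convergence is positive. -/
def IsConvergent (f : ℂ⟦X⟧) : Prop :=
  0 < (FormalMultilinearSeries.ofScalars ℂ (fun m => PowerSeries.coeff m f)).radius

/-- Rows and columns of a matrix that is split into `J` blocks of sizes `n 0, …, n (J - 1)`. -/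
abbrev Idx {J : ℕ} (n : Fin J → ℕ) : Type := Σ j : Fin J, Fin (n j)

/-- The nilpotent Jordan block of size `m`, with ones just above the diagonal. -/
def jordanNilpotent (m : ℕ) : Matrix (Fin m) (Fin m) ℂ :=
  fun p q => if (p : ℕ) + 1 = q then 1 else 0

/-- The matrix of exponents of formal monodromy `L = ⨁ (λ_j I + J_{n_j})`. -/
def exponentMatrix {J : ℕ} (n : Fin J → ℕ) (lam : Fin J → ℂ) : Matrix (Idx n) (Idx n) ℂ :=
  Matrix.blockDiagonal' fun j => lam j • (1 : Matrix (Fin (n j)) (Fin (n j)) ℂ)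
    + jordanNilpotent (n j)

/-- The matrix `⨁ a_j I`, so that `Q(1/x) = -(1/x) ⨁ a_j I`. -/
def stokesMatrix {J : ℕ} (n : Fin J → ℕ) (a : Fin J → ℂ) : Matrix (Idx n) (Idx n) ℂ :=
  Matrix.blockDiagonal' fun j => a j • (1 : Matrix (Fin (n j)) (Fin (n j)) ℂ)

/-- The normal solution `x^L e^{Q(1/x)}`, with the principal determination of `x^L`. -/
def normalSolution {J : ℕ} (n : Fin J → ℕ) (a lam : Fin J → ℂ) (x : ℂ) :
    Matrix (Idx n) (Idx n) ℂ :=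
  NormedSpace.exp (Complex.log x • exponentMatrix n lam)
    * NormedSpace.exp ((-x⁻¹) • stokesMatrix n a)

/-- The coefficient matrix `A₀(x) = ⨁ a_j I + x L` of the normal form `x² Y' = A₀(x) Y`,
the system with fundamental solution `x^L e^{Q(1/x)}` (see `normalSolution_hasDerivAt`). -/
def normalForm {J : ℕ} (n : Fin J → ℕ) (a lam : Fin J → ℂ) : Matrix (Idx n) (Idx n) ℂ⟦X⟧ :=
  (stokesMatrix n a).map (PowerSeries.C (R := ℂ))
    + (PowerSeries.X : ℂ⟦X⟧) • (exponentMatrix n lam).map (PowerSeries.C (R := ℂ))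

theorem stokesMatrix_comm {J : ℕ} (n : Fin J → ℕ) (a lam : Fin J → ℂ) :
    Commute (exponentMatrix n lam) (stokesMatrix n a) := by
  unfold Commute SemiconjBy exponentMatrix stokesMatrix
  rw [← Matrix.blockDiagonal'_mul, ← Matrix.blockDiagonal'_mul]
  congr 1
  funext j
  simp

attribute [local instance] Matrix.linftyOpNormedRing Matrix.linftyOpNormedAlgebra in
/-- `x^L e^{Q(1/x)}` solves `x² Y' = A₀(x) Y`. -/
theorem normalSolution_hasDerivAt {J : ℕ} (n : Fin J → ℕ) (a lam : Fin J → ℂ) (x : ℂ)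
    (hx : x ∈ Complex.slitPlane) (i k : Idx n) :
    HasDerivAt (fun y => normalSolution n a lam y i k)
      ((x ^ 2)⁻¹ * ((stokesMatrix n a + x • exponentMatrix n lam) * normalSolution n a lam x) i k)
      x := by
  have hx0 : x ≠ 0 := Complex.slitPlane_ne_zero hx
  set L := exponentMatrix n lam
  set D := stokesMatrix n a
  have hLD : Commute L D := stokesMatrix_comm n a lam
  have h1 : HasDerivAt (fun y : ℂ => NormedSpace.exp (Complex.log y • L))
      (x⁻¹ • (L * NormedSpace.exp (Complex.log x • L))) x :=
    (hasDerivAt_exp_smul_const' (𝕂 := ℂ) L (Complex.log x)).scomp x (Complex.hasDerivAt_log hx)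
  have h2 : HasDerivAt (fun y : ℂ => NormedSpace.exp ((-y⁻¹) • D))
      ((x ^ 2)⁻¹ • (D * NormedSpace.exp ((-x⁻¹) • D))) x := by
    have h0 : HasDerivAt (fun y : ℂ => -y⁻¹) ((x ^ 2)⁻¹) x := by
      simpa using (hasDerivAt_inv hx0).fun_neg
    exact (hasDerivAt_exp_smul_const' (𝕂 := ℂ) D (-x⁻¹)).scomp x h0
  have h3 := h1.mul h2
  have h4 : (x⁻¹ • (L * NormedSpace.exp (Complex.log x • L))) * NormedSpace.exp ((-x⁻¹) • D)
      + NormedSpace.exp (Complex.log x • L) * ((x ^ 2)⁻¹ • (D * NormedSpace.exp ((-x⁻¹) • D)))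
      = (x ^ 2)⁻¹ • ((D + x • L) * normalSolution n a lam x) := by
    have hc : Commute (NormedSpace.exp (Complex.log x • L)) D :=
      ((hLD.symm.smul_right (Complex.log x)).exp_right).symm
    have h5 : NormedSpace.exp (Complex.log x • L) * (D * NormedSpace.exp ((-x⁻¹) • D))
        = D * normalSolution n a lam x := by
      rw [← mul_assoc, hc.eq, mul_assoc]; rfl
    rw [mul_smul_comm, h5, smul_mul_assoc, mul_assoc, add_mul, smul_add, smul_mul_assoc, smul_smul,
      add_comm]
    congr 2
    field_simp
  rw [h4] at h3
  exact (ContinuousLinearMap.proj (R := ℂ) (φ := fun _ : Idx n => ℂ) k).hasFDerivAt.comp_hasDerivAt x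
    ((ContinuousLinearMap.proj (R := ℂ)
      (φ := fun _ : Idx n => Idx n → ℂ) i).hasFDerivAt.comp_hasDerivAt x h3)

/-- `F(x) x^L e^{Q(1/x)}` is a formal fundamental solution of `x² Y' = A(x) Y`: the formal
meromorphic matrix `F` is invertible and, since `x² (F Y₀)' = (x² F' + F A₀) Y₀` for the
invertible normal solution `Y₀ = x^L e^{Q(1/x)}`, it satisfies `x² F' + F A₀ = A F`. -/
def IsFormalFundamentalSolution {J : ℕ} {n : Fin J → ℕ} (A : Matrix (Idx n) (Idx n) ℂ⟦X⟧)
    (a lam : Fin J → ℂ) (F : Matrix (Idx n) (Idx n) ℂ⸨X⸩) : Prop :=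
  IsUnit F ∧
    HahnSeries.ofPowerSeries ℤ ℂ (PowerSeries.X ^ 2) • F.map (LaurentSeries.derivative ℂ)
      + F * (normalForm n a lam).map (HahnSeries.ofPowerSeries ℤ ℂ)
      = A.map (HahnSeries.ofPowerSeries ℤ ℂ) * F

/-- The set of all differences `a_j - a_k` of the Stokes values. -/
def stokesDifferences {J : ℕ} (a : Fin J → ℂ) : Set ℂ :=
  {ω | ∃ j k, ω = a j - a k}

/-! ### The Riemann surface attached to a set `Ω` that contains `0` -/

/-- Paths from `0` that lie in `ℂ ∖ Ω` except for their start at `0`. A path may rest at `0` for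
a while before it leaves; as `0 ∈ Ω`, it cannot come back, so that only the constant path
ends at `0`. -/
def IsAdmissible (Ω : Set ℂ) {z : ℂ} (γ : Path (0 : ℂ) z) : Prop :=
  ∃ t₀ : I, (∀ t ≤ t₀, γ t = 0) ∧ ∀ t, t₀ < t → γ t ∉ Ω

/-- Homotopy with fixed extremities through admissible paths. -/
def AdmissiblyHomotopic (Ω : Set ℂ) {z : ℂ} (γ γ' : {γ : Path (0 : ℂ) z // IsAdmissible Ω γ}) :
    Prop :=
  ∃ H : Path.Homotopy γ.1 γ'.1, ∀ s : I, IsAdmissible Ω (H.eval s)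

/-- The Riemann surface `𝓡_Ω`: an end-point together with a homotopy class of admissible paths
from `0` to it. -/
def Surface (Ω : Set ℂ) : Type := Σ z : ℂ, Quot (AdmissiblyHomotopic Ω (z := z))

/-- The point of `𝓡_Ω` given by an admissible path. -/
def Surface.mk {Ω : Set ℂ} {z : ℂ} (γ : Path (0 : ℂ) z) (h : IsAdmissible Ω γ) : Surface Ω :=
  ⟨z, Quot.mk _ ⟨γ, h⟩⟩

/-- The natural projection of `𝓡_Ω` to the complex plane. -/
def Surface.proj {Ω : Set ℂ} (q : Surface Ω) : ℂ := q.1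

/-- Resurgent functions with singular support `Ω`: functions that are analytic on all of `𝓡_Ω`
for the complex structure pulled back by the projection. Near the point `[γ]` with end-point `z`
the inverse of the projection is `w ↦ [γ followed by the segment from z to w]`. -/
def IsResurgentFunction {Ω : Set ℂ} (φ : Surface Ω → ℂ) : Prop :=
  ∀ (z : ℂ) (γ : Path (0 : ℂ) z), IsAdmissible Ω γ →
    ∃ r > 0, ∃ g : ℂ → ℂ, AnalyticOnNhd ℂ g (Metric.ball z r) ∧
      ∀ w ∈ Metric.ball z r, ∃ h : IsAdmissible Ω (γ.trans (Path.segment z w)),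
        φ (Surface.mk (γ.trans (Path.segment z w)) h) = g w

/-! ### Sectorial regions and summable-resurgence -/

/-- Piecewise `C¹` paths. -/
def IsPiecewiseC1 {z w : ℂ} (γ : Path z w) : Prop :=
  ∃ (m : ℕ) (t : Fin (m + 1) → ℝ), Monotone t ∧ t 0 = 0 ∧ t (Fin.last m) = 1 ∧
    ∀ i : Fin m, ContDiffOn ℝ 1 γ.extend (Set.Icc (t i.castSucc) (t i.succ))

/-- Polar coordinates `(ρ, θ)` centred at `v`. -/
def polar (v : ℂ) (p : ℝ × ℝ) : ℂ := v + p.1 * Complex.exp (p.2 * Complex.I)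

theorem continuous_polar (v : ℂ) : Continuous (polar v) := by
  unfold polar
  fun_prop

/-- The path that is a segment in the polar coordinates centred at `v`. -/
def polarPath (v : ℂ) (p q : ℝ × ℝ) : Path (polar v p) (polar v q) :=
  (Path.segment p q).map (continuous_polar v)

/-- A `ν`-sectorial region of `𝓡_Ω`. It is composed of an open disc about `0`, a tubular
neighbourhood of a piecewise `C¹` path that starts in the disc, and an open sector at infinity
of bounded opening (which may exceed `2π`, as the region lies on `𝓡_Ω`) that contains the end of
the path; they keep away from `Ω` by `ν`, except for the disc and the point `0`. -/
structure SectorialRegion (Ω : Set ℂ) (ν : ℝ) where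
  ν_pos : 0 < ν
  two_mul_lt : ∀ ω ∈ Ω, ∀ ω' ∈ Ω, ω ≠ ω' → 2 * ν < dist ω ω'
  /-- radius of the disc -/
  discRadius : ℝ
  discRadius_pos : 0 < discRadius
  disc_far : ∀ z ∈ Metric.ball (0 : ℂ) discRadius, ∀ ω ∈ Ω, ω ≠ 0 → ν < dist z ω
  /-- vertex of the sector -/
  vertex : ℂ
  /-- the sector consists of the points at a distance greater than this from its vertex -/
  innerRadius : ℝ
  innerRadius_nonneg : 0 ≤ innerRadius
  /-- lower bound of the arguments in the sector -/
  argMin : ℝ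
  /-- upper bound of the arguments in the sector -/
  argMax : ℝ
  sector_far : ∀ p ∈ Set.Ioi innerRadius ×ˢ Set.Ioo argMin argMax, ∀ ω ∈ Ω,
    ν < dist (polar vertex p) ω
  /-- start of the path, in the disc -/
  start : ℂ
  start_mem : start ∈ Metric.ball (0 : ℂ) discRadius
  /-- polar coordinates of the end of the path, in the sector -/
  finish : ℝ × ℝ
  finish_mem : finish ∈ Set.Ioi innerRadius ×ˢ Set.Ioo argMin argMax
  /-- the path from the disc to the sector -/
  path : Path start (polar vertex finish)
  path_piecewiseC1 : IsPiecewiseC1 path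
  /-- radius of the tube about the path -/
  tubeRadius : ℝ
  tubeRadius_pos : 0 < tubeRadius
  tube_far : ∀ t, ∀ z ∈ Metric.ball (path t) tubeRadius, ∀ ω ∈ Ω, ν < dist z ω

namespace SectorialRegion

variable {Ω : Set ℂ} {ν : ℝ}

/-- The disc, on the first sheet. -/
def disc (S : SectorialRegion Ω ν) : Set (Surface Ω) :=
  {q | ∃ w ∈ Metric.ball (0 : ℂ) S.discRadius, ∃ h, q = Surface.mk (Path.segment 0 w) h}

/-- The tubular neighbourhood: from `0` straight to the start of the path, along the path up to
time `t`, then straight to a point of the disc about the point reached. -/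
def tube (S : SectorialRegion Ω ν) : Set (Surface Ω) :=
  {q | ∃ t : I, ∃ w ∈ Metric.ball (S.path t) S.tubeRadius, ∃ h,
    q = Surface.mk (((Path.segment 0 (S.path 0)).trans (S.path.subpath 0 t)).trans
      (Path.segment (S.path t) w)) h}

/-- The sector, reached along the whole path and then inside the sector. -/
def sector (S : SectorialRegion Ω ν) : Set (Surface Ω) :=
  {q | ∃ p ∈ Set.Ioi S.innerRadius ×ˢ Set.Ioo S.argMin S.argMax, ∃ h,
    q = Surface.mk (((Path.segment 0 S.start).trans S.path).trans
      (polarPath S.vertex S.finish p)) h}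

/-- The region as a subset of `𝓡_Ω`. -/
def carrier (S : SectorialRegion Ω ν) : Set (Surface Ω) := S.disc ∪ S.tube ∪ S.sector

end SectorialRegion

/-- Summable-resurgent functions: resurgent functions that grow at most exponentially at infinity
on every sectorial region. -/
def IsSummableResurgentFunction {Ω : Set ℂ} (φ : Surface Ω → ℂ) : Prop :=
  IsResurgentFunction φ ∧
    ∀ (ν : ℝ) (S : SectorialRegion Ω ν), ∃ C K R : ℝ, ∀ q ∈ S.carrier,
      R ≤ ‖q.proj‖ → ‖φ q‖ ≤ C * Real.exp (K * ‖q.proj‖)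

/-- The Borel transform, `x^m ↦ ξ^(m-1) / (m-1)!` for `m ≥ 1`. The finitely many terms `x^m`
with `m ≤ 0` are sent to derivatives of the Dirac `δ` at `0`, which play no part in the
convergence and the continuation and are left out. -/
def borel (f : ℂ⸨X⸩) : ℂ⟦X⟧ :=
  PowerSeries.mk fun m => f.coeff ((m : ℤ) + 1) / (m.factorial : ℂ)

/-- The function `φ` on `𝓡_Ω` is given near `0` on the first sheet by the power series `g`. -/
def Continues {Ω : Set ℂ} (φ : Surface Ω → ℂ) (g : ℂ⟦X⟧) : Prop :=
  ∀ᶠ w in nhds (0 : ℂ), ∃ h : IsAdmissible Ω (Path.segment 0 w),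
    HasSum (fun m : ℕ => PowerSeries.coeff m g * w ^ m) (φ (Surface.mk (Path.segment 0 w) h))

/-- Summable-resurgent series with singular support `Ω, 0`: the Borel transform converges near
`0` and continues to a summable-resurgent function on `𝓡_Ω`. -/
def IsSummableResurgentSeries (Ω : Set ℂ) (f : ℂ⸨X⸩) : Prop :=
  IsConvergent (borel f) ∧
    ∃ φ : Surface Ω → ℂ, IsSummableResurgentFunction φ ∧ Continues φ (borel f)

end LevelOne

end

noncomputable section

namespace LevelOne

open Topology Filter

set_option linter.unusedSectionVars false

/-! ### The étale space of the germs of solutions of a linear differential equation -/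

section Germs

variable {E : Type} [NormedAddCommGroup E] [NormedSpace ℂ E] [CompleteSpace E]

/-! Since F is invertible, F = x^{-s} p G, where p is a polynomial matrix (a truncation of x^s F)
with nonzero determinant and G = 1 + O(x²). A gauge transformation that is tangent to the identity
to second order does not disturb A₀ = D + xL modulo x², so G solves x²G' + G A₀ = (A₀ + x²B) G; the
matrix B is convergent because the same system is obtained from A by the gauge p
(`exists_reduction`). As p is polynomial, the entries of F are finite linear combinations of series
x^t G_{ik} with t an integer, and it suffices to treat these.

Let u_l be the coefficient of x^{l+1} in such a series and û(z) = ∑ u_l z^l / l!. For the entries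
(i, k) jointly, with ω the difference of the corresponding Stokes values, the system becomes (z - ω)
û = Ĉ + K̂ * û up to a constant, with Ĉ and K̂ entire of exponential type because B converges
(`reduced_eqn`). The recursion for u_l gives convergence of û near 0 (`exists_norm_u_le`).

To continue û, the convolution equation is made local. The functions h_m = Ĉ^{(m)} + K̂^{(m)} * û
satisfy h_m' = h_{m+1} + K_m û, and (z - ω) û' = h_1 + K_0 û - û. With y_0 = û and y_m = c^{-m} h_m
for m ≥ 1 this is a linear differential equation y' = T(z) y in a Banach space of bounded sequences,
where T has only simple poles, at the points ω, and is bounded away from them up to infinity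
(`exists_linearODE`).

A linear equation can be continued along every path that avoids the poles, and the result depends on
the homotopy class only, by the monodromy theorem in the étale space of germs of solutions
(`exists_isLift`, `endGerm_congr`). Grönwall's inequality bounds the solution by the exponential of
a constant times the length of the path; in a sector that length is O(|z|), whence the exponential
growth (`exists_norm_value_le_of_mem_sector`). -/

/-- Near `z`, the analytic function `f` solves `df/dz = T f` off `Ω`. -/
def IsSol (T : ℂ → E →L[ℂ] E) (Ω : Set ℂ) (f : ℂ → E) (z : ℂ) : Prop :=
  AnalyticAt ℂ f z ∧ ∀ᶠ w in 𝓝 z, w ∉ Ω → HasDerivAt f (T w (f w)) w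

theorem IsSol.eventually {T : ℂ → E →L[ℂ] E} {Ω : Set ℂ} {f : ℂ → E} {z : ℂ}
    (h : IsSol T Ω f z) : ∀ᶠ w in 𝓝 z, IsSol T Ω f w := by
  filter_upwards [h.1.eventually_analyticAt, h.2.eventually_nhds] with w h1 h2
  exact ⟨h1, h2⟩

/-- Germs of analytic solutions of `df/dz = T f`. -/
@[ext]
structure SolGerm (T : ℂ → E →L[ℂ] E) (Ω : Set ℂ) where
  /-- base point of the germ -/
  pt : ℂ
  /-- the germ itself -/
  germ : (𝓝 pt).Germ E
  exists_rep : ∃ f : ℂ → E, IsSol T Ω f pt ∧ germ = (f : (𝓝 pt).Germ E)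

namespace SolGerm

variable {T : ℂ → E →L[ℂ] E} {Ω : Set ℂ}

/-- The germ at `z` of the solution `f`. -/
def of (f : ℂ → E) (z : ℂ) (h : IsSol T Ω f z) : SolGerm T Ω := ⟨z, f, f, h, rfl⟩

/-- The value of a germ at its base point. -/
def val (x : SolGerm T Ω) : E := x.germ.value

@[simp] theorem pt_of {f : ℂ → E} {z : ℂ} (h : IsSol T Ω f z) : (of f z h).pt = z := rfl

@[simp] theorem val_of {f : ℂ → E} {z : ℂ} (h : IsSol T Ω f z) : (of f z h).val = f z := rfl

theorem of_eq_of {f g : ℂ → E} {z : ℂ} (hf : IsSol T Ω f z) (hg : IsSol T Ω g z)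
    (h : f =ᶠ[𝓝 z] g) : of f z hf = of g z hg := by
  unfold of
  congr 1
  exact Filter.Germ.coe_eq.2 h

theorem eventuallyEq_of_of_eq_of {f g : ℂ → E} {z : ℂ} {hf : IsSol T Ω f z} {hg : IsSol T Ω g z}
    (h : of f z hf = of g z hg) : f =ᶠ[𝓝 z] g := by
  unfold of at h
  simpa using h

theorem exists_eq_of (x : SolGerm T Ω) : ∃ f h, x = of f x.pt h := by
  obtain ⟨z, φ, f, hf, rfl⟩ := x
  exact ⟨f, hf, rfl⟩

/-- The étale topology: the sheets of local solutions over open sets form a basis, so a continuous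
path of germs is one that locally follows a single solution. -/
instance : TopologicalSpace (SolGerm T Ω) where
  IsOpen s := ∀ (f : ℂ → E) (z : ℂ) (h : IsSol T Ω f z), of f z h ∈ s →
    ∀ᶠ w in 𝓝 z, ∀ h' : IsSol T Ω f w, of f w h' ∈ s
  isOpen_univ := by simp
  isOpen_inter s t hs ht f z h hz := by
    filter_upwards [hs f z h hz.1, ht f z h hz.2] with w h1 h2 h' using ⟨h1 h', h2 h'⟩
  isOpen_sUnion S hS f z h hz := by
    obtain ⟨s, hs, hz⟩ := hz
    filter_upwards [hS s hs f z h hz] with w h1 h2 using ⟨s, hs, h1 h2⟩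

/-- The germs of `f` at the points of `U`. -/
def sheet (T : ℂ → E →L[ℂ] E) (Ω : Set ℂ) (f : ℂ → E) (U : Set ℂ) : Set (SolGerm T Ω) :=
  {x | ∃ w ∈ U, ∃ h : IsSol T Ω f w, x = of f w h}

/-- Functions with equal germs at a point have equal germs at all nearby points. -/
theorem isOpen_sheet (f : ℂ → E) {U : Set ℂ} (hU : IsOpen U) : IsOpen (sheet T Ω f U) := by
  rintro g z hg ⟨w, hw, hf, h⟩
  obtain rfl : z = w := congrArg SolGerm.pt h
  filter_upwards [hU.mem_nhds hw, hf.eventually, (eventuallyEq_of_of_eq_of h).eventuallyEq_nhds]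
    with w h1 h2 h3 h4
  exact ⟨w, h1, h2, of_eq_of _ _ h3⟩

theorem continuous_pt : Continuous (pt : SolGerm T Ω → ℂ) := by
  refine continuous_def.2 fun U hU f z h hz => ?_
  filter_upwards [hU.mem_nhds hz] with w hw _ using hw

theorem isOpenMap_pt : IsOpenMap (pt : SolGerm T Ω → ℂ) := by
  intro s hs
  rw [isOpen_iff_mem_nhds]
  rintro z ⟨x, hx, rfl⟩
  obtain ⟨f, h, e⟩ := exists_eq_of x
  have hx' : of f x.pt h ∈ s := by rwa [← e]
  filter_upwards [hs f _ h hx', h.eventually] with w h1 h2 using ⟨_, h1 h2, rfl⟩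

/-- On the sheet of one function a germ is determined by its base point, so `pt` is injective there,
besides being continuous and open. -/
theorem isLocalHomeomorph_pt : IsLocalHomeomorph (pt : SolGerm T Ω → ℂ) := by
  rw [isLocalHomeomorph_iff_isOpenEmbedding_restrict]
  intro x
  obtain ⟨f, h, e⟩ := exists_eq_of x
  have ho := isOpen_sheet (T := T) (Ω := Ω) f isOpen_univ
  refine ⟨sheet T Ω f Set.univ, ho.mem_nhds ⟨_, Set.mem_univ _, h, e⟩, ?_⟩
  refine .of_continuous_injective_isOpenMap (continuous_pt.comp continuous_subtype_val) ?_
    (isOpenMap_pt.comp ho.isOpenMap_subtype_val)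
  intro y y' hyy
  obtain ⟨w, -, hw, e⟩ := y.2
  obtain ⟨w', -, hw', e'⟩ := y'.2
  have hyy : y.1.pt = y'.1.pt := hyy
  rw [e, e'] at hyy
  obtain rfl : w = w' := hyy
  exact Subtype.ext (e.trans e'.symm)

/-- The identity theorem: if the sheets of two germs over a small ball met anywhere, the two
functions would agree on the ball. Uniqueness of lifts rests on this. -/
theorem isSeparatedMap_pt : IsSeparatedMap (pt : SolGerm T Ω → ℂ) := by
  intro x y hxy hne
  obtain ⟨f, hf, ef⟩ := exists_eq_of x
  obtain ⟨g, hg, eg⟩ := exists_eq_of y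
  -- A free variable for the common base point, so that both germs can be rewritten over it.
  obtain ⟨z, hz⟩ : ∃ z, z = x.pt := ⟨_, rfl⟩
  rw [← hxy] at hg
  have eg' : y = of g x.pt hg := by
    rw [eg]
    clear ef eg hne
    congr 1
    exact hxy.symm
  clear eg
  rw [← hz] at hf hg
  have ef : x = of f z hf := by rw [ef]; subst hz; rfl
  have eg : y = of g z hg := by rw [eg']; subst hz; rfl
  subst ef eg
  obtain ⟨r, hr, hb⟩ := Metric.eventually_nhds_iff_ball.1
    (hf.1.eventually_analyticAt.and hg.1.eventually_analyticAt)
  refine ⟨_, _, isOpen_sheet f Metric.isOpen_ball, isOpen_sheet g Metric.isOpen_ball,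
    ⟨z, Metric.mem_ball_self hr, hf, rfl⟩, ⟨z, Metric.mem_ball_self hr, hg, rfl⟩, ?_⟩
  rw [Set.disjoint_left]
  rintro _ ⟨w, hw, h1, rfl⟩ ⟨w', hw', h2, h3⟩
  obtain rfl : w = w' := congrArg SolGerm.pt h3
  refine hne (of_eq_of _ _ ?_)
  have := AnalyticOnNhd.eqOn_of_preconnected_of_eventuallyEq (𝕜 := ℂ) (fun x hx => (hb x hx).1)
    (fun x hx => (hb x hx).2) (convex_ball z r).isPreconnected hw (eventuallyEq_of_of_eq_of h3)
  exact this.eventuallyEq_of_mem (Metric.ball_mem_nhds z hr)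

theorem continuousOn_of_comp {A : Type*} [TopologicalSpace A] {s : Set A} {f : ℂ → E} {γ : A → ℂ}
    (hγ : ContinuousOn γ s) {Γ : A → SolGerm T Ω}
    (hΓ : ∀ a ∈ s, ∃ h : IsSol T Ω f (γ a), Γ a = of f (γ a) h) : ContinuousOn Γ s := by
  intro a ha
  rw [ContinuousWithinAt, tendsto_nhds]
  intro V hV haV
  obtain ⟨h, e⟩ := hΓ a ha
  rw [e] at haV
  filter_upwards [hγ a ha (hV f _ h haV), self_mem_nhdsWithin] with b hb hbs
  obtain ⟨h2, e2⟩ := hΓ b hbs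
  rw [Set.mem_preimage, e2]
  exact hb h2

/-- Along a continuous path of germs, the germs are locally given by one function. -/
theorem exists_rep_of_continuous {A : Type*} [TopologicalSpace A] {Γ : A → SolGerm T Ω} {a : A}
    (hΓ : ContinuousAt Γ a) : ∃ f, IsSol T Ω f (Γ a).pt ∧
      ∀ᶠ b in 𝓝 a, (Γ b).val = f (Γ b).pt := by
  obtain ⟨f, h, e⟩ := exists_eq_of (Γ a)
  refine ⟨f, h, ?_⟩
  have : sheet T Ω f Set.univ ∈ 𝓝 (Γ a) :=
    (isOpen_sheet f isOpen_univ).mem_nhds ⟨_, Set.mem_univ _, h, e⟩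
  filter_upwards [hΓ this] with b hb
  obtain ⟨w, -, h', e'⟩ := hb
  simp [e']

end SolGerm

end Germs

/-! ### Sequences of geometric growth and power series -/

/-- A sequence that is controlled by a geometric convolution of its predecessors grows at most
geometrically. -/
theorem exists_geometric_bound {w : ℕ → ℝ} {K c : ℝ} (hK : 0 < K) (hc : 0 < c)
    (h : ∀ l, w l ≤ K * c ^ l + K * ∑ j ∈ Finset.range l, c ^ (l - j) * w j) :
    ∃ U R : ℝ, 0 < U ∧ 0 < R ∧ ∀ l, w l ≤ U * R ^ l := by
  -- The rate R = c (1 + 2K) makes R - c = 2Kc, so that the geometric sum equals R^l - c^l and its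
  -- second term cancels K c^l.
  refine ⟨2 * K, c * (1 + 2 * K), by positivity, by positivity, fun l => ?_⟩
  induction l using Nat.strong_induction_on with
  | _ l ih =>
    set R := c * (1 + 2 * K) with hR
    have hRc : R - c = 2 * K * c := by rw [hR]; ring
    have h1 : ∑ j ∈ Finset.range l, c ^ (l - j) * w j
        ≤ 2 * K * c * ∑ j ∈ Finset.range l, R ^ j * c ^ (l - 1 - j) := by
      rw [Finset.mul_sum]
      refine Finset.sum_le_sum fun j hj => ?_
      have hj' := Finset.mem_range.1 hj
      have : l - j = l - 1 - j + 1 := by omega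
      rw [this, pow_succ]
      calc c ^ (l - 1 - j) * c * w j ≤ c ^ (l - 1 - j) * c * (2 * K * R ^ j) := by
            gcongr; exact ih j hj'
        _ = _ := by ring
    have h2 : 2 * K * c * ∑ j ∈ Finset.range l, R ^ j * c ^ (l - 1 - j) = R ^ l - c ^ l := by
      rw [← geom_sum₂_mul R c l, hRc, mul_comm]
    have h3 : c ^ l ≤ R ^ l := by
      gcongr
      rw [hR]
      nlinarith
    calc w l ≤ K * c ^ l + K * (R ^ l - c ^ l) := by
          refine (h l).trans ?_
          gcongr
          exact h1.trans h2.le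
      _ = K * R ^ l := by ring
      _ ≤ 2 * K * R ^ l := by nlinarith [pow_pos (show (0 : ℝ) < R by positivity) l]

/-- As `exists_geometric_bound`, with a control that is available from some rank on. -/
theorem exists_geometric_bound_of_eventually {w : ℕ → ℝ} (hw : ∀ l, 0 ≤ w l) {K c : ℝ} (hK : 0 < K)
    (hc : 0 < c) (N : ℕ)
    (h : ∀ l ≥ N, w l ≤ K * c ^ l + K * ∑ j ∈ Finset.range l, c ^ (l - j) * w j) :
    ∃ U R : ℝ, 0 < U ∧ 0 < R ∧ ∀ l, w l ≤ U * R ^ l := by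
  -- Adding D to K lets the term K c^l alone dominate the finitely many values of rank below N.
  set D := ∑ l ∈ Finset.range N, w l / c ^ l with hD
  have hterm : ∀ l, 0 ≤ w l / c ^ l := fun l => div_nonneg (hw l) (by positivity)
  have hD0 : 0 ≤ D := Finset.sum_nonneg fun l _ => hterm l
  refine exists_geometric_bound (K := K + D) (by positivity) hc fun l => ?_
  have hs : 0 ≤ ∑ j ∈ Finset.range l, c ^ (l - j) * w j :=
    Finset.sum_nonneg fun j _ => mul_nonneg (by positivity) (hw j)
  rcases lt_or_ge l N with hl | hl
  · have h1 : w l / c ^ l ≤ D :=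
      Finset.single_le_sum (f := fun l => w l / c ^ l) (fun l _ => hterm l) (Finset.mem_range.2 hl)
    rw [div_le_iff₀ (by positivity)] at h1
    have := mul_nonneg (add_nonneg hK.le hD0) hs
    nlinarith [pow_pos hc l]
  · refine (h l hl).trans ?_
    gcongr <;> linarith

section Series

variable {E : Type*} [NormedAddCommGroup E] [NormedSpace ℂ E] [CompleteSpace E]

theorem norm_pow_smul_le {Y : ℕ → E} {C R : ℝ} (hY : ∀ l, ‖Y l‖ ≤ C * R ^ l) (z : ℂ) (l : ℕ) :
    ‖z ^ l • Y l‖ ≤ C * (R * ‖z‖) ^ l := by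
  rw [norm_smul, norm_pow, mul_pow]
  calc ‖z‖ ^ l * ‖Y l‖ ≤ ‖z‖ ^ l * (C * R ^ l) := by gcongr; exact hY l
    _ = _ := by ring

theorem summable_norm_pow_smul {Y : ℕ → E} {C R : ℝ} (hR : 0 < R) (hY : ∀ l, ‖Y l‖ ≤ C * R ^ l)
    {z : ℂ} (hz : R * ‖z‖ < 1) : Summable fun l => ‖z ^ l • Y l‖ :=
  .of_nonneg_of_le (fun _ => norm_nonneg _) (norm_pow_smul_le hY z)
    ((summable_geometric_of_lt_one (by positivity) hz).mul_left C)

/-- The factor l + 1 is absorbed into 2 ^ l; this is the source of the condition 2 * R * ‖z‖ < 1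
below. -/
theorem norm_succ_smul_le {Y : ℕ → E} {C R : ℝ} (hY : ∀ l, ‖Y l‖ ≤ C * R ^ l)
    (l : ℕ) :
    ‖((l : ℂ) + 1) • Y (l + 1)‖ ≤ C * R * (2 * R) ^ l := by
  rw [norm_smul]
  have h1 : ‖(l : ℂ) + 1‖ ≤ 2 ^ l := by
    have : ((l : ℂ) + 1) = ((l + 1 : ℕ) : ℂ) := by push_cast; rfl
    rw [this, Complex.norm_natCast]
    exact_mod_cast Nat.lt_two_pow_self (n := l)
  calc ‖(l : ℂ) + 1‖ * ‖Y (l + 1)‖ ≤ 2 ^ l * (C * R ^ (l + 1)) := by gcongr; exact hY _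
    _ = _ := by rw [mul_pow]; ring

/-- Termwise differentiation of a vector-valued power series. -/
theorem hasDerivAt_tsum_pow_smul {Y : ℕ → E} {C R : ℝ} (hR : 0 < R) (hC : 0 ≤ C)
    (hY : ∀ l, ‖Y l‖ ≤ C * R ^ l) {z : ℂ} (hz : 2 * R * ‖z‖ < 1) :
    HasDerivAt (fun z : ℂ => ∑' l, z ^ l • Y l) (∑' l : ℕ, z ^ l • (((l : ℂ) + 1) • Y (l + 1))) z := by
  obtain ⟨ρ, hzρ, hρ⟩ : ∃ ρ, ‖z‖ < ρ ∧ 2 * R * ρ < 1 := by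
    obtain ⟨ρ, h1, h2⟩ := exists_between (show ‖z‖ < 1 / (2 * R) by
      rwa [lt_div_iff₀' (by positivity)])
    exact ⟨ρ, h1, by rwa [lt_div_iff₀' (by positivity)] at h2⟩
  have hρ0 : 0 < ρ := (norm_nonneg z).trans_lt hzρ
  have hY' := norm_succ_smul_le hY
  have key := hasDerivAt_tsum_of_isPreconnected (𝕜 := ℂ)
    (g := fun l (z : ℂ) => z ^ (l + 1) • Y (l + 1))
    (g' := fun l z => z ^ l • (((l : ℂ) + 1) • Y (l + 1)))
    (u := fun l => C * R * (2 * R * ρ) ^ l) (t := Metric.ball 0 ρ) (y₀ := 0) (y := z)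
    ((summable_geometric_of_lt_one (by positivity) hρ).mul_left _)
    Metric.isOpen_ball (convex_ball _ _).isPreconnected ?_ ?_ (Metric.mem_ball_self hρ0) ?_
    (by simpa using hzρ)
  · have hsplit : ∀ᶠ w in 𝓝 z, ∑' l, w ^ l • Y l = Y 0 + ∑' l, w ^ (l + 1) • Y (l + 1) := by
      have : Metric.ball (0 : ℂ) ρ ∈ 𝓝 z := Metric.isOpen_ball.mem_nhds (by simpa using hzρ)
      filter_upwards [this] with w hw
      have hw' : ‖w‖ < ρ := by simpa using hw
      rw [(summable_norm_pow_smul hR hY (z := w) (by nlinarith [norm_nonneg w])).of_norm.tsum_eq_zero_add]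
      simp
    exact (key.const_add (Y 0)).congr_of_eventuallyEq hsplit
  · intro l w _
    have := (hasDerivAt_pow (l + 1) w).smul_const (Y (l + 1))
    simpa [smul_smul, mul_comm] using this
  · intro l w hw
    have hw' : ‖w‖ < ρ := by simpa using hw
    refine (norm_pow_smul_le hY' w l).trans ?_
    gcongr
  · exact summable_zero.congr fun l => by simp

end Series

/-! ### Linear differential equations in a Banach space -/

section ODE

variable {E : Type*} [NormedAddCommGroup E] [NormedSpace ℂ E] [CompleteSpace E]

/-- Coefficients of the power series solution of `dU/dz = (∑ τ_k z^k) U`, `U(0) = 1`. -/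
def odeCoeff {𝔸 : Type*} [Ring 𝔸] [Algebra ℂ 𝔸] (τ : ℕ → 𝔸) : ℕ → 𝔸
  | 0 => 1
  | k + 1 => ((k : ℂ) + 1)⁻¹ • ∑ j : Fin (k + 1), τ (k - j) * odeCoeff τ j

theorem succ_smul_odeCoeff {𝔸 : Type*} [Ring 𝔸] [Algebra ℂ 𝔸] (τ : ℕ → 𝔸) (k : ℕ) :
    ((k : ℂ) + 1) • odeCoeff τ (k + 1)
      = ∑ j ∈ Finset.range (k + 1), τ (k - j) * odeCoeff τ j := by
  rw [odeCoeff, smul_smul, mul_inv_cancel₀ (by exact_mod_cast Nat.succ_ne_zero k), one_smul,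
    Finset.sum_range]

/-- Only degrees up to k enter the coefficient k + 1, which turns C into C / R in the geometric
convolution; the division by k + 1 is given away. The term ‖1‖ serves the initial coefficient. -/
theorem norm_odeCoeff_le {𝔸 : Type*} [NormedRing 𝔸] [NormedAlgebra ℂ 𝔸] {τ : ℕ → 𝔸} {C R : ℝ}
    (hC : 0 ≤ C) (hR : 0 < R) (hτ : ∀ k, ‖τ k‖ ≤ C * R ^ k) :
    ∃ U R' : ℝ, 0 < U ∧ 0 < R' ∧ ∀ l, ‖odeCoeff τ l‖ ≤ U * R' ^ l := by
  refine exists_geometric_bound (K := 1 + ‖(1 : 𝔸)‖ + C / R) (by positivity) hR fun l => ?_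
  have hs : 0 ≤ ∑ j ∈ Finset.range l, R ^ (l - j) * ‖odeCoeff τ j‖ :=
    Finset.sum_nonneg fun j _ => by positivity
  cases l with
  | zero =>
    have : 0 ≤ C / R := by positivity
    simp [odeCoeff]
    linarith
  | succ k =>
    have h1 : ‖odeCoeff τ (k + 1)‖ ≤ ‖((k : ℂ) + 1) • odeCoeff τ (k + 1)‖ := by
      rw [norm_smul]
      have : (1 : ℝ) ≤ ‖(k : ℂ) + 1‖ := by
        have : ((k : ℂ) + 1) = ((k + 1 : ℕ) : ℂ) := by push_cast; rfl
        rw [this, Complex.norm_natCast]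
        simp
      nlinarith [norm_nonneg (odeCoeff τ (k + 1))]
    rw [succ_smul_odeCoeff] at h1
    have h2 : ‖∑ j ∈ Finset.range (k + 1), τ (k - j) * odeCoeff τ j‖
        ≤ C / R * ∑ j ∈ Finset.range (k + 1), R ^ (k + 1 - j) * ‖odeCoeff τ j‖ := by
      rw [Finset.mul_sum]
      refine norm_sum_le_of_le _ fun j hj => ?_
      have hj' := Finset.mem_range.1 hj
      have : k + 1 - j = k - j + 1 := by omega
      rw [this, pow_succ]
      calc _ ≤ C * R ^ (k - j) * ‖odeCoeff τ j‖ := (norm_mul_le _ _).trans (by gcongr; exact hτ _)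
        _ = _ := by field_simp
    have h3 : 0 ≤ R ^ (k + 1) := by positivity
    have h4 : 0 ≤ C / R := by positivity
    have h5 : 0 ≤ ‖(1 : 𝔸)‖ := norm_nonneg _
    have h6 : 0 ≤ (1 + ‖(1 : 𝔸)‖ + C / R) * R ^ (k + 1) := by positivity
    refine h1.trans (h2.trans ?_)
    refine le_add_of_nonneg_of_le h6 ?_
    gcongr
    linarith

/-- Local fundamental solutions of a linear differential equation with analytic coefficients. -/
theorem exists_fundamental_solution {𝔸 : Type*} [NormedRing 𝔸] [NormedAlgebra ℂ 𝔸]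
    [CompleteSpace 𝔸] {T : ℂ → 𝔸} {z₀ : ℂ} (hT : AnalyticAt ℂ T z₀) :
    ∃ U : ℂ → 𝔸, U z₀ = 1 ∧ ∀ᶠ w in 𝓝 z₀, HasDerivAt U (T w * U w) w := by
  obtain ⟨p, hp⟩ := hT
  obtain ⟨r, hr0, hr⟩ := ENNReal.lt_iff_exists_nnreal_btwn.1 hp.radius_pos
  have hr0' : 0 < r := by exact_mod_cast hr0
  obtain ⟨C, hC, hbound⟩ := p.norm_le_div_pow_of_pos_of_lt_radius hr0' hr
  have hτ : ∀ k, ‖p.coeff k‖ ≤ C * ((r : ℝ)⁻¹) ^ k := fun k => by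
    rw [← p.norm_apply_eq_norm_coef]
    simpa [div_eq_mul_inv] using hbound k
  have hR : 0 < (r : ℝ)⁻¹ := by positivity
  obtain ⟨B, R, hB, hR', hU⟩ := norm_odeCoeff_le hC.le hR hτ
  refine ⟨fun z => ∑' l, (z - z₀) ^ l • odeCoeff p.coeff l, ?_, ?_⟩
  · simp only [sub_self]
    rw [tsum_eq_single 0 (fun l hl => by simp [hl])]
    simp [odeCoeff]
  · have hcont : Tendsto (fun w : ℂ => w - z₀) (𝓝 z₀) (𝓝 0) := by
      have : Continuous fun w : ℂ => w - z₀ := by fun_prop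
      simpa using this.tendsto z₀
    have hsmall : ∀ ρ : ℝ, ∀ᶠ w : ℂ in 𝓝 0, ρ * ‖w‖ < 1 := fun ρ => by
      have : Continuous fun w : ℂ => ρ * ‖w‖ := by fun_prop
      exact this.continuousAt.eventually_lt continuousAt_const (by simp)
    filter_upwards [hcont.eventually (hasFPowerSeriesAt_iff.1 hp), hcont.eventually (hsmall (2 * R)),
      hcont.eventually (hsmall (r : ℝ)⁻¹)] with w h1 h2 h3
    have h4 : R * ‖w - z₀‖ < 1 := by nlinarith [mul_nonneg hR'.le (norm_nonneg (w - z₀))]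
    have hd := (hasDerivAt_tsum_pow_smul hR' hB.le hU h2).comp_sub_const w z₀
    refine hd.congr_deriv ?_
    rw [add_sub_cancel] at h1
    rw [← h1.tsum_eq]
    symm
    rw [tsum_mul_tsum_eq_tsum_sum_antidiagonal_of_summable_norm
      (summable_norm_pow_smul hR hτ h3) (summable_norm_pow_smul hR' hU h4)]
    congr 1
    funext k
    rw [succ_smul_odeCoeff, Finset.smul_sum, Finset.Nat.sum_antidiagonal_eq_sum_range_succ_mk,
      ← Finset.sum_range_reflect]
    refine Finset.sum_congr rfl fun j hj => ?_
    have hj' := Finset.mem_range.1 hj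
    have e1 : k + 1 - 1 - j = k - j := by omega
    have e2 : k - (k - j) = j := by omega
    simp only [e1, e2]
    rw [smul_mul_smul_comm, ← pow_add]
    congr 2
    omega

/-- A fundamental solution equal to 1 at z stays invertible on a ball, so every Cauchy problem posed
in the ball is solved on all of it. The radius depends on neither z₁ nor e, as the subdivision in
`exists_isLift` requires. -/
theorem exists_solution_through {T : ℂ → E →L[ℂ] E} {Ω : Set ℂ} (hΩ : IsClosed Ω)
    (hT : DifferentiableOn ℂ T Ωᶜ) {z : ℂ} (hz : z ∉ Ω) :
    ∃ r > 0, Metric.ball z r ⊆ Ωᶜ ∧ ∀ z₁ ∈ Metric.ball z r, ∀ e : E, ∃ f : ℂ → E,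
      f z₁ = e ∧ ∀ w ∈ Metric.ball z r, HasDerivAt f (T w (f w)) w := by
  obtain ⟨U, hU1, hU⟩ := exists_fundamental_solution
    (hT.analyticAt (hΩ.isOpen_compl.mem_nhds hz))
  have hunit : ∀ᶠ w in 𝓝 z, IsUnit (U w) := by
    have hc : ContinuousAt U z := hU.self_of_nhds.continuousAt
    exact hc.eventually (by rw [hU1]; exact Units.isOpen.mem_nhds isUnit_one)
  obtain ⟨r, hr, hb⟩ := Metric.eventually_nhds_iff_ball.1
    ((hU.and hunit).and (hΩ.isOpen_compl.mem_nhds hz))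
  refine ⟨r, hr, fun w hw => (hb w hw).2, fun z₁ hz₁ e => ?_⟩
  refine ⟨fun w => U w (Ring.inverse (U z₁) e), ?_, fun w hw => ?_⟩
  · change (U z₁ * Ring.inverse (U z₁)) e = e
    rw [Ring.mul_inverse_cancel _ (hb z₁ hz₁).1.2]
    rfl
  · exact (hb w hw).1.1.clm_apply (hasDerivAt_const w _) |>.congr_deriv (by simp)

/-- The Grönwall inequality on the unit interval. -/
theorem norm_le_of_norm_deriv_le {E : Type*} [NormedAddCommGroup E] [NormedSpace ℝ E]
    {y y' : ℝ → E} {K : ℝ} (hy : ContinuousOn y (Set.Icc 0 1))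
    (hy' : ∀ t ∈ Set.Ico (0 : ℝ) 1, HasDerivWithinAt y (y' t) (Set.Ici t) t)
    (hK : ∀ t ∈ Set.Ico (0 : ℝ) 1, ‖y' t‖ ≤ K * ‖y t‖) : ‖y 1‖ ≤ ‖y 0‖ * Real.exp K := by
  have := norm_le_gronwallBound_of_norm_deriv_right_le hy hy' le_rfl
    (fun t ht => (hK t ht).trans_eq (add_zero _).symm) 1 (by simp)
  simpa [gronwallBound_ε0] using this

/-- Uniqueness for the Cauchy problem: Grönwall's inequality for f - g along each segment that
issues from z. -/
theorem eventuallyEq_of_solutions {T : ℂ → E →L[ℂ] E} {z : ℂ} (hT : ContinuousAt T z)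
    {f g : ℂ → E} (hf : ∀ᶠ w in 𝓝 z, HasDerivAt f (T w (f w)) w)
    (hg : ∀ᶠ w in 𝓝 z, HasDerivAt g (T w (g w)) w) (hfg : f z = g z) : f =ᶠ[𝓝 z] g := by
  have hB : ∀ᶠ w in 𝓝 z, ‖T w‖ < ‖T z‖ + 1 := hT.norm.eventually_lt continuousAt_const (by simp)
  obtain ⟨r, hr, hb⟩ := Metric.eventually_nhds_iff_ball.1 ((hf.and hg).and hB)
  refine Filter.eventuallyEq_of_mem (Metric.ball_mem_nhds z hr) fun w hw => ?_
  have hline : ∀ t : ℝ, t ∈ Set.Icc (0 : ℝ) 1 → z + t * (w - z) ∈ Metric.ball z r := by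
    intro t ht
    rw [Metric.mem_ball, dist_eq_norm] at hw ⊢
    rw [add_sub_cancel_left, norm_mul, Complex.norm_real, Real.norm_of_nonneg ht.1]
    nlinarith [norm_nonneg (w - z), ht.2]
  have hd : ∀ t ∈ Set.Icc (0 : ℝ) 1, HasDerivAt (fun t : ℝ => f (z + t * (w - z)) - g (z + t * (w - z)))
      ((w - z) • T (z + t * (w - z)) (f (z + t * (w - z)) - g (z + t * (w - z)))) t := by
    intro t ht
    have h0 : HasDerivAt (fun t : ℝ => z + t * (w - z)) (w - z) t := by
      have := ((Complex.ofRealCLM.hasDerivAt (x := t)).mul_const (w - z)).const_add z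
      simpa using this
    have h1 := hb _ (hline t ht)
    have := (h1.1.1.scomp t h0).sub (h1.1.2.scomp t h0)
    refine this.congr_deriv ?_
    rw [← smul_sub, map_sub]
  have := norm_le_of_norm_deriv_le (K := ‖w - z‖ * (‖T z‖ + 1))
    (fun t ht => (hd t ht).continuousAt.continuousWithinAt)
    (fun t ht => (hd t ⟨ht.1, ht.2.le⟩).hasDerivWithinAt) (fun t ht => by
      rw [norm_smul, mul_assoc]
      gcongr
      refine (ContinuousLinearMap.le_opNorm _ _).trans ?_
      gcongr
      exact (hb _ (hline t ⟨ht.1, ht.2.le⟩)).2.le)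
  simpa [hfg, sub_eq_zero] using this

end ODE

/-! ### Continuation of a solution to the Riemann surface -/

section Paths

theorem trans_half {X : Type*} [TopologicalSpace X] {x y z : X} (γ : Path x y) (γ' : Path y z)
    (s t : I) (h : (t : ℝ) = s / 2) : γ.trans γ' t = γ s := by
  rw [Path.trans_apply, dif_pos (by rw [h]; linarith [s.2.2])]
  congr 1
  ext
  simp only [h]
  ring

theorem trans_half_add {X : Type*} [TopologicalSpace X] {x y z : X} (γ : Path x y) (γ' : Path y z)
    (s t : I) (h : (t : ℝ) = (1 + s) / 2) : γ.trans γ' t = γ' s := by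
  rw [Path.trans_apply]
  split_ifs with ht
  · have hs : s = 0 := Subtype.ext (le_antisymm (by rw [h] at ht; simp; linarith) s.2.1)
    subst hs
    have e : (⟨2 * t, (unitInterval.mul_pos_mem_iff zero_lt_two).2 ⟨t.2.1, ht⟩⟩ : I) = 1 := by
      ext
      simp [h]
    rw [γ'.source]
    exact (congrArg γ e).trans γ.target
  · congr 1
    ext
    simp only [h]
    ring

theorem forall_trans {X : Type*} [TopologicalSpace X] {x y z : X} (γ : Path x y) (γ' : Path y z)
    (t : I) : (∃ s : I, (t : ℝ) = s / 2 ∧ γ.trans γ' t = γ s) ∨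
      ∃ s : I, (t : ℝ) = (1 + s) / 2 ∧ γ.trans γ' t = γ' s := by
  rcases le_total (t : ℝ) (1 / 2) with h | h
  · refine Or.inl ⟨⟨2 * t, by linarith [t.2.1], by linarith⟩, by simp, trans_half _ _ _ _ (by simp)⟩
  · refine Or.inr ⟨⟨2 * t - 1, by linarith, by linarith [t.2.2]⟩, by simp,
      trans_half_add _ _ _ _ (by simp)⟩

theorem IsAdmissible.eq_zero_of_mem {Ω : Set ℂ} {z : ℂ} {γ : Path (0 : ℂ) z}
    (h : IsAdmissible Ω γ) (hz : z ∈ Ω) : ∀ t, γ t = 0 := by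
  obtain ⟨t₀, h0, h1⟩ := h
  have : t₀ = 1 := by
    by_contra hne
    exact h1 1 (lt_of_le_of_ne t₀.2.2 hne) (by rwa [γ.target])
  exact fun t => h0 t (this ▸ t.2.2)

/-- Only one rest, at the start, is allowed. If z ∈ Ω then γ is constant at 0 and the rest extends
into γ' until (1 + t₁) / 2; otherwise γ has left 0 after time t₀ / 2 and a rest of γ' takes place at
z, off Ω. -/
theorem IsAdmissible.trans {Ω : Set ℂ} (h0 : (0 : ℂ) ∈ Ω) {z w : ℂ} {γ : Path (0 : ℂ) z}
    (h : IsAdmissible Ω γ) {γ' : Path z w} {t₁ : I} (h1 : ∀ t ≤ t₁, γ' t = z)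
    (h2 : ∀ t, t₁ < t → γ' t ∉ Ω) : IsAdmissible Ω (γ.trans γ') := by
  by_cases hz : z ∈ Ω
  · have hγ := h.eq_zero_of_mem hz
    have hz0 : z = 0 := by rw [← γ.target, hγ]
    refine ⟨⟨(1 + t₁) / 2, by linarith [t₁.2.1], by linarith [t₁.2.2]⟩, fun t ht => ?_,
      fun t ht => ?_⟩
    · have ht' : (t : ℝ) ≤ (1 + t₁) / 2 := ht
      rcases forall_trans γ γ' t with ⟨s, hs, e⟩ | ⟨s, hs, e⟩
      · rw [e, hγ]
      · rw [e, h1 s (by rw [← Subtype.coe_le_coe]; linarith), hz0]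
    · have ht' : (1 + t₁) / 2 < (t : ℝ) := ht
      rcases forall_trans γ γ' t with ⟨s, hs, e⟩ | ⟨s, hs, e⟩
      · linarith [s.2.2, t₁.2.1]
      · rw [e]
        exact h2 s (by rw [← Subtype.coe_lt_coe]; linarith)
  · obtain ⟨t₀, h3, h4⟩ := h
    refine ⟨⟨t₀ / 2, by linarith [t₀.2.1], by linarith [t₀.2.2]⟩, fun t ht => ?_, fun t ht => ?_⟩
    · have ht' : (t : ℝ) ≤ t₀ / 2 := ht
      rcases forall_trans γ γ' t with ⟨s, hs, e⟩ | ⟨s, hs, e⟩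
      · rw [e]
        exact h3 s (by rw [← Subtype.coe_le_coe]; linarith)
      · have : t₀ = 1 := Subtype.ext (le_antisymm t₀.2.2 (by simp; linarith [s.2.1]))
        refine absurd ?_ hz
        rw [← γ.target, h3 1 (by rw [this])]
        exact h0
    · have ht' : t₀ / 2 < (t : ℝ) := ht
      rcases forall_trans γ γ' t with ⟨s, hs, e⟩ | ⟨s, hs, e⟩
      · rw [e]
        exact h4 s (by rw [← Subtype.coe_lt_coe]; linarith)
      · rw [e]
        rcases le_or_gt s t₁ with h | h
        · rwa [h1 s h]
        · exact h2 s h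

/-- A segment that meets `Ω` at most at its start satisfies the hypotheses of
`IsAdmissible.trans`. -/
theorem segment_avoids {Ω : Set ℂ} {z w : ℂ} {r : ℝ} (hw : w ∈ Metric.ball z r)
    (hΩ : ∀ x ∈ Metric.ball z r, x ∈ Ω → x = z) :
    ∃ t₁ : I, (∀ t ≤ t₁, Path.segment z w t = z) ∧ ∀ t, t₁ < t → Path.segment z w t ∉ Ω := by
  by_cases hzw : w = z
  · subst hzw
    refine ⟨1, fun t _ => by simp, fun t ht => absurd ht (not_lt.2 t.2.2)⟩
  · refine ⟨0, fun t ht => ?_, fun t ht hmem => ?_⟩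
    · rw [show t = 0 from le_antisymm ht t.2.1]
      simp
    · have hb : Path.segment z w t ∈ Metric.ball z r := by
        refine (convex_ball z r).segment_subset
          (Metric.mem_ball_self ((dist_nonneg).trans_lt hw)) hw ?_
        rw [← Path.range_segment z w]
        exact ⟨t, rfl⟩
      have := hΩ _ hb hmem
      rw [Path.segment_apply, AffineMap.lineMap_apply] at this
      have ht0 : (t : ℝ) ≠ 0 := fun h => ht.ne' (Subtype.ext h)
      simp [sub_eq_zero, hzw, ht0] at this

end Paths

/-- A linear differential equation `df/dz = T f` with coefficients that are analytic off `Ω` and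
bounded away from `Ω`, with a solution near `0`. -/
structure LinearODE (Ω : Set ℂ) (E : Type) [NormedAddCommGroup E] [NormedSpace ℂ E] where
  /-- the coefficient -/
  T : ℂ → E →L[ℂ] E
  isClosed : IsClosed Ω
  zero_mem : (0 : ℂ) ∈ Ω
  differentiableOn : DifferentiableOn ℂ T Ωᶜ
  bounded : ∀ ν > 0, ∃ B, ∀ z, (∀ ω ∈ Ω, ν < dist z ω) → ‖T z‖ ≤ B
  /-- the solution near `0` -/
  f : ℂ → E
  /-- radius of a disc on which the solution `f` is defined -/
  r : ℝ
  r_pos : 0 < r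
  isSol : ∀ w ∈ Metric.ball 0 r, IsSol T Ω f w
  eq_zero_of_mem : ∀ w ∈ Metric.ball 0 r, w ∈ Ω → w = 0

namespace LinearODE

variable {Ω : Set ℂ} {E : Type} [NormedAddCommGroup E] [NormedSpace ℂ E] [CompleteSpace E]
  (D : LinearODE Ω E)

/-- The germ at `0` of the solution. -/
def base : SolGerm D.T Ω := SolGerm.of D.f 0 (D.isSol 0 (Metric.mem_ball_self D.r_pos))

/-- The path of germs `Γ` continues the solution along `γ`. -/
structure IsLift {z w : ℂ} (x : SolGerm D.T Ω) (γ : Path z w) (Γ : I → SolGerm D.T Ω) : Prop where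
  continuous : Continuous Γ
  pt : ∀ t, (Γ t).pt = γ t
  zero : Γ 0 = x

variable {D}

theorem IsLift.unique {z w : ℂ} {x : SolGerm D.T Ω} {γ : Path z w} {Γ Γ' : I → SolGerm D.T Ω}
    (h : D.IsLift x γ Γ) (h' : D.IsLift x γ Γ') : Γ = Γ' :=
  SolGerm.isSeparatedMap_pt.eq_of_comp_eq SolGerm.isLocalHomeomorph_pt.isLocallyInjective
    h.continuous h'.continuous (funext fun t => by simp [h.pt, h'.pt]) 0 (by rw [h.zero, h'.zero])

theorem IsLift.trans {z w v : ℂ} {x : SolGerm D.T Ω} {γ : Path z w} {γ' : Path w v}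
    {Γ Γ' : I → SolGerm D.T Ω} (h : D.IsLift x γ Γ) (h' : D.IsLift (Γ 1) γ' Γ') :
    ∃ Δ, D.IsLift x (γ.trans γ') Δ ∧ Δ 1 = Γ' 1 := by
  let p : Path x (Γ 1) := ⟨⟨Γ, h.continuous⟩, h.zero, rfl⟩
  let q : Path (Γ 1) (Γ' 1) := ⟨⟨Γ', h'.continuous⟩, h'.zero, rfl⟩
  refine ⟨p.trans q, ⟨(p.trans q).continuous, fun t => ?_, (p.trans q).source⟩,
    (p.trans q).target⟩
  rcases forall_trans p q t with ⟨s, hs, e⟩ | ⟨s, hs, e⟩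
  · rw [e, trans_half _ _ s t hs]
    exact h.pt s
  · rw [e, trans_half_add _ _ s t hs]
    exact h'.pt s

/-- Cuts a lift at the junction of a concatenation, so that the growth estimate can treat the polar
part alone. -/
theorem IsLift.left {z w v : ℂ} {x : SolGerm D.T Ω} {γ : Path z w} {γ' : Path w v}
    {Γ : I → SolGerm D.T Ω} (h : D.IsLift x (γ.trans γ') Γ) :
    ∃ Γ₁ Γ₂, D.IsLift x γ Γ₁ ∧ D.IsLift (Γ₁ 1) γ' Γ₂ ∧ Γ₂ 1 = Γ 1 := by
  have hc := h.continuous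
  refine ⟨fun s => Γ ⟨s / 2, by linarith [s.2.1], by linarith [s.2.2]⟩,
    fun s => Γ ⟨(1 + s) / 2, by linarith [s.2.1], by linarith [s.2.2]⟩,
    ⟨by fun_prop, fun s => ?_, ?_⟩, ⟨by fun_prop, fun s => ?_, ?_⟩, ?_⟩
  · rw [h.pt, trans_half _ _ s _ rfl]
  · rw [← h.zero]; congr 1; ext; simp
  · rw [h.pt, trans_half_add _ _ s _ rfl]
  · congr 1; ext; simp
  · exact congrArg Γ (Subtype.ext (by norm_num))

/-- A solution on `U` continues itself along the paths in `U`. -/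
theorem isLift_of {z w : ℂ} {U : Set ℂ} {f : ℂ → E} (hf : ∀ x ∈ U, IsSol D.T Ω f x)
    (γ : Path z w) (hγ : ∀ t, γ t ∈ U) (x : SolGerm D.T Ω)
    (hx : ∃ h, x = SolGerm.of f z h) :
    D.IsLift x γ fun t => SolGerm.of f (γ t) (hf _ (hγ t)) := by
  refine ⟨?_, fun t => rfl, ?_⟩
  · rw [← continuousOn_univ]
    exact SolGerm.continuousOn_of_comp γ.continuous.continuousOn fun t _ => ⟨_, rfl⟩
  · obtain ⟨h, rfl⟩ := hx
    congr 1
    exact γ.source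

variable (D)

/-- Near 0 the lift consists of germs of `D.f`. Once the path has left 0, the equation is solvable
on balls with arbitrary initial values, and a subdivision subordinate to these discs extends the
lift step by step. -/
theorem exists_isLift {z : ℂ} {γ : Path (0 : ℂ) z} (h : IsAdmissible Ω γ) :
    ∃ Γ, D.IsLift D.base γ Γ := by
  obtain ⟨t₀, h0, h1⟩ := h
  -- the path stays in the disc about `0` for a while after `t₀`
  obtain ⟨V, hV, hVconv, ht₀V⟩ : ∃ V : Set I, IsOpen V ∧
      (∀ t ∈ V, ∀ s ≤ t, γ s ∈ Metric.ball 0 D.r) ∧ ∀ t ≤ t₀, t ∈ V := by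
    have : ∀ᶠ t in 𝓝 t₀, γ t ∈ Metric.ball 0 D.r :=
      γ.continuous.continuousAt (Metric.isOpen_ball.mem_nhds
        (by rw [h0 t₀ le_rfl]; exact Metric.mem_ball_self D.r_pos))
    obtain ⟨ε, hε, hb⟩ := Metric.eventually_nhds_iff_ball.1 this
    refine ⟨{t | (t : ℝ) < t₀ + ε}, isOpen_lt continuous_subtype_val continuous_const,
      fun t ht s hs => ?_, fun t ht => ?_⟩
    · rcases le_total s t₀ with h | h
      · rw [h0 s h]; exact Metric.mem_ball_self D.r_pos
      · refine hb s ?_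
        have h' : (t₀ : ℝ) ≤ s := h
        have hs' : (s : ℝ) ≤ t := hs
        have ht' : (t : ℝ) < t₀ + ε := ht
        rw [Metric.mem_ball, Subtype.dist_eq, Real.dist_eq, abs_lt]
        constructor <;> linarith
    · have ht' : (t : ℝ) ≤ t₀ := ht
      change (t : ℝ) < t₀ + ε
      linarith
  have hloc := fun s : {s : I // t₀ < s} =>
    exists_solution_through D.isClosed D.differentiableOn (h1 s.1 s.2)
  choose r hr hrΩ hsol using hloc
  -- In the cover, `none` is the initial stretch V and `some s` the set of times at which the path
  -- is in the ball about γ s.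
  obtain ⟨t, ht0, hmono, ⟨n, hn⟩, hsub⟩ := exists_monotone_Icc_subset_open_cover_unitInterval
    (c := fun o : Option {s : I // t₀ < s} => o.elim V fun s => γ ⁻¹' Metric.ball (γ s) (r s))
    (by
      rintro (_ | s)
      · exact hV
      · exact Metric.isOpen_ball.preimage γ.continuous)
    (by
      intro s _
      rw [Set.mem_iUnion]
      rcases le_or_gt s t₀ with hs | hs
      · exact ⟨none, ht₀V s hs⟩
      · exact ⟨some ⟨s, hs⟩, Metric.mem_ball_self (hr _)⟩)
  have main : ∀ m, ∃ Γ : I → SolGerm D.T Ω, ContinuousOn Γ (Set.Icc 0 (t m)) ∧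
      (∀ s ∈ Set.Icc 0 (t m), (Γ s).pt = γ s) ∧ Γ 0 = D.base := by
    intro m
    induction m with
    | zero =>
      refine ⟨fun _ => D.base, continuousOn_const, fun s hs => ?_, rfl⟩
      rw [ht0, Set.Icc_self, Set.mem_singleton_iff] at hs
      rw [hs, γ.source]
      rfl
    | succ m ih =>
      obtain ⟨Γ, hc, hpt, hz⟩ := ih
      have hm : t m ≤ t (m + 1) := hmono m.le_succ
      have htm : t m ∈ Set.Icc 0 (t m) := ⟨(t m).2.1, le_rfl⟩
      classical
      obtain ⟨o, ho⟩ := hsub m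
      rcases o with _ | s
      -- The path has not yet left the initial disc: the lift is built anew from time 0 with `D.f`,
      -- without gluing.
      · have hball := hVconv (t (m + 1)) (ho ⟨hm, le_rfl⟩)
        refine ⟨fun s => if hs : γ s ∈ Metric.ball 0 D.r then SolGerm.of D.f (γ s) (D.isSol _ hs)
          else D.base, ?_, fun s hs => ?_, ?_⟩
        · exact SolGerm.continuousOn_of_comp (f := D.f) γ.continuous.continuousOn fun s hs =>
            ⟨_, dif_pos (hball s hs.2)⟩
        · beta_reduce
          rw [dif_pos (hball s hs.2)]
          rfl
        · beta_reduce
          rw [dif_pos (hball 0 unitInterval.nonneg')]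
          unfold base
          congr 1
          exact γ.source
      · have hball : ∀ s' ∈ Set.Icc (t m) (t (m + 1)), γ s' ∈ Metric.ball (γ s) (r s) := ho
        have htb := hball (t m) ⟨le_rfl, hm⟩
        -- The Cauchy datum is the value reached so far; uniqueness then identifies the new germ
        -- with the old one at the junction.
        obtain ⟨f, hfv, hf⟩ := hsol s (γ (t m)) htb (Γ (t m)).val
        have hfs : ∀ w ∈ Metric.ball (γ s) (r s), IsSol D.T Ω f w := fun w hw =>
          ⟨DifferentiableOn.analyticAt (s := Metric.ball (γ s) (r s))
            (fun x hx => (hf x hx).differentiableAt.differentiableWithinAt)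
            (Metric.isOpen_ball.mem_nhds hw),
          by filter_upwards [Metric.isOpen_ball.mem_nhds hw] with x hx _ using hf x hx⟩
        have hglue : Γ (t m) = SolGerm.of f (γ (t m)) (hfs _ htb) := by
          obtain ⟨g, hg, e⟩ := SolGerm.exists_eq_of (Γ (t m))
          have hp := hpt _ htm
          have hgv : (Γ (t m)).val = g (γ (t m)) := by rw [e, SolGerm.val_of, hp]
          rw [hp] at hg
          have e' : Γ (t m) = SolGerm.of g (γ (t m)) hg := by
            rw [e]; congr 1
          rw [e']
          have hmem : Ωᶜ ∈ 𝓝 (γ (t m)) := D.isClosed.isOpen_compl.mem_nhds (hrΩ s htb)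
          refine SolGerm.of_eq_of _ _ (eventuallyEq_of_solutions
            (D.differentiableOn.differentiableAt hmem).continuousAt ?_ ?_ ?_)
          · filter_upwards [hg.2, hmem] with w h1 h2 using h1 h2
          · filter_upwards [Metric.isOpen_ball.mem_nhds htb] with w hw using hf w hw
          · rw [hfv, hgv]
        have hne : ∀ s' (hs' : s' ∈ Set.Icc (t m) (t (m + 1))),
            (if s' ≤ t m then Γ s' else if hs : γ s' ∈ Metric.ball (γ s) (r s) then
              SolGerm.of f (γ s') (hfs _ hs) else D.base)
              = SolGerm.of f (γ s') (hfs _ (hball s' hs')) := by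
          intro s' hs'
          split_ifs with h h'
          · obtain rfl : s' = t m := le_antisymm h hs'.1
            exact hglue
          · rfl
          · exact absurd (hball s' hs') h'
        refine ⟨fun s' => if s' ≤ t m then Γ s' else if hs : γ s' ∈ Metric.ball (γ s) (r s) then
          SolGerm.of f (γ s') (hfs _ hs) else D.base, ?_, fun s' hs' => ?_, ?_⟩
        · rw [← Set.Icc_union_Icc_eq_Icc (unitInterval.nonneg' (t := t m)) hm]
          refine ContinuousOn.union_of_isClosed ?_ ?_ isClosed_Icc isClosed_Icc
          · exact hc.congr fun s' hs' => if_pos hs'.2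
          · exact SolGerm.continuousOn_of_comp (f := f) γ.continuous.continuousOn
              fun s' hs' => ⟨_, hne s' hs'⟩
        · rcases le_total s' (t m) with h | h
          · simp only [if_pos h]
            exact hpt s' ⟨hs'.1, h⟩
          · beta_reduce
            rw [hne s' ⟨h, hs'.2⟩]
            rfl
        · simp only [if_pos (unitInterval.nonneg' (t := t m))]
          exact hz
  obtain ⟨Γ, hc, hpt, hz⟩ := main n
  have hI : Set.Icc 0 (t n) = Set.univ := by
    rw [hn n le_rfl]
    exact Set.eq_univ_of_forall fun s => s.2
  rw [hI] at hc hpt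
  exact ⟨Γ, continuousOn_univ.1 hc, fun s => hpt s trivial, hz⟩

/-- The germ that is reached along an admissible path. -/
def endGerm {z : ℂ} (γ : {γ : Path (0 : ℂ) z // IsAdmissible Ω γ}) : SolGerm D.T Ω :=
  (D.exists_isLift γ.2).choose 1

theorem endGerm_eq {z : ℂ} {γ : Path (0 : ℂ) z} (h : IsAdmissible Ω γ) {Γ : I → SolGerm D.T Ω}
    (hΓ : D.IsLift D.base γ Γ) : D.endGerm ⟨γ, h⟩ = Γ 1 := by
  unfold endGerm
  rw [(D.exists_isLift h).choose_spec.unique hΓ]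

/-- Monodromy: the lifts of the intermediate paths all start at `D.base` and the end-point is fixed,
so the end germ does not vary. This makes `value` well defined. -/
theorem endGerm_congr {z : ℂ} {γ γ' : {γ : Path (0 : ℂ) z // IsAdmissible Ω γ}}
    (h : AdmissiblyHomotopic Ω γ γ') : D.endGerm γ = D.endGerm γ' := by
  obtain ⟨H, hH⟩ := h
  choose Γ hΓ using fun s => D.exists_isLift (hH s)
  have key := SolGerm.isLocalHomeomorph_pt.monodromy_theorem SolGerm.isSeparatedMap_pt H
    (fun s => ⟨Γ s, (hΓ s).continuous⟩) (fun s t => (hΓ s).pt t)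
    (fun s => by simp [(hΓ _).zero]) 1
  have h0 : D.IsLift D.base γ.1 (Γ 0) :=
    ⟨(hΓ 0).continuous, fun t => by rw [(hΓ 0).pt, H.eval_zero], (hΓ 0).zero⟩
  have h1 : D.IsLift D.base γ'.1 (Γ 1) :=
    ⟨(hΓ 1).continuous, fun t => by rw [(hΓ 1).pt, H.eval_one], (hΓ 1).zero⟩
  rw [show γ = ⟨γ.1, γ.2⟩ from rfl, show γ' = ⟨γ'.1, γ'.2⟩ from rfl, D.endGerm_eq γ.2 h0,
    D.endGerm_eq γ'.2 h1]
  exact key.symm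

/-- The continuation of the solution, as a function on the Riemann surface. -/
def value (q : Surface Ω) : E :=
  Quot.lift (fun γ => (D.endGerm γ).val) (fun _ _ h => by rw [D.endGerm_congr h]) q.2

theorem value_mk {z : ℂ} {γ : Path (0 : ℂ) z} (h : IsAdmissible Ω γ) {Γ : I → SolGerm D.T Ω}
    (hΓ : D.IsLift D.base γ Γ) : D.value (Surface.mk γ h) = (Γ 1).val := by
  rw [← D.endGerm_eq h hΓ]
  rfl

/-- A representative of the end germ also gives the continuation along short segments appended to
the path. At z = 0 these are admissible because 0 is isolated in Ω. -/
theorem exists_differentiableOn_value {z : ℂ} {γ : Path (0 : ℂ) z} (h : IsAdmissible Ω γ) :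
    ∃ r > 0, ∃ g : ℂ → E, DifferentiableOn ℂ g (Metric.ball z r) ∧
      ∀ w ∈ Metric.ball z r, ∃ h : IsAdmissible Ω (γ.trans (Path.segment z w)),
        D.value (Surface.mk (γ.trans (Path.segment z w)) h) = g w := by
  obtain ⟨Γ, hΓ⟩ := D.exists_isLift h
  obtain ⟨f, hf, e⟩ := SolGerm.exists_eq_of (Γ 1)
  have hp : (Γ 1).pt = z := by rw [hΓ.pt, γ.target]
  have hiso : ∀ᶠ w in 𝓝 z, w ∈ Ω → w = z := by
    by_cases hz : z ∈ Ω
    · have hz0 : z = 0 := by rw [← γ.target, h.eq_zero_of_mem hz]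
      subst hz0
      filter_upwards [Metric.ball_mem_nhds 0 D.r_pos] with w hw using D.eq_zero_of_mem w hw
    · filter_upwards [D.isClosed.isOpen_compl.mem_nhds hz] with w hw hw' using absurd hw' hw
  have hf' := hf
  rw [hp] at hf'
  obtain ⟨r, hr, hb⟩ := Metric.eventually_nhds_iff_ball.1 (hf'.eventually.and hiso)
  refine ⟨r, hr, f, fun w hw => (hb w hw).1.1.differentiableAt.differentiableWithinAt,
    fun w hw => ?_⟩
  obtain ⟨t₁, h1, h2⟩ := segment_avoids hw fun x hx => (hb x hx).2
  refine ⟨h.trans D.zero_mem h1 h2, ?_⟩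
  have hseg : ∀ t, Path.segment z w t ∈ Metric.ball z r := fun t => by
    refine (convex_ball z r).segment_subset (Metric.mem_ball_self hr) hw ?_
    rw [← Path.range_segment z w]
    exact ⟨t, rfl⟩
  obtain ⟨Δ, hΔ, eΔ⟩ := hΓ.trans (isLift_of (fun x hx => (hb x hx).1) (Path.segment z w) hseg (Γ 1)
    ⟨hf', by rw [e]; congr 1⟩)
  rw [D.value_mk _ hΔ, eΔ, SolGerm.val_of, Path.target]

theorem value_segment {w : ℂ} (hw : w ∈ Metric.ball 0 D.r) :
    ∃ h : IsAdmissible Ω (Path.segment 0 w), D.value (Surface.mk (Path.segment 0 w) h) = D.f w := by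
  obtain ⟨t₁, h1, h2⟩ := segment_avoids hw D.eq_zero_of_mem
  have hadm : IsAdmissible Ω (Path.segment 0 w) := ⟨t₁, h1, h2⟩
  refine ⟨hadm, ?_⟩
  have hseg : ∀ t, Path.segment 0 w t ∈ Metric.ball 0 D.r := fun t => by
    refine (convex_ball 0 D.r).segment_subset (Metric.mem_ball_self D.r_pos) hw ?_
    rw [← Path.range_segment 0 w]
    exact ⟨t, rfl⟩
  rw [D.value_mk _ (isLift_of D.isSol _ hseg D.base ⟨_, rfl⟩), SolGerm.val_of, Path.target]

/-- The Grönwall inequality for the continuation along a `C¹` path. -/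
theorem IsLift.norm_val_le {D : LinearODE Ω E} {z w : ℂ} {x : SolGerm D.T Ω} {γ : Path z w}
    {Γ : I → SolGerm D.T Ω} (h : D.IsLift x γ Γ) {c c' : ℝ → ℂ}
    (hc : ∀ t : I, γ t = c t) (hc' : ∀ t, HasDerivAt c (c' t) t) {B ℓ : ℝ}
    (hΩ : ∀ t, γ t ∉ Ω) (hB : ∀ t, ‖D.T (γ t)‖ ≤ B) (hℓ : ∀ t ∈ Set.Icc (0 : ℝ) 1, ‖c' t‖ ≤ ℓ) :
    ‖(Γ 1).val‖ ≤ ‖x.val‖ * Real.exp (ℓ * B) := by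
  set y : ℝ → E := fun t => (Γ (Set.projIcc 0 1 zero_le_one t)).val with hy
  have hproj : ∀ t : ℝ, ∀ ht : t ∈ Set.Icc (0 : ℝ) 1, Set.projIcc 0 1 zero_le_one t = ⟨t, ht⟩ :=
    fun t ht => Set.projIcc_of_mem zero_le_one ht
  have hcont : Continuous fun t : ℝ => Γ (Set.projIcc 0 1 zero_le_one t) :=
    h.continuous.comp continuous_projIcc
  have hpt : ∀ t ∈ Set.Icc (0 : ℝ) 1, (Γ (Set.projIcc 0 1 zero_le_one t)).pt = c t := by
    intro t ht
    rw [h.pt, hproj t ht, hc]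
  have hrep : ∀ t ∈ Set.Icc (0 : ℝ) 1, ∃ f : ℂ → E, ContinuousAt f (c t) ∧
      HasDerivAt f (D.T (c t) (f (c t))) (c t) ∧
      (∀ᶠ s in 𝓝 t, s ∈ Set.Icc (0 : ℝ) 1 → y s = f (c s)) := by
    intro t ht
    obtain ⟨f, hf, hev⟩ := SolGerm.exists_rep_of_continuous (a := t) hcont.continuousAt
    rw [hpt t ht] at hf
    refine ⟨f, hf.1.continuousAt, hf.2.self_of_nhds ?_, ?_⟩
    · have := hΩ ⟨t, ht⟩
      rwa [hc] at this
    · filter_upwards [hev] with s hs hsI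
      rw [hy]
      beta_reduce
      rw [hs, hpt s hsI]
  have key := norm_le_of_norm_deriv_le (y := y) (y' := fun t => c' t • D.T (c t) (y t))
    (K := ℓ * B) (fun t ht => ?_) (fun t ht => ?_) (fun t ht => ?_)
  · have e0 : y 0 = x.val := by
      rw [← h.zero, hy]; simp
    have e1 : y 1 = (Γ 1).val := by
      rw [hy]; simp
    rwa [e0, e1] at key
  · obtain ⟨f, hf, -, hev⟩ := hrep t ht
    have h1 : ContinuousAt (fun s => f (c s)) t :=
      ContinuousAt.comp (f := c) hf (hc' t).continuousAt
    refine h1.continuousWithinAt.congr_of_eventuallyEq ?_ (hev.self_of_nhds ht)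
    filter_upwards [mem_nhdsWithin_of_mem_nhds hev, self_mem_nhdsWithin] with s h1 h2 using h1 h2
  · have ht' : t ∈ Set.Icc (0 : ℝ) 1 := ⟨ht.1, ht.2.le⟩
    obtain ⟨f, -, hf, hev⟩ := hrep t ht'
    have h1 := (hf.scomp t (hc' t)).hasDerivWithinAt (s := Set.Ici t)
    rw [← hev.self_of_nhds ht'] at h1
    refine h1.congr_of_eventuallyEq ?_ (hev.self_of_nhds ht')
    filter_upwards [mem_nhdsWithin_of_mem_nhds hev, self_mem_nhdsWithin,
      mem_nhdsWithin_of_mem_nhds (Iio_mem_nhds ht.2)] with s h1 h2 h3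
    exact h1 ⟨ht.1.trans h2, h3.le⟩
  · have ht' : t ∈ Set.Icc (0 : ℝ) 1 := ⟨ht.1, ht.2.le⟩
    have hB' : ‖D.T (c t)‖ ≤ B := by
      have := hB ⟨t, ht'⟩
      rwa [hc] at this
    have hℓ' := hℓ t ht'
    have : 0 ≤ ℓ := (norm_nonneg _).trans hℓ'
    rw [norm_smul, mul_assoc]
    gcongr
    exact (ContinuousLinearMap.le_opNorm _ _).trans (by gcongr)

end LinearODE

/-! ### Growth on sectorial regions -/

theorem hasDerivAt_polar_segment (v : ℂ) (p q : ℝ × ℝ) (t : ℝ) :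
    HasDerivAt (fun t : ℝ => polar v (p.1 + t * (q.1 - p.1), p.2 + t * (q.2 - p.2)))
      (((q.1 - p.1 : ℝ) : ℂ) * Complex.exp (((p.2 + t * (q.2 - p.2) : ℝ) : ℂ) * Complex.I)
        + ((p.1 + t * (q.1 - p.1) : ℝ) : ℂ)
          * (Complex.exp (((p.2 + t * (q.2 - p.2) : ℝ) : ℂ) * Complex.I)
            * (((q.2 - p.2 : ℝ) : ℂ) * Complex.I))) t := by
  have hlin : ∀ a b : ℝ, HasDerivAt (fun t : ℝ => ((a + t * (b - a) : ℝ) : ℂ)) ((b - a : ℝ) : ℂ) t :=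
    fun a b => by
      have : HasDerivAt (fun t : ℝ => a + t * (b - a)) (b - a) t := by
        simpa using ((hasDerivAt_id t).mul_const (b - a)).const_add a
      exact this.ofReal_comp
  exact ((hlin p.1 q.1).mul ((hlin p.2 q.2).mul_const Complex.I).cexp).const_add v

theorem polarPath_apply (v : ℂ) (p q : ℝ × ℝ) (t : I) :
    polarPath v p q t = polar v (p.1 + t * (q.1 - p.1), p.2 + t * (q.2 - p.2)) := by
  unfold polarPath
  rw [Path.map_coe, Function.comp_apply, Path.segment_apply]
  congr 1
  exact Prod.ext (by simp [AffineMap.lineMap_apply, add_comm])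
    (by simp [AffineMap.lineMap_apply, add_comm])

theorem norm_le_norm_polar (v : ℂ) (p : ℝ × ℝ) : p.1 ≤ ‖polar v p‖ + ‖v‖ := by
  have h1 : ‖(p.1 : ℂ) * Complex.exp (p.2 * Complex.I)‖ = |p.1| := by
    rw [norm_mul, Complex.norm_exp_ofReal_mul_I, mul_one, Complex.norm_real, Real.norm_eq_abs]
  have h2 : (p.1 : ℂ) * Complex.exp (p.2 * Complex.I) = polar v p - v := by simp [polar]
  rw [h2] at h1
  linarith [le_abs_self p.1, norm_sub_le (polar v p) v]

namespace SectorialRegion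

variable {Ω : Set ℂ} {ν : ℝ} (S : SectorialRegion Ω ν)

/-- The disc and the tube of a sectorial region are bounded. -/
theorem exists_norm_proj_le : ∃ R, ∀ q ∈ S.disc ∪ S.tube, ‖q.proj‖ ≤ R := by
  obtain ⟨M, hM⟩ := (isCompact_range S.path.continuous).isBounded.exists_norm_le
  refine ⟨max S.discRadius (M + S.tubeRadius), ?_⟩
  rintro q (⟨w, hw, h, rfl⟩ | ⟨t, w, hw, h, rfl⟩)
  · refine le_max_of_le_left ?_
    rw [mem_ball_zero_iff] at hw
    exact hw.le
  · refine le_max_of_le_right ?_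
    change ‖w‖ ≤ _
    rw [Metric.mem_ball, dist_eq_norm] at hw
    have h1 := hM _ ⟨t, rfl⟩
    have h2 : ‖w‖ ≤ ‖S.path t‖ + ‖w - S.path t‖ := norm_le_norm_add_norm_sub' w (S.path t)
    linarith

end SectorialRegion

/-! ### Exponential bounds along polar paths -/

namespace LinearODE

variable {Ω : Set ℂ} {E : Type} [NormedAddCommGroup E] [NormedSpace ℂ E] [CompleteSpace E]
  (D : LinearODE Ω E)

theorem exists_norm_value_le_of_mem_sector {ν : ℝ} (S : SectorialRegion Ω ν) :
    ∃ C K : ℝ, ∀ q ∈ S.sector, ‖D.value q‖ ≤ C * Real.exp (K * ‖q.proj‖) := by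
  obtain ⟨B₀, hB₀⟩ := D.bounded ν S.ν_pos
  set B := max B₀ 0 with hB
  have hB0 : 0 ≤ B := le_max_right _ _
  -- Lifts are unique, so one number bounds them all. Admissibility of this path is not part of the
  -- data of a region, hence the case distinction.
  obtain ⟨M, hM⟩ : ∃ M : ℝ, ∀ Γ, D.IsLift D.base ((Path.segment 0 S.start).trans S.path) Γ →
      ‖(Γ 1).val‖ ≤ M := by
    by_cases h : ∃ Γ, D.IsLift D.base ((Path.segment 0 S.start).trans S.path) Γ
    · obtain ⟨Γ, hΓ⟩ := h
      exact ⟨‖(Γ 1).val‖, fun Γ' hΓ' => by rw [hΓ'.unique hΓ]⟩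
    · exact ⟨0, fun Γ hΓ => absurd ⟨Γ, hΓ⟩ h⟩
  -- The speed of the polar path is at most |Δρ| + ρ |Δθ|, and both |Δρ| and ρ are at most the sum
  -- of the two end radii: its length is at most that sum times w.
  set w := 1 + (S.argMax - S.argMin) with hw
  have hf1 : S.innerRadius < S.finish.1 := S.finish_mem.1
  have hf2 : S.finish.2 ∈ Set.Ioo S.argMin S.argMax := S.finish_mem.2
  have hrad := S.innerRadius_nonneg
  have hw0 : 0 < w := by linarith [hf2.1, hf2.2]
  refine ⟨|M| * Real.exp ((S.finish.1 + ‖S.vertex‖) * w * B), w * B, ?_⟩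
  rintro q ⟨p, hp, h, rfl⟩
  have hp1 : S.innerRadius < p.1 := hp.1
  have hp2 : p.2 ∈ Set.Ioo S.argMin S.argMax := hp.2
  obtain ⟨Γ, hΓ⟩ := D.exists_isLift h
  obtain ⟨Γ₁, Γ₂, h1, h2, e⟩ := hΓ.left
  rw [D.value_mk h hΓ, ← e]
  have hconv : ∀ t ∈ Set.Icc (0 : ℝ) 1, ∀ a b lo : ℝ, lo < a → lo < b → lo < a + t * (b - a) := by
    intro t ht a b lo ha hb
    nlinarith [ht.1, ht.2, mul_nonneg ht.1 (sub_nonneg.2 hb.le),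
      mul_nonneg (sub_nonneg.2 ht.2) (sub_nonneg.2 ha.le)]
  have hmem : ∀ t ∈ Set.Icc (0 : ℝ) 1,
      ((S.finish.1 + t * (p.1 - S.finish.1), S.finish.2 + t * (p.2 - S.finish.2)) : ℝ × ℝ)
        ∈ Set.Ioi S.innerRadius ×ˢ Set.Ioo S.argMin S.argMax := by
    intro t ht
    refine ⟨hconv t ht _ _ _ hf1 hp1, hconv t ht _ _ _ hf2.1 hp2.1, ?_⟩
    have := hconv t ht (-S.finish.2) (-p.2) (-S.argMax) (neg_lt_neg hf2.2) (neg_lt_neg hp2.2)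
    change S.finish.2 + t * (p.2 - S.finish.2) < S.argMax
    linarith
  have hfar : ∀ t : I, ∀ ω ∈ Ω, ν < dist (polarPath S.vertex S.finish p t) ω := by
    intro t
    rw [polarPath_apply]
    exact S.sector_far _ (hmem t t.2)
  have key := h2.norm_val_le (B := B) (ℓ := (S.finish.1 + p.1) * w)
    (polarPath_apply S.vertex S.finish p)
    (hasDerivAt_polar_segment S.vertex S.finish p)
    (fun t ht => absurd (hfar t _ ht) (by simpa using S.ν_pos.le))
    (fun t => (hB₀ _ (hfar t)).trans (le_max_left _ _)) (fun t ht => ?_)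
  · refine key.trans ?_
    have h3 := norm_le_norm_polar S.vertex p
    have h4 : ‖(Γ₁ 1).val‖ ≤ |M| := (hM _ h1).trans (le_abs_self M)
    change _ ≤ |M| * Real.exp ((S.finish.1 + ‖S.vertex‖) * w * B)
      * Real.exp (w * B * ‖polar S.vertex p‖)
    rw [mul_assoc |M|, ← Real.exp_add]
    gcongr
    calc (S.finish.1 + p.1) * w * B
        ≤ (S.finish.1 + (‖polar S.vertex p‖ + ‖S.vertex‖)) * w * B := by gcongr
      _ = _ := by ring
  · have hρ := (hmem t ht).1
    have hρ' : 0 < S.finish.1 + t * (p.1 - S.finish.1) := hrad.trans_lt hρ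
    refine (norm_add_le _ _).trans ?_
    simp only [norm_mul, Complex.norm_exp_ofReal_mul_I, Complex.norm_real, Complex.norm_I, mul_one,
      one_mul, Real.norm_eq_abs]
    rw [abs_of_pos hρ']
    have a0 : 0 ≤ S.finish.1 + p.1 := by linarith
    have a1 : |p.1 - S.finish.1| ≤ S.finish.1 + p.1 := by
      rw [abs_le]; constructor <;> linarith
    have a2 : |p.2 - S.finish.2| ≤ S.argMax - S.argMin := by
      rw [abs_le]; constructor <;> linarith [hf2.1, hf2.2, hp2.1, hp2.2]
    have a3 : S.finish.1 + t * (p.1 - S.finish.1) ≤ S.finish.1 + p.1 := by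
      nlinarith [ht.1, ht.2]
    calc _ ≤ (S.finish.1 + p.1) + (S.finish.1 + p.1) * (S.argMax - S.argMin) := by gcongr
      _ = _ := by rw [hw]; ring

/-- The components of the continued solution are summable-resurgent functions. -/
theorem isSummableResurgentFunction (L : E →L[ℂ] ℂ) :
    IsSummableResurgentFunction fun q => L (D.value q) := by
  refine ⟨fun z γ h => ?_, fun ν S => ?_⟩
  · obtain ⟨r, hr, g, hg, hval⟩ := D.exists_differentiableOn_value h
    refine ⟨r, hr, fun w => L (g w),
      (L.differentiable.comp_differentiableOn hg).analyticOnNhd Metric.isOpen_ball, fun w hw => ?_⟩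
    obtain ⟨h', e⟩ := hval w hw
    exact ⟨h', congrArg L e⟩
  · obtain ⟨R, hR⟩ := S.exists_norm_proj_le
    obtain ⟨C, K, hCK⟩ := D.exists_norm_value_le_of_mem_sector S
    -- The disc and the tube project into the ball of radius R; beyond it only the sector remains.
    refine ⟨‖L‖ * C, K, R + 1, ?_⟩
    rintro q (hq | hq) hRq
    · linarith [hR q hq]
    · rw [mul_assoc]
      exact (L.le_opNorm _).trans (by gcongr; exact hCK q hq)

end LinearODE

/-! ### The convolution equation in the Borel plane -/

/-- The recursion for the coefficients `u_l / l!` of a solution of a linear convolution equation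
`(z - ω_i) û_i(z) = Ĉ_i(z) + (K̂ * û)_i(z)` whose kernel and right-hand side are entire functions
of exponential type. -/
structure ConvolutionEquation (ι : Type) [Fintype ι] where
  /-- the zeros of the coefficients -/
  ω : ι → ℂ
  /-- Taylor coefficients of the kernel -/
  K : ℕ → (ι → ℂ) →L[ℂ] (ι → ℂ)
  /-- Taylor coefficients of the right-hand side -/
  C : ℕ → ι → ℂ
  /-- Taylor coefficients of the solution -/
  u : ℕ → ι → ℂ
  /-- constant of the bounds -/
  κ : ℝ
  /-- exponential type of the bounds -/
  c : ℝ
  κ_pos : 0 < κ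
  one_le : 1 ≤ c
  norm_K_le : ∀ m, ‖K m‖ ≤ κ * c ^ m
  norm_C_le : ∀ m, ‖C m‖ ≤ κ * c ^ m
  eqn : ∀ (l : ℕ) (i : ι), ((l : ℂ) + 1) * u l i - ω i * u (l + 1) i
    = C (l + 1) i + ∑ j ∈ Finset.range (l + 1), K (l - j) (u j) i
  decoupled : ∀ i, ω i = 0 → ∀ v : ι → ℂ, (∀ j, ω j = 0 → v j = 0) → K 0 v i = 0

namespace ConvolutionEquation

variable {ι : Type} [Fintype ι] (V : ConvolutionEquation ι)

theorem c_pos : 0 < V.c := zero_lt_one.trans_le V.one_le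

theorem norm_K_apply_le (m : ℕ) (v : ι → ℂ) (i : ι) : ‖V.K m v i‖ ≤ V.κ * V.c ^ m * ‖v‖ :=
  (norm_le_pi_norm _ i).trans (((V.K m).le_opNorm v).trans (by gcongr; exact V.norm_K_le m))

theorem norm_sum_K_le (l : ℕ) (i : ι) :
    ‖∑ j ∈ Finset.range l, V.K (l - j) (V.u j) i‖
      ≤ V.κ * ∑ j ∈ Finset.range l, V.c ^ (l - j) * ‖V.u j‖ := by
  rw [Finset.mul_sum]
  exact norm_sum_le_of_le _ fun j _ => (V.norm_K_apply_le _ _ _).trans_eq (by ring)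

/-- By j! ≤ l! the convolution bounds pass to the Borel coefficients u_l / l!. -/
theorem sum_norm_u_le (l : ℕ) : ∑ j ∈ Finset.range l, V.c ^ (l - j) * ‖V.u j‖
    ≤ l.factorial * ∑ j ∈ Finset.range l, V.c ^ (l - j) * (‖V.u j‖ / j.factorial) := by
  have := V.c_pos
  rw [Finset.mul_sum]
  refine Finset.sum_le_sum fun j hj => ?_
  have h1 : (j.factorial : ℝ) ≤ l.factorial := by
    exact_mod_cast Nat.factorial_le (Finset.mem_range.1 hj).le
  have h2 : (0 : ℝ) < j.factorial := by exact_mod_cast j.factorial_pos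
  calc V.c ^ (l - j) * ‖V.u j‖ = j.factorial * (V.c ^ (l - j) * (‖V.u j‖ / j.factorial)) := by
        field_simp
    _ ≤ _ := by gcongr

/-- Rows with `ω_i = 0`. -/
theorem norm_u_le_of_eq_zero {l : ℕ} (hl : 2 * V.κ ≤ l + 1) {i : ι} (hi : V.ω i = 0) :
    ‖V.u l i‖ ≤ 2 * (V.κ * V.c ^ (l + 1)
      + V.κ * ∑ j ∈ Finset.range l, V.c ^ (l - j) * ‖V.u j‖) := by
  classical
  set b := V.κ * V.c ^ (l + 1) + V.κ * ∑ j ∈ Finset.range l, V.c ^ (l - j) * ‖V.u j‖ with hb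
  have hc := V.c_pos
  have hκ := V.κ_pos
  have hb0 : 0 ≤ b := by
    have : 0 ≤ ∑ j ∈ Finset.range l, V.c ^ (l - j) * ‖V.u j‖ :=
      Finset.sum_nonneg fun j _ => by positivity
    positivity
  -- The unknown u_l occurs on both sides, through K_0. By `decoupled` only its rows with ω = 0
  -- matter, which Z collects; the factor l + 1 ≥ 2κ then absorbs κ ‖Z‖.
  set Z : ι → ℂ := fun i => if V.ω i = 0 then V.u l i else 0 with hZ
  have hrow : ∀ i, V.ω i = 0 → ((l : ℝ) + 1) * ‖V.u l i‖ ≤ b + V.κ * ‖Z‖ := by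
    intro i hi
    have h1 := V.eqn l i
    rw [hi, zero_mul, sub_zero, Finset.sum_range_succ, Nat.sub_self] at h1
    have h2 : V.K 0 (V.u l) i = V.K 0 Z i := by
      have := V.decoupled i hi (V.u l - Z) (fun j hj => by simp [hZ, hj])
      rwa [map_sub, Pi.sub_apply, sub_eq_zero] at this
    rw [h2] at h1
    have h3 : ((l : ℝ) + 1) * ‖V.u l i‖ = ‖((l : ℂ) + 1) * V.u l i‖ := by
      rw [norm_mul]
      congr 1
      have : ((l : ℂ) + 1) = ((l + 1 : ℕ) : ℂ) := by push_cast; rfl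
      rw [this, Complex.norm_natCast]
      push_cast
      rfl
    rw [h3, h1]
    have h4 : ‖V.C (l + 1) i‖ ≤ V.κ * V.c ^ (l + 1) :=
      (norm_le_pi_norm _ i).trans (V.norm_C_le _)
    have h5 : ‖V.K 0 Z i‖ ≤ V.κ * ‖Z‖ := by simpa using V.norm_K_apply_le 0 Z i
    have h6 := V.norm_sum_K_le l i
    calc _ ≤ ‖V.C (l + 1) i‖ + (‖∑ j ∈ Finset.range l, V.K (l - j) (V.u j) i‖ + ‖V.K 0 Z i‖) :=
          (norm_add_le _ _).trans (by gcongr; exact norm_add_le _ _)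
      _ ≤ _ := by rw [hb]; linarith
  have hl1 : (0 : ℝ) < (l : ℝ) + 1 := by positivity
  have hZle : ‖Z‖ ≤ (b + V.κ * ‖Z‖) / (l + 1) := by
    rw [pi_norm_le_iff_of_nonneg (by positivity)]
    intro j
    by_cases hj : V.ω j = 0
    · simp only [hZ, hj, if_true]
      rw [le_div_iff₀ hl1, mul_comm]
      exact hrow j hj
    · simp only [hZ, hj, if_false, norm_zero]
      positivity
  rw [le_div_iff₀ hl1] at hZle
  have h7 : ‖V.u l i‖ ≤ ‖Z‖ := by
    have := norm_le_pi_norm Z i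
    simpa [hZ, hi] using this
  have h8 : (1 : ℝ) ≤ (l : ℝ) + 1 := by simp
  nlinarith [norm_nonneg Z, mul_le_mul_of_nonneg_left hl (norm_nonneg Z),
    mul_le_mul_of_nonneg_left h8 (norm_nonneg Z)]

/-- Rows with `ω_i ≠ 0`. -/
theorem norm_u_le_of_ne_zero (l : ℕ) {i : ι} (hi : V.ω i ≠ 0) :
    ‖V.u (l + 1) i‖ ≤ ‖V.ω i‖⁻¹ * ((l + 1) * ‖V.u l‖ + V.κ * V.c ^ (l + 1)
      + V.κ * ∑ j ∈ Finset.range (l + 1), V.c ^ (l + 1 - j) * ‖V.u j‖) := by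
  have hc := V.c_pos
  have hκ := V.κ_pos
  have h1 := V.eqn l i
  have h2 : V.ω i * V.u (l + 1) i = ((l : ℂ) + 1) * V.u l i
      - (V.C (l + 1) i + ∑ j ∈ Finset.range (l + 1), V.K (l - j) (V.u j) i) := by
    rw [← h1]; ring
  have h3 : ‖((l : ℂ) + 1) * V.u l i‖ ≤ (l + 1) * ‖V.u l‖ := by
    rw [norm_mul]
    have : ((l : ℂ) + 1) = ((l + 1 : ℕ) : ℂ) := by push_cast; rfl
    rw [this, Complex.norm_natCast]
    push_cast
    gcongr
    exact norm_le_pi_norm _ i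
  have h4 : ‖V.C (l + 1) i‖ ≤ V.κ * V.c ^ (l + 1) :=
    (norm_le_pi_norm _ i).trans (V.norm_C_le _)
  -- Raising the exponent of c by one is free as c ≥ 1 and gives the form that
  -- `exists_geometric_bound` expects.
  have h5 : ‖∑ j ∈ Finset.range (l + 1), V.K (l - j) (V.u j) i‖
      ≤ V.κ * ∑ j ∈ Finset.range (l + 1), V.c ^ (l + 1 - j) * ‖V.u j‖ := by
    rw [Finset.mul_sum]
    refine norm_sum_le_of_le _ fun j _ => (V.norm_K_apply_le _ _ _).trans ?_
    rw [mul_assoc]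
    gcongr
    · exact V.one_le
    · omega
  rw [← div_eq_inv_mul, le_div_iff₀' (norm_pos_iff.2 hi), ← norm_mul, h2]
  calc _ ≤ ‖((l : ℂ) + 1) * V.u l i‖
        + (‖V.C (l + 1) i‖ + ‖∑ j ∈ Finset.range (l + 1), V.K (l - j) (V.u j) i‖) :=
        (norm_sub_le _ _).trans (by gcongr; exact norm_add_le _ _)
    _ ≤ _ := by linarith

/-- The solution is Gevrey of order one: its Borel transform converges. -/
theorem exists_norm_u_le : ∃ U R : ℝ, 0 < U ∧ 0 < R ∧
    ∀ l, ‖V.u l‖ / l.factorial ≤ U * R ^ l := by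
  have hc := V.c_pos
  have hκ := V.κ_pos
  set δ := ∑ i, ‖V.ω i‖⁻¹ with hδ
  have hδ0 : 0 ≤ δ := Finset.sum_nonneg fun i _ => by positivity
  obtain ⟨N, hN⟩ := exists_nat_ge (2 * V.κ)
  -- The part 2κc + 2κ serves the rows with ω_i = 0, the part δ (1 + κ) the others; in δ the
  -- vanishing ω_i contribute 0⁻¹ = 0. From rank N + 1 on, the absorption works and l is a
  -- successor.
  refine exists_geometric_bound_of_eventually (K := 2 * V.κ * V.c + 2 * V.κ + δ * (1 + V.κ))
    (fun l => by positivity) (by positivity) hc (N + 1) fun l hl => ?_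
  set w := fun l => ‖V.u l‖ / (l.factorial : ℝ) with hw
  set s := ∑ j ∈ Finset.range l, V.c ^ (l - j) * w j with hs
  have hs0 : 0 ≤ s := Finset.sum_nonneg fun j _ => by positivity
  have hfac : (1 : ℝ) ≤ l.factorial := by exact_mod_cast l.factorial_pos
  have hsum : ∑ j ∈ Finset.range l, V.c ^ (l - j) * ‖V.u j‖ ≤ l.factorial * s := V.sum_norm_u_le l
  rw [div_le_iff₀ (by positivity), pi_norm_le_iff_of_nonneg (by positivity)]
  intro i
  have hcl : 0 < V.c ^ l := by positivity
  by_cases hi : V.ω i = 0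
  · have hl' : 2 * V.κ ≤ l + 1 := by
      have : (N : ℝ) + 1 ≤ l := by exact_mod_cast hl
      linarith
    refine (V.norm_u_le_of_eq_zero hl' hi).trans ?_
    calc 2 * (V.κ * V.c ^ (l + 1) + V.κ * ∑ j ∈ Finset.range l, V.c ^ (l - j) * ‖V.u j‖)
        ≤ 2 * (V.κ * V.c ^ (l + 1) * l.factorial + V.κ * (l.factorial * s)) := by
          have h1 : V.κ * V.c ^ (l + 1) ≤ V.κ * V.c ^ (l + 1) * l.factorial :=
            le_mul_of_one_le_right (by positivity) hfac
          have h2 := mul_le_mul_of_nonneg_left hsum hκ.le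
          linarith
      _ = (2 * V.κ * V.c * V.c ^ l + 2 * V.κ * s) * l.factorial := by ring
      _ ≤ _ := by
          gcongr
          · nlinarith [mul_nonneg hδ0 hκ.le]
          · nlinarith [mul_nonneg hδ0 hκ.le, mul_pos hκ hc]
  · obtain ⟨k, rfl⟩ : ∃ k, l = k + 1 := ⟨l - 1, by omega⟩
    refine (V.norm_u_le_of_ne_zero k hi).trans ?_
    have hδi : ‖V.ω i‖⁻¹ ≤ δ :=
      Finset.single_le_sum (f := fun i => ‖V.ω i‖⁻¹) (fun i _ => by positivity) (Finset.mem_univ i)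
    have hfk : (((k + 1).factorial : ℕ) : ℝ) = (k + 1) * k.factorial := by
      rw [Nat.factorial_succ]; push_cast; rfl
    have hlast : w k ≤ s := by
      have h1 : V.c ^ (k + 1 - k) * w k ≤ s :=
        Finset.single_le_sum (f := fun j => V.c ^ (k + 1 - j) * w j) (fun j _ => by positivity)
          (Finset.mem_range.2 k.lt_succ_self)
      have h2 : 0 ≤ w k := by positivity
      rw [Nat.add_sub_cancel_left, pow_one] at h1
      nlinarith [V.one_le]
    have hk : (0 : ℝ) < k.factorial := by exact_mod_cast k.factorial_pos
    -- The factor k + 1, which comes from the multiplication by z, is exactly what the step from k!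
    -- to (k + 1)! pays for.
    have huk : (k + 1) * ‖V.u k‖ ≤ (k + 1).factorial * s := by
      have : ‖V.u k‖ = w k * k.factorial := by rw [hw]; field_simp
      rw [this, hfk]
      nlinarith [mul_nonneg (mul_nonneg (by positivity : (0 : ℝ) ≤ k + 1) hk.le)
        (sub_nonneg.2 hlast)]
    calc _ ≤ δ * ((k + 1).factorial * s + V.κ * V.c ^ (k + 1) * (k + 1).factorial
          + V.κ * ((k + 1).factorial * s)) := by
          have h1 : V.κ * V.c ^ (k + 1) ≤ V.κ * V.c ^ (k + 1) * (k + 1).factorial :=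
            le_mul_of_one_le_right (by positivity) hfac
          have h2 := mul_le_mul_of_nonneg_left hsum hκ.le
          have h3 : 0 ≤ ∑ j ∈ Finset.range (k + 1), V.c ^ (k + 1 - j) * ‖V.u j‖ :=
            Finset.sum_nonneg fun j _ => by positivity
          exact mul_le_mul hδi (by linarith) (by positivity) hδ0
      _ = (δ * V.κ * V.c ^ (k + 1) + δ * (1 + V.κ) * s) * (k + 1).factorial := by ring
      _ ≤ _ := by
          gcongr
          · nlinarith [mul_pos hκ hc]
          · nlinarith [mul_pos hκ hc]

end ConvolutionEquation

/-! ### The convolution equation as a linear differential equation -/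

open scoped BoundedContinuousFunction

section Operators

/-- The Banach space of bounded sequences. -/
def BddSeq (G : Type*) [NormedAddCommGroup G] : Type _ := ℕ →ᵇ G

namespace BddSeq

variable {F G : Type*} [NormedAddCommGroup F] [NormedSpace ℂ F] [NormedAddCommGroup G]
  [NormedSpace ℂ G]

instance : NormedAddCommGroup (BddSeq G) := inferInstanceAs (NormedAddCommGroup (ℕ →ᵇ G))

instance : NormedSpace ℂ (BddSeq G) := inferInstanceAs (NormedSpace ℂ (ℕ →ᵇ G))

instance [CompleteSpace G] : CompleteSpace (BddSeq G) := inferInstanceAs (CompleteSpace (ℕ →ᵇ G))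

/-- The value of a bounded sequence at `m`. -/
def eval (m : ℕ) : BddSeq G →L[ℂ] G :=
  LinearMap.mkContinuous
    { toFun := fun y => DFunLike.coe (F := ℕ →ᵇ G) y m
      map_add' := fun _ _ => rfl
      map_smul' := fun _ _ => rfl }
    1 fun y => by
      rw [one_mul]
      exact BoundedContinuousFunction.norm_coe_le_norm (α := ℕ) (β := G) y m

@[ext] theorem ext {x y : BddSeq G} (h : ∀ m, eval m x = eval m y) : x = y :=
  BoundedContinuousFunction.ext h

theorem norm_le {y : BddSeq G} {C : ℝ} (hC : 0 ≤ C) : ‖y‖ ≤ C ↔ ∀ m, ‖eval m y‖ ≤ C :=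
  BoundedContinuousFunction.norm_le hC

theorem norm_eval_le (m : ℕ) : ‖(eval m : BddSeq G →L[ℂ] G)‖ ≤ 1 :=
  LinearMap.mkContinuous_norm_le _ zero_le_one _

/-- The sequence `f` as an element of the Banach space of bounded sequences. -/
def mk (f : ℕ → G) (C : ℝ) (hf : ∀ m, ‖f m‖ ≤ C) : BddSeq G :=
  BoundedContinuousFunction.ofNormedAddCommGroupDiscrete f C hf

@[simp] theorem eval_mk (f : ℕ → G) (C : ℝ) (hf : ∀ m, ‖f m‖ ≤ C) (m : ℕ) :
    eval m (mk f C hf) = f m := rfl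

/-- A uniformly bounded sequence of operators, as an operator into bounded sequences. -/
def ofOperators (A : ℕ → F →L[ℂ] G) (C : ℝ) (hA : ∀ m, ‖A m‖ ≤ C) : F →L[ℂ] BddSeq G :=
  LinearMap.mkContinuous
    { toFun := fun y => mk (fun m => A m y) (C * ‖y‖) fun m => (A m).le_of_opNorm_le (hA m) y
      map_add' := fun x y => by ext; simp
      map_smul' := fun c x => by ext; simp }
    C fun y => (norm_le (mul_nonneg ((norm_nonneg _).trans (hA 0))
      (norm_nonneg y))).2 fun m => (A m).le_of_opNorm_le (hA m) y

@[simp] theorem eval_ofOperators (A : ℕ → F →L[ℂ] G) (C : ℝ) (hA : ∀ m, ‖A m‖ ≤ C) (y : F)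
    (m : ℕ) : eval m (ofOperators A C hA y) = A m y := rfl

end BddSeq

end Operators

/-! ### The operator T(z) on bounded sequences and the coefficients of its solution -/

namespace ConvolutionEquation

variable {ι : Type} [Fintype ι] [DecidableEq ι] (V : ConvolutionEquation ι)

/-- Row `m ≥ 1` of the differential equation: `c y_{m+1} + c⁻ᵐ K_m y_0`. -/
def row (m : ℕ) : BddSeq (ι → ℂ) →L[ℂ] (ι → ℂ) :=
  (V.c : ℂ) • BddSeq.eval (m + 1) + ((V.c : ℂ) ^ m)⁻¹ • (V.K m ∘L BddSeq.eval 0)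

theorem row_apply (m : ℕ) (y : BddSeq (ι → ℂ)) :
    V.row m y = (V.c : ℂ) • BddSeq.eval (m + 1) y
      + ((V.c : ℂ) ^ m)⁻¹ • V.K m (BddSeq.eval 0 y) := rfl

/-- The weights c⁻ᵐ offset the growth of K_m, so the rows form a bounded operator. -/
theorem norm_row_le (m : ℕ) : ‖V.row m‖ ≤ V.c + V.κ := by
  have hc := V.c_pos
  rw [row]
  refine le_trans (norm_add_le _ _) (add_le_add ?_ ?_)
  · rw [norm_smul, Complex.norm_real, Real.norm_of_nonneg hc.le]
    exact mul_le_of_le_one_right hc.le (BddSeq.norm_eval_le _)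
  · rw [norm_smul, norm_inv, norm_pow, Complex.norm_real, Real.norm_of_nonneg hc.le,
      inv_mul_le_iff₀ (by positivity)]
    refine (ContinuousLinearMap.opNorm_comp_le _ _).trans ?_
    calc ‖V.K m‖ * ‖(BddSeq.eval 0 : BddSeq (ι → ℂ) →L[ℂ] (ι → ℂ))‖ ≤ (V.κ * V.c ^ m) * 1 := by
          gcongr
          · exact mul_nonneg V.κ_pos.le (by positivity)
          · exact V.norm_K_le m
          · exact BddSeq.norm_eval_le _
      _ = _ := by ring

/-- The regular part of the differential equation. -/
def regularPart : BddSeq (ι → ℂ) →L[ℂ] BddSeq (ι → ℂ) :=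
  BddSeq.ofOperators (fun m => if m = 0 then 0 else V.row m) (V.c + V.κ) fun m => by
    split_ifs
    · simpa using add_nonneg V.c_pos.le V.κ_pos.le
    · exact V.norm_row_le m

/-- The residue of the differential equation at `ω_i`. -/
def residue (i : ι) : BddSeq (ι → ℂ) →L[ℂ] BddSeq (ι → ℂ) :=
  BddSeq.ofOperators (fun m => if m = 0 then
      ContinuousLinearMap.single ℂ (fun _ : ι => ℂ) i ∘L ContinuousLinearMap.proj i
        ∘L (V.row 0 - BddSeq.eval 0) else 0)
    ‖ContinuousLinearMap.single ℂ (fun _ : ι => ℂ) i ∘L ContinuousLinearMap.proj i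
        ∘L (V.row 0 - BddSeq.eval 0)‖ fun m => by
    split_ifs
    · exact le_rfl
    · rw [norm_zero]; exact ContinuousLinearMap.opNorm_nonneg _

/-- The coefficient of the differential equation. -/
def coefficient (z : ℂ) : BddSeq (ι → ℂ) →L[ℂ] BddSeq (ι → ℂ) :=
  V.regularPart + ∑ i, (z - V.ω i)⁻¹ • V.residue i

theorem coefficient_apply_zero (z : ℂ) (y : BddSeq (ι → ℂ)) (i : ι) :
    BddSeq.eval 0 (V.coefficient z y) i
      = (z - V.ω i)⁻¹ * (V.row 0 y i - BddSeq.eval 0 y i) := by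
  simp only [coefficient, regularPart, residue, add_apply, sum_apply, smul_apply, map_add, map_sum,
    map_smul, BddSeq.eval_ofOperators, if_true, ContinuousLinearMap.comp_apply,
    ContinuousLinearMap.single_apply, ContinuousLinearMap.proj_apply, sub_apply, zero_apply,
    Pi.add_apply, Finset.sum_apply, Pi.smul_apply, Pi.zero_apply, smul_eq_mul, zero_add]
  rw [Finset.sum_eq_single i (fun j _ hj => by simp [hj.symm]) (by simp)]
  simp

theorem coefficient_apply_succ (z : ℂ) (y : BddSeq (ι → ℂ)) (m : ℕ) :
    BddSeq.eval (m + 1) (V.coefficient z y) = V.row (m + 1) y := by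
  simp [coefficient, regularPart, residue]

theorem differentiableOn_coefficient {Ω : Set ℂ} (hΩ : ∀ i, V.ω i ∈ Ω) :
    DifferentiableOn ℂ V.coefficient Ωᶜ := by
  change DifferentiableOn ℂ (fun z => V.regularPart + ∑ i, (z - V.ω i)⁻¹ • V.residue i) Ωᶜ
  refine DifferentiableOn.const_add _ (DifferentiableOn.fun_sum fun i _ => ?_)
  have h : DifferentiableOn ℂ (fun z => (z - V.ω i)⁻¹) Ωᶜ := by
    refine DifferentiableOn.inv (by fun_prop) fun z hz h => ?_
    rw [sub_eq_zero] at h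
    exact hz (h ▸ hΩ i)
  exact h.smul_const _

/-- Each simple pole costs at most ν⁻¹. The bound is uniform up to infinity, which is what limits
the growth to exponential type. -/
theorem norm_coefficient_le {Ω : Set ℂ} (hΩ : ∀ i, V.ω i ∈ Ω) {ν : ℝ} (hν : 0 < ν) {z : ℂ}
    (hz : ∀ ω ∈ Ω, ν < dist z ω) :
    ‖V.coefficient z‖ ≤ ‖V.regularPart‖ + ∑ i, ν⁻¹ * ‖V.residue i‖ := by
  rw [coefficient]
  refine le_trans (norm_add_le _ _) (add_le_add le_rfl ?_)
  refine norm_sum_le_of_le _ fun i _ => ?_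
  rw [norm_smul, norm_inv, ← dist_eq_norm]
  gcongr
  exact (hz _ (hΩ i)).le

/-- Taylor coefficients of the derivatives of `Ĉ(ξ) + ∫₀ᶻ K̂(ξ - η) û(η) dη` at `ξ = z`. -/
def history (m l : ℕ) : ι → ℂ :=
  V.C (m + l) + ∑ j ∈ Finset.range l, V.K (m + l - 1 - j) (V.u j)

/-- The Taylor form of h_m' = h_{m+1} + K_m û, where h_m = Ĉ^{(m)} + K̂^{(m)} * û; the last term is
the boundary term of the convolution integral. -/
theorem history_succ (m l : ℕ) :
    V.history m (l + 1) = V.history (m + 1) l + V.K m (V.u l) := by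
  unfold history
  rw [Finset.sum_range_succ, add_assoc, show m + (l + 1) = m + 1 + l by ring]
  congr 2
  · rw [show m + 1 + l - 1 - l = m by omega]

/-- The Taylor form of h_1 + K_0 û = ((z - ω_i) û)' in row i. Differentiation removes the constant
term, so V.C 0 plays no part. -/
theorem history_zero_succ (l : ℕ) (i : ι) :
    V.history 1 l i + V.K 0 (V.u l) i = ((l : ℂ) + 1) * V.u l i - V.ω i * V.u (l + 1) i := by
  rw [V.eqn, ← Pi.add_apply, ← V.history_succ 0 l]
  simp [history]

/-- Both geometric rates are at most ρ = c + R, and the number l of summands costs a factor 2 ^ l.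
The dependence on m is just c ^ m, which the weights in `entry` remove. -/
theorem norm_history_le {U R : ℝ} (hU : 0 < U) (hR : 0 < R)
    (hu : ∀ l, ‖V.u l‖ / l.factorial ≤ U * R ^ l) (m l : ℕ) :
    ‖V.history m l‖ / l.factorial ≤ V.c ^ m * (V.κ * (1 + U) * (2 * (V.c + R)) ^ l) := by
  have hc := V.c_pos
  have hκ := V.κ_pos
  have hf : (1 : ℝ) ≤ l.factorial := by exact_mod_cast l.factorial_pos
  set ρ := V.c + R with hρ
  have hρ1 : 1 ≤ ρ := by linarith [V.one_le]
  have hterm : ∀ j ∈ Finset.range l,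
      ‖V.K (m + l - 1 - j) (V.u j)‖ ≤ l.factorial * (V.κ * U * V.c ^ m * ρ ^ l) := by
    intro j hj
    have hj' := Finset.mem_range.1 hj
    have hjf : (0 : ℝ) < j.factorial := by exact_mod_cast j.factorial_pos
    have h1 : ‖V.u j‖ ≤ U * R ^ j * l.factorial := by
      have := (div_le_iff₀ hjf).1 (hu j)
      refine this.trans ?_
      gcongr
    have h2 : m + l - 1 - j = m + (l - 1 - j) := by omega
    calc _ ≤ V.κ * V.c ^ (m + l - 1 - j) * (U * R ^ j * l.factorial) :=
          ((V.K _).le_opNorm _).trans (by gcongr; exact V.norm_K_le _)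
      _ = l.factorial * (V.κ * U * V.c ^ m * (V.c ^ (l - 1 - j) * R ^ j)) := by
          rw [h2, pow_add]; ring
      _ ≤ l.factorial * (V.κ * U * V.c ^ m * (ρ ^ (l - 1 - j) * ρ ^ j)) := by
          gcongr <;> linarith
      _ ≤ _ := by
          rw [← pow_add]
          gcongr
          omega
  have hC : ‖V.C (m + l)‖ ≤ l.factorial * (V.κ * V.c ^ m * ρ ^ l) := by
    calc ‖V.C (m + l)‖ ≤ V.κ * V.c ^ (m + l) := V.norm_C_le _
      _ = 1 * (V.κ * V.c ^ m * V.c ^ l) := by rw [pow_add]; ring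
      _ ≤ _ := by
          gcongr
          linarith
  have hl2 : (l : ℝ) ≤ 2 ^ l := by exact_mod_cast Nat.lt_two_pow_self.le
  have h12 : (1 : ℝ) ≤ 2 ^ l := one_le_pow₀ one_le_two
  rw [div_le_iff₀ (by positivity)]
  calc ‖V.history m l‖ ≤ l.factorial * (V.κ * V.c ^ m * ρ ^ l)
        + l * (l.factorial * (V.κ * U * V.c ^ m * ρ ^ l)) := by
        refine (norm_add_le _ _).trans (add_le_add hC ((norm_sum_le_of_le _ hterm).trans_eq ?_))
        simp
    _ = l.factorial * (V.κ * V.c ^ m * ρ ^ l) * (1 + U * l) := by ring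
    _ ≤ l.factorial * (V.κ * V.c ^ m * ρ ^ l) * (2 ^ l + U * 2 ^ l) := by gcongr
    _ = _ := by rw [mul_pow]; ring

/-- Entries of the Taylor coefficients of the solution of the differential equation. -/
def entry (l m : ℕ) : ι → ℂ :=
  ((l.factorial : ℂ))⁻¹ • if m = 0 then V.u l else ((V.c : ℂ) ^ m)⁻¹ • V.history m l

theorem exists_norm_entry_le : ∃ B R : ℝ, 0 < B ∧ 0 < R ∧ ∀ l m, ‖V.entry l m‖ ≤ B * R ^ l := by
  obtain ⟨U, R, hU, hR, hu⟩ := V.exists_norm_u_le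
  have hc := V.c_pos
  have hκ := V.κ_pos
  refine ⟨U + V.κ * (1 + U), 2 * (V.c + R), by positivity, by positivity, fun l m => ?_⟩
  have hf : ‖((l.factorial : ℂ))⁻¹‖ = (l.factorial : ℝ)⁻¹ := by
    rw [norm_inv, Complex.norm_natCast]
  have hp : (0 : ℝ) ≤ (2 * (V.c + R)) ^ l := by positivity
  unfold entry
  rw [norm_smul, hf, ← div_eq_inv_mul]
  split_ifs with hm
  · refine (hu l).trans ?_
    have h1 : R ^ l ≤ (2 * (V.c + R)) ^ l := by
      gcongr
      linarith
    nlinarith [mul_nonneg (mul_nonneg hκ.le (by positivity : 0 ≤ 1 + U)) hp]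
  · rw [norm_smul, norm_inv, norm_pow, Complex.norm_real, Real.norm_of_nonneg hc.le, mul_div_assoc,
      inv_mul_le_iff₀ (by positivity)]
    refine (V.norm_history_le hU hR hu m l).trans ?_
    gcongr
    linarith

theorem succ_smul_entry_succ (l m : ℕ) (hm : m ≠ 0) :
    ((l : ℂ) + 1) • V.entry (l + 1) m
      = (V.c : ℂ) • V.entry l (m + 1) + ((V.c : ℂ) ^ m)⁻¹ • V.K m (V.entry l 0) := by
  have hc : (V.c : ℂ) ≠ 0 := by exact_mod_cast V.c_pos.ne'
  have hl : (l : ℂ) + 1 ≠ 0 := by exact_mod_cast l.succ_ne_zero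
  have hf : (l.factorial : ℂ) ≠ 0 := by exact_mod_cast l.factorial_ne_zero
  unfold entry
  rw [if_neg hm, if_neg (Nat.succ_ne_zero m), if_pos rfl, V.history_succ, Nat.factorial_succ,
    map_smul]
  ext i
  simp only [Pi.smul_apply, Pi.add_apply, smul_eq_mul]
  push_cast
  field_simp
  ring

/-- Component 0 of the differential equation with the pole cleared: c y_1 + K_0 y_0 - y_0 = (z -
ω_i) y_0', in degree l. -/
theorem entry_zero_eqn (l : ℕ) (i : ι) :
    (V.c : ℂ) * V.entry l 1 i + V.K 0 (V.entry l 0) i - V.entry l 0 i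
      = (l : ℂ) * V.entry l 0 i - V.ω i * (((l : ℂ) + 1) * V.entry (l + 1) 0 i) := by
  have hc : (V.c : ℂ) ≠ 0 := by exact_mod_cast V.c_pos.ne'
  have hl : (l : ℂ) + 1 ≠ 0 := by exact_mod_cast l.succ_ne_zero
  have hf : (l.factorial : ℂ) ≠ 0 := by exact_mod_cast l.factorial_ne_zero
  have h := V.history_zero_succ l i
  unfold entry
  rw [if_pos rfl, if_neg one_ne_zero, if_pos rfl, Nat.factorial_succ, map_smul]
  simp only [Pi.smul_apply, smul_eq_mul]
  push_cast
  field_simp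
  linear_combination h

end ConvolutionEquation

/-! ### Summation of the power series solution -/

namespace ConvolutionEquation

variable {ι : Type} [Fintype ι] [DecidableEq ι] (V : ConvolutionEquation ι)

/-- The power series with the coefficients `entry` solves the differential equation. -/
theorem coefficient_tsum_eq {Y : ℕ → BddSeq (ι → ℂ)} {B R : ℝ} (hR : 0 < R)
    (hY : ∀ l, ‖Y l‖ ≤ B * R ^ l) (hYe : ∀ l m, BddSeq.eval m (Y l) = V.entry l m) {z : ℂ}
    (hz : 2 * R * ‖z‖ < 1) (hω : ∀ i, z ≠ V.ω i) :
    V.coefficient z (∑' l, z ^ l • Y l) = ∑' l : ℕ, z ^ l • (((l : ℂ) + 1) • Y (l + 1)) := by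
  have hz' : R * ‖z‖ < 1 := by nlinarith [mul_nonneg hR.le (norm_nonneg z)]
  have h1 : HasSum (fun l => z ^ l • Y l) (∑' l, z ^ l • Y l) :=
    (summable_norm_pow_smul hR hY hz').of_norm.hasSum
  have h2 : HasSum (fun l : ℕ => z ^ l • (((l : ℂ) + 1) • Y (l + 1)))
      (∑' l : ℕ, z ^ l • (((l : ℂ) + 1) • Y (l + 1))) :=
    (summable_norm_pow_smul (by positivity) (norm_succ_smul_le hY) hz).of_norm.hasSum
  set y := ∑' l, z ^ l • Y l
  set y' := ∑' l : ℕ, z ^ l • (((l : ℂ) + 1) • Y (l + 1))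
  have hrow : ∀ m, HasSum (fun l => z ^ l • V.row m (Y l)) (V.row m y) := fun m => by
    simpa using (V.row m).hasSum h1
  have heval : ∀ m, HasSum (fun l => z ^ l • BddSeq.eval m (Y l)) (BddSeq.eval m y) := fun m => by
    simpa using (BddSeq.eval m : BddSeq (ι → ℂ) →L[ℂ] (ι → ℂ)).hasSum h1
  have heval' : ∀ m, HasSum (fun l : ℕ => z ^ l • (((l : ℂ) + 1) • BddSeq.eval m (Y (l + 1))))
      (BddSeq.eval m y') := fun m => by
    simpa using (BddSeq.eval m : BddSeq (ι → ℂ) →L[ℂ] (ι → ℂ)).hasSum h2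
  ext m : 1
  rcases m with _ | m
  · ext i
    rw [V.coefficient_apply_zero, inv_mul_eq_iff_eq_mul₀ (sub_ne_zero.2 (hω i)), sub_mul]
    have e1 := (Pi.hasSum.1 (hrow 0) i).sub (Pi.hasSum.1 (heval 0) i)
    have e2 := Pi.hasSum.1 (heval' 0) i
    -- The series of z y_0'; the index may be shifted because the term l = 0 vanishes.
    have e3 : HasSum (fun l : ℕ => z ^ l * ((l : ℂ) * V.entry l 0 i)) (z * BddSeq.eval 0 y' i) := by
      rw [← hasSum_nat_add_iff' 1]
      simp only [Finset.range_one, Finset.sum_singleton, Nat.cast_zero, zero_mul, mul_zero, sub_zero]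
      refine (e2.mul_left z).congr_fun ?_
      intro l
      simp only [Pi.smul_apply, smul_eq_mul, hYe]
      push_cast
      ring
    refine e1.unique ((e3.sub (e2.mul_left (V.ω i))).congr_fun fun l => ?_)
    have := V.entry_zero_eqn l i
    simp only [V.row_apply, hYe, Pi.smul_apply, Pi.add_apply, smul_eq_mul, pow_zero, inv_one,
      one_mul, zero_add]
    linear_combination z ^ l * this
  · rw [V.coefficient_apply_succ]
    refine (hrow (m + 1)).unique ((heval' (m + 1)).congr_fun fun l => ?_)
    rw [V.row_apply, hYe, hYe, hYe, V.succ_smul_entry_succ l (m + 1) (Nat.succ_ne_zero m)]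

/-- The geometric bound on `entry`, uniform in m, makes the series converge in the Banach space. A
pole of T at 0 is harmless: the sum is analytic at 0, and the equation is asked for only off Ω. -/
theorem exists_linearODE {Ω : Set ℂ} (hΩ : Ω.Finite) (h0 : (0 : ℂ) ∈ Ω) (hω : ∀ i, V.ω i ∈ Ω) :
    ∃ D : LinearODE Ω (BddSeq (ι → ℂ)), ∀ w ∈ Metric.ball (0 : ℂ) D.r, ∀ i,
      HasSum (fun l : ℕ => V.u l i / (l.factorial : ℂ) * w ^ l) (BddSeq.eval 0 (D.f w) i) := by
  obtain ⟨B, R, hB, hR, hbound⟩ := V.exists_norm_entry_le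
  set Y : ℕ → BddSeq (ι → ℂ) := fun l => BddSeq.mk (V.entry l) _ (hbound l) with hYdef
  have hY : ∀ l, ‖Y l‖ ≤ B * R ^ l := fun l => (BddSeq.norm_le (by positivity)).2 (hbound l)
  have hYe : ∀ l m, BddSeq.eval m (Y l) = V.entry l m := fun l m => rfl
  have hsmall : ∀ᶠ w : ℂ in 𝓝 0, 2 * R * ‖w‖ < 1 := by
    have : Continuous fun w : ℂ => 2 * R * ‖w‖ := by fun_prop
    exact this.continuousAt.eventually_lt continuousAt_const (by simp)
  have hiso : ∀ᶠ w : ℂ in 𝓝 0, w ∈ Ω → w = 0 := by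
    have hcl : IsClosed (Ω \ {0}) := (hΩ.subset Set.sdiff_subset).isClosed
    filter_upwards [hcl.isOpen_compl.mem_nhds (show (0 : ℂ) ∈ (Ω \ {0})ᶜ by simp)] with w hw hwΩ
    by_contra hne
    exact hw ⟨hwΩ, hne⟩
  obtain ⟨r, hr, hball⟩ := Metric.eventually_nhds_iff_ball.1 (hsmall.and hiso)
  have hderiv : ∀ w ∈ Metric.ball (0 : ℂ) r, HasDerivAt (fun z : ℂ => ∑' l, z ^ l • Y l)
      (∑' l : ℕ, w ^ l • (((l : ℂ) + 1) • Y (l + 1))) w := fun w hw =>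
    hasDerivAt_tsum_pow_smul hR hB.le hY (hball w hw).1
  refine ⟨{ T := V.coefficient
            isClosed := hΩ.isClosed
            zero_mem := h0
            differentiableOn := V.differentiableOn_coefficient hω
            bounded := fun ν hν => ⟨_, fun z hz => V.norm_coefficient_le hω hν hz⟩
            f := fun z => ∑' l, z ^ l • Y l
            r := r
            r_pos := hr
            isSol := fun w hw => ⟨?_, ?_⟩
            eq_zero_of_mem := fun w hw => (hball w hw).2 }, fun w hw i => ?_⟩
  · exact DifferentiableOn.analyticAt (s := Metric.ball 0 r)
      (fun x hx => (hderiv x hx).differentiableAt.differentiableWithinAt)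
      (Metric.isOpen_ball.mem_nhds hw)
  · filter_upwards [Metric.isOpen_ball.mem_nhds hw] with x hx hxΩ
    refine (hderiv x hx).congr_deriv ?_
    exact (V.coefficient_tsum_eq hR hY hYe (hball x hx).1 fun i h => hxΩ (h ▸ hω i)).symm
  · have hz' : R * ‖w‖ < 1 := by
      nlinarith [mul_nonneg hR.le (norm_nonneg w), (hball w hw).1]
    have h1 : HasSum (fun l => w ^ l • Y l) (∑' l, w ^ l • Y l) :=
      (summable_norm_pow_smul hR hY hz').of_norm.hasSum
    have h2 := Pi.hasSum.1 ((BddSeq.eval 0 : BddSeq (ι → ℂ) →L[ℂ] (ι → ℂ)).hasSum h1) i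
    refine h2.congr_fun fun l => ?_
    rw [map_smul, hYe]
    simp [entry]
    ring

end ConvolutionEquation

/-! ### Convergent power series -/

theorem isConvergent_iff {f : ℂ⟦X⟧} : IsConvergent f ↔
    ∃ C R : ℝ, 0 < C ∧ 0 < R ∧ ∀ m, ‖PowerSeries.coeff m f‖ ≤ C * R ^ m := by
  unfold IsConvergent
  constructor
  · intro h
    obtain ⟨r, hr0, hr⟩ := ENNReal.lt_iff_exists_nnreal_btwn.1 h
    have hr0' : 0 < r := by exact_mod_cast hr0
    obtain ⟨C, hC, hbound⟩ :=
      FormalMultilinearSeries.norm_le_div_pow_of_pos_of_lt_radius _ hr0' hr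
    refine ⟨C, (r : ℝ)⁻¹, hC, by positivity, fun m => ?_⟩
    have := hbound m
    rw [FormalMultilinearSeries.ofScalars_norm] at this
    simpa [div_eq_mul_inv] using this
  · rintro ⟨C, R, hC, hR, h⟩
    have hR' : 0 < R⁻¹.toNNReal := Real.toNNReal_pos.2 (inv_pos.2 hR)
    refine lt_of_lt_of_le (ENNReal.coe_pos.2 hR')
      (FormalMultilinearSeries.le_radius_of_bound _ C fun m => ?_)
    rw [FormalMultilinearSeries.ofScalars_norm, Real.coe_toNNReal _ (inv_pos.2 hR).le]
    calc _ ≤ C * R ^ m * (R⁻¹) ^ m := by gcongr; exact h m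
      _ = C := by rw [mul_assoc, ← mul_pow, mul_inv_cancel₀ hR.ne', one_pow, mul_one]

theorem ConvolutionEquation.isSummableResurgentSeries {ι : Type} [Fintype ι] [DecidableEq ι]
    (V : ConvolutionEquation ι) {Ω : Set ℂ} (hΩ : Ω.Finite) (h0 : (0 : ℂ) ∈ Ω)
    (hω : ∀ i, V.ω i ∈ Ω) {f : ℂ⸨X⸩} (i : ι)
    (hf : ∀ l : ℕ, f.coeff ((l : ℤ) + 1) = V.u l i) : IsSummableResurgentSeries Ω f := by
  have hcoeff : ∀ l, PowerSeries.coeff l (borel f) = V.u l i / (l.factorial : ℂ) := fun l => by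
    rw [borel, PowerSeries.coeff_mk, hf]
  refine ⟨?_, ?_⟩
  · obtain ⟨U, R, hU, hR, hu⟩ := V.exists_norm_u_le
    refine isConvergent_iff.2 ⟨U, R, hU, hR, fun l => le_trans ?_ (hu l)⟩
    rw [hcoeff, norm_div, Complex.norm_natCast]
    gcongr
    exact norm_le_pi_norm _ i
  · obtain ⟨D, hD⟩ := V.exists_linearODE hΩ h0 hω
    refine ⟨_, D.isSummableResurgentFunction (ContinuousLinearMap.proj i ∘L BddSeq.eval 0), ?_⟩
    filter_upwards [Metric.ball_mem_nhds 0 D.r_pos] with w hw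
    obtain ⟨h, e⟩ := D.value_segment hw
    refine ⟨h, ?_⟩
    beta_reduce
    rw [e]
    simp only [hcoeff]
    exact hD w hw i

theorem isConvergent_of_eventually_zero {f : ℂ⟦X⟧} (N : ℕ)
    (h : ∀ m ≥ N, PowerSeries.coeff m f = 0) : IsConvergent f := by
  have hs : 0 ≤ ∑ j ∈ Finset.range N, ‖PowerSeries.coeff j f‖ :=
    Finset.sum_nonneg fun _ _ => norm_nonneg _
  refine isConvergent_iff.2 ⟨1 + ∑ j ∈ Finset.range N, ‖PowerSeries.coeff j f‖, 1, by positivity,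
    one_pos, fun m => ?_⟩
  rw [one_pow, mul_one]
  rcases lt_or_ge m N with hm | hm
  · have := Finset.single_le_sum (f := fun j => ‖PowerSeries.coeff j f‖)
      (fun j _ => norm_nonneg _) (Finset.mem_range.2 hm)
    linarith
  · rw [h m hm, norm_zero]
    positivity

/-- Finitely many convergent power series have a common geometric bound. -/
theorem exists_common_bound {ι : Type*} [Fintype ι] {f : ι → ℂ⟦X⟧} (hf : ∀ i, IsConvergent (f i)) :
    ∃ C R : ℝ, 0 < C ∧ 1 ≤ R ∧ ∀ i m, ‖PowerSeries.coeff m (f i)‖ ≤ C * R ^ m := by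
  choose C R hC hR h using fun i => isConvergent_iff.1 (hf i)
  have hC0 : 0 ≤ ∑ i, C i := Finset.sum_nonneg fun i _ => (hC i).le
  have hR0 : 0 ≤ ∑ i, R i := Finset.sum_nonneg fun i _ => (hR i).le
  refine ⟨1 + ∑ i, C i, 1 + ∑ i, R i, by positivity, by linarith, fun i m => (h i m).trans ?_⟩
  have h1 : C i ≤ ∑ i, C i := Finset.single_le_sum (fun i _ => (hC i).le) (Finset.mem_univ i)
  have h2 : R i ≤ ∑ i, R i := Finset.single_le_sum (fun i _ => (hR i).le) (Finset.mem_univ i)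
  have := (hR i).le
  gcongr <;> linarith

theorem IsConvergent.add {f g : ℂ⟦X⟧} (hf : IsConvergent f) (hg : IsConvergent g) :
    IsConvergent (f + g) := by
  obtain ⟨C, R, hC, hR, h⟩ := isConvergent_iff.1 hf
  obtain ⟨C', R', hC', hR', h'⟩ := isConvergent_iff.1 hg
  refine isConvergent_iff.2 ⟨C + C', R + R', by positivity, by positivity, fun m => ?_⟩
  rw [map_add, add_mul]
  refine (norm_add_le _ _).trans (add_le_add ((h m).trans ?_) ((h' m).trans ?_)) <;> gcongr <;>
    linarith

theorem IsConvergent.neg {f : ℂ⟦X⟧} (hf : IsConvergent f) : IsConvergent (-f) := by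
  obtain ⟨C, R, hC, hR, h⟩ := isConvergent_iff.1 hf
  exact isConvergent_iff.2 ⟨C, R, hC, hR, fun m => by rw [map_neg, norm_neg]; exact h m⟩

theorem IsConvergent.sub {f g : ℂ⟦X⟧} (hf : IsConvergent f) (hg : IsConvergent g) :
    IsConvergent (f - g) := by
  rw [sub_eq_add_neg]
  exact hf.add hg.neg

theorem IsConvergent.mul {f g : ℂ⟦X⟧} (hf : IsConvergent f) (hg : IsConvergent g) :
    IsConvergent (f * g) := by
  obtain ⟨C, R, hC, hR, h⟩ := isConvergent_iff.1 hf
  obtain ⟨C', R', hC', hR', h'⟩ := isConvergent_iff.1 hg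
  refine isConvergent_iff.2 ⟨C * C', 2 * (R + R'), by positivity, by positivity, fun m => ?_⟩
  rw [PowerSeries.coeff_mul]
  have hterm : ∀ x ∈ Finset.HasAntidiagonal.antidiagonal m, ‖PowerSeries.coeff x.1 f * PowerSeries.coeff x.2 g‖
      ≤ C * C' * (R + R') ^ m := by
    intro x hx
    rw [← Finset.HasAntidiagonal.mem_antidiagonal.1 hx, pow_add, norm_mul]
    calc _ ≤ (C * R ^ x.1) * (C' * R' ^ x.2) := by gcongr; exacts [h _, h' _]
      _ = C * C' * (R ^ x.1 * R' ^ x.2) := by ring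
      _ ≤ _ := by gcongr <;> linarith
  refine (norm_sum_le_of_le _ hterm).trans ?_
  rw [Finset.sum_const, Finset.Nat.card_antidiagonal, nsmul_eq_mul, mul_pow]
  have h2 : ((m + 1 : ℕ) : ℝ) ≤ 2 ^ m := by exact_mod_cast Nat.lt_two_pow_self (n := m)
  calc _ ≤ 2 ^ m * (C * C' * (R + R') ^ m) := by gcongr
    _ = _ := by ring

/-- The ring `ℂ{x}`. -/
def convergentSeries : Subring ℂ⟦X⟧ where
  carrier := {f | IsConvergent f}
  mul_mem' := IsConvergent.mul
  one_mem' := isConvergent_of_eventually_zero 1 fun m hm => by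
    rw [PowerSeries.coeff_one, if_neg (by omega)]
  add_mem' := IsConvergent.add
  zero_mem' := isConvergent_of_eventually_zero 0 fun m _ => by simp
  neg_mem' := IsConvergent.neg

theorem isConvergent_of_X_pow_mul {f : ℂ⟦X⟧} (d : ℕ) (h : IsConvergent (PowerSeries.X ^ d * f)) :
    IsConvergent f := by
  obtain ⟨C, R, hC, hR, h⟩ := isConvergent_iff.1 h
  refine isConvergent_iff.2 ⟨C * R ^ d, R, by positivity, hR, fun m => ?_⟩
  have := h (m + d)
  rw [PowerSeries.coeff_X_pow_mul] at this
  exact this.trans_eq (by rw [pow_add]; ring)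

/-- Solving the Cauchy product for the coefficient of g in degree m leaves a geometric convolution
of the preceding ones. -/
theorem isConvergent_of_unit_mul {f g : ℂ⟦X⟧} (hf : IsConvergent f)
    (hf0 : PowerSeries.coeff 0 f ≠ 0) (h : IsConvergent (f * g)) : IsConvergent g := by
  obtain ⟨C, R, hC, hR, hb⟩ := exists_common_bound (f := ![f, f * g])
    (by intro i; fin_cases i; exacts [hf, h])
  have hb0 : ∀ m, ‖PowerSeries.coeff m f‖ ≤ C * R ^ m := hb 0
  have hb1 : ∀ m, ‖PowerSeries.coeff m (f * g)‖ ≤ C * R ^ m := hb 1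
  have hR0 : 0 < R := zero_lt_one.trans_le hR
  have hn : 0 < ‖PowerSeries.coeff 0 f‖ := norm_pos_iff.2 hf0
  obtain ⟨U, R', hU, hR', hg⟩ := exists_geometric_bound
    (w := fun m => ‖PowerSeries.coeff m g‖) (K := ‖PowerSeries.coeff 0 f‖⁻¹ * C) (c := R)
    (by positivity) hR0 fun m => by
      have h1 : PowerSeries.coeff 0 f * PowerSeries.coeff m g = PowerSeries.coeff m (f * g)
          - ∑ j ∈ Finset.range m, PowerSeries.coeff (m - j) f * PowerSeries.coeff j g := by
        rw [mul_comm f g, PowerSeries.coeff_mul, Finset.Nat.sum_antidiagonal_eq_sum_range_succ_mk,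
          Finset.sum_range_succ, Nat.sub_self]
        simp only [mul_comm (PowerSeries.coeff _ g)]
        ring
      rw [mul_assoc, mul_assoc, ← mul_add, ← div_eq_inv_mul, le_div_iff₀' hn, ← norm_mul, h1]
      refine (norm_sub_le _ _).trans (add_le_add (hb1 m) ?_)
      rw [Finset.mul_sum]
      refine norm_sum_le_of_le _ fun j _ => ?_
      rw [norm_mul, ← mul_assoc]
      gcongr
      exact hb0 _
  refine isConvergent_iff.2 ⟨U, R', hU, hR', ?_⟩
  exact hg

/-- A power series is convergent if its product with a nonzero convergent one is. -/
theorem IsConvergent.of_mul {f g : ℂ⟦X⟧} (hf : IsConvergent f) (hf0 : f ≠ 0)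
    (h : IsConvergent (f * g)) : IsConvergent g := by
  obtain ⟨d, q, hq, rfl⟩ : ∃ d q, PowerSeries.coeff 0 q ≠ 0 ∧ f = PowerSeries.X ^ d * q :=
    ⟨f.order.toNat, f.divXPowOrder, by
      rw [PowerSeries.coeff_zero_eq_constantCoeff_apply]
      exact fun h => hf0 (PowerSeries.constantCoeff_divXPowOrder_eq_zero_iff.1 h),
      PowerSeries.X_pow_order_mul_divXPowOrder.symm⟩
  rw [mul_assoc] at h
  exact isConvergent_of_unit_mul (isConvergent_of_X_pow_mul d hf) hq (isConvergent_of_X_pow_mul d h)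

/-! ### Linear combinations of summable-resurgent series -/

theorem borel_add (f g : ℂ⸨X⸩) : borel (f + g) = borel f + borel g := by
  ext m
  simp [borel, add_div]

theorem borel_smul (c : ℂ) (f : ℂ⸨X⸩) : borel (c • f) = PowerSeries.C c * borel f := by
  ext m
  simp [borel, mul_div_assoc]

theorem IsSummableResurgentSeries.add {Ω : Set ℂ} {f g : ℂ⸨X⸩} (hf : IsSummableResurgentSeries Ω f)
    (hg : IsSummableResurgentSeries Ω g) : IsSummableResurgentSeries Ω (f + g) := by
  obtain ⟨hf0, φ, ⟨hφ, hφb⟩, hφc⟩ := hf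
  obtain ⟨hg0, ψ, ⟨hψ, hψb⟩, hψc⟩ := hg
  refine ⟨by rw [borel_add]; exact hf0.add hg0, fun q => φ q + ψ q, ⟨fun z γ hγ => ?_,
    fun ν S => ?_⟩, ?_⟩
  · obtain ⟨r, hr, u, hu, h1⟩ := hφ z γ hγ
    obtain ⟨r', hr', v, hv, h2⟩ := hψ z γ hγ
    refine ⟨min r r', lt_min hr hr', fun w => u w + v w,
      (hu.mono (Metric.ball_subset_ball (min_le_left _ _))).add
        (hv.mono (Metric.ball_subset_ball (min_le_right _ _))), fun w hw => ?_⟩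
    obtain ⟨h, e⟩ := h1 w (Metric.ball_subset_ball (min_le_left _ _) hw)
    obtain ⟨h', e'⟩ := h2 w (Metric.ball_subset_ball (min_le_right _ _) hw)
    exact ⟨h, by beta_reduce; rw [e, e']⟩
  · obtain ⟨C, K, R, h1⟩ := hφb ν S
    obtain ⟨C', K', R', h2⟩ := hψb ν S
    refine ⟨|C| + |C'|, max K K', max R R', fun q hq hR => ?_⟩
    rw [add_mul]
    refine (norm_add_le _ _).trans (add_le_add ((h1 q hq ((le_max_left _ _).trans hR)).trans ?_)
      ((h2 q hq ((le_max_right _ _).trans hR)).trans ?_))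
    · gcongr
      · exact le_abs_self C
      · exact le_max_left _ _
    · gcongr
      · exact le_abs_self C'
      · exact le_max_right _ _
  · filter_upwards [hφc, hψc] with w ⟨h, e⟩ ⟨h', e'⟩
    refine ⟨h, ?_⟩
    rw [borel_add]
    simpa [add_mul] using e.add e'

theorem IsSummableResurgentSeries.smul {Ω : Set ℂ} {f : ℂ⸨X⸩} (c : ℂ)
    (hf : IsSummableResurgentSeries Ω f) : IsSummableResurgentSeries Ω (c • f) := by
  obtain ⟨hf0, φ, ⟨hφ, hφb⟩, hφc⟩ := hf
  have hc : IsConvergent (PowerSeries.C c) := isConvergent_of_eventually_zero 1 fun m hm => by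
    rw [PowerSeries.coeff_C, if_neg (by omega)]
  refine ⟨by rw [borel_smul]; exact hc.mul hf0, fun q => c * φ q, ⟨fun z γ hγ => ?_,
    fun ν S => ?_⟩, ?_⟩
  · obtain ⟨r, hr, u, hu, h1⟩ := hφ z γ hγ
    refine ⟨r, hr, fun w => c * u w, analyticOnNhd_const.mul hu, fun w hw => ?_⟩
    obtain ⟨h, e⟩ := h1 w hw
    exact ⟨h, by beta_reduce; rw [e]⟩
  · obtain ⟨C, K, R, h1⟩ := hφb ν S
    refine ⟨‖c‖ * C, K, R, fun q hq hR => ?_⟩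
    rw [norm_mul, mul_assoc]
    gcongr
    exact h1 q hq hR
  · filter_upwards [hφc] with w ⟨h, e⟩
    refine ⟨h, ?_⟩
    rw [borel_smul]
    simpa [mul_assoc] using e.mul_left c

/-- The zero series is not free: the definition demands that short segments be admissible, a
property of Ω that is borrowed from f. -/
theorem isSummableResurgentSeries_zero {Ω : Set ℂ} {f : ℂ⸨X⸩} (hf : IsSummableResurgentSeries Ω f) :
    IsSummableResurgentSeries Ω 0 := by
  have h : (0 : ℂ) • f = 0 := by ext; simp
  exact h ▸ hf.smul 0

/-! ### Reduction to a system that agrees with its normal form to second order -/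

open PowerSeries (derivative)

/-- The coefficients of a power series times a power of `x`. -/
theorem coeff_single_mul_coe (t m : ℤ) (f : ℂ⟦X⟧) :
    (HahnSeries.single t (1 : ℂ) * HahnSeries.ofPowerSeries ℤ ℂ f).coeff m
      = (HahnSeries.ofPowerSeries ℤ ℂ f).coeff (m - t) := by
  conv_lhs => rw [← sub_add_cancel m t]
  rw [HahnSeries.coeff_single_mul_add, one_mul]

theorem coeff_ofPowerSeries_X_sq_mul_derivative (f : ℂ⟦X⟧) (m : ℤ) :
    (HahnSeries.ofPowerSeries ℤ ℂ (PowerSeries.X ^ 2 * derivative ℂ f)).coeff (m + 1)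
      = m * (HahnSeries.ofPowerSeries ℤ ℂ f).coeff m := by
  rcases lt_trichotomy m 0 with h | rfl | h
  · rw [PowerSeries.coeff_coe, PowerSeries.coeff_coe, if_pos h, mul_zero]
    split_ifs with h'
    · rfl
    · obtain rfl : m = -1 := by omega
      simp [PowerSeries.coeff_X_pow_mul']
  · rw [PowerSeries.coeff_coe, if_neg (by norm_num)]
    simp [PowerSeries.coeff_X_pow_mul']
  · obtain ⟨k, rfl⟩ : ∃ k : ℕ, m = ((k + 1 : ℕ) : ℤ) := ⟨(m - 1).toNat, by omega⟩
    have : ((k + 1 : ℕ) : ℤ) + 1 = ((k + 2 : ℕ) : ℤ) := by push_cast; ring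
    rw [this, LaurentSeries.coeff_coe_powerSeries, LaurentSeries.coeff_coe_powerSeries,
      PowerSeries.coeff_X_pow_mul, PowerSeries.coeff_derivative]
    push_cast
    ring

/-- Conjugation of x² d/dx by x^{-s} subtracts s x, which keeps the equation among power series. -/
theorem X_sq_mul_derivative_single_mul (s : ℕ) (f : ℂ⟦X⟧) :
    HahnSeries.ofPowerSeries ℤ ℂ (PowerSeries.X ^ 2) * LaurentSeries.derivative ℂ
        (HahnSeries.single (-(s : ℤ)) (1 : ℂ) * HahnSeries.ofPowerSeries ℤ ℂ f)
      = HahnSeries.single (-(s : ℤ)) (1 : ℂ) * HahnSeries.ofPowerSeries ℤ ℂ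
        (PowerSeries.X ^ 2 * derivative ℂ f - (s : ℂ⟦X⟧) * PowerSeries.X * f) := by
  ext m
  rw [HahnSeries.ofPowerSeries_X_pow]
  have e1 : m = (m - 2) + ((2 : ℕ) : ℤ) := by push_cast; ring
  conv_lhs => rw [e1]
  rw [HahnSeries.coeff_single_mul_add, one_mul, LaurentSeries.derivative_apply,
    LaurentSeries.hasseDeriv_coeff, coeff_single_mul_coe, coeff_single_mul_coe, map_sub,
    HahnSeries.coeff_sub, mul_assoc, map_mul _ (s : ℂ⟦X⟧), map_natCast, ← nsmul_eq_mul,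
    HahnSeries.coeff_nsmul, Pi.smul_apply, map_mul _ PowerSeries.X f, HahnSeries.ofPowerSeries_X]
  have e2 : m - -(s : ℤ) = (m + s - 1) + 1 := by ring
  have e3 : m - 2 + ((1 : ℕ) : ℤ) - -(s : ℤ) = m + s - 1 := by push_cast; ring
  rw [e2, e3, HahnSeries.coeff_single_mul_add, one_mul, coeff_ofPowerSeries_X_sq_mul_derivative]
  simp only [Nat.cast_one, Ring.choose_one_right, zsmul_eq_mul, nsmul_eq_mul]
  push_cast
  ring

/-! ### Gauge transformations -/

section Matrices

variable {ι : Type} [Fintype ι] [DecidableEq ι]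

theorem map_derivative_mul (M N : Matrix ι ι ℂ⟦X⟧) :
    (M * N).map (derivative ℂ) = M.map (derivative ℂ) * N + M * N.map (derivative ℂ) := by
  ext1 i k
  simp only [Matrix.map_apply, Matrix.mul_apply, Matrix.add_apply, map_sum, Derivation.leibniz,
    smul_eq_mul, ← Finset.sum_add_distrib]
  exact Finset.sum_congr rfl fun j _ => by ring

theorem exists_powerSeries_solution {A A₀ : Matrix ι ι ℂ⟦X⟧} {F : Matrix ι ι ℂ⸨X⸩} (hF : IsUnit F)
    (h : HahnSeries.ofPowerSeries ℤ ℂ (PowerSeries.X ^ 2) • F.map (LaurentSeries.derivative ℂ)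
      + F * A₀.map (HahnSeries.ofPowerSeries ℤ ℂ) = A.map (HahnSeries.ofPowerSeries ℤ ℂ) * F) :
    ∃ (s : ℕ) (Φ : Matrix ι ι ℂ⟦X⟧),
      (∀ i k, F i k = HahnSeries.single (-(s : ℤ)) (1 : ℂ) * HahnSeries.ofPowerSeries ℤ ℂ (Φ i k)) ∧
      Φ.det ≠ 0 ∧
      (PowerSeries.X ^ 2 : ℂ⟦X⟧) • Φ.map (derivative ℂ) - ((s : ℂ⟦X⟧) * PowerSeries.X) • Φ + Φ * A₀
        = A * Φ := by
  -- One power of x that clears the poles of all entries.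
  set s := ∑ i, ∑ k, (F i k).order.natAbs with hs
  have hle : ∀ i k, (F i k).order.natAbs ≤ s := fun i k =>
    (Finset.single_le_sum (f := fun k => (F i k).order.natAbs) (fun _ _ => Nat.zero_le _)
      (Finset.mem_univ k)).trans
    (Finset.single_le_sum (f := fun i => ∑ k, (F i k).order.natAbs) (fun _ _ => Nat.zero_le _)
      (Finset.mem_univ i))
  set Φ : Matrix ι ι ℂ⟦X⟧ := fun i k => PowerSeries.mk fun m => (F i k).coeff ((m : ℤ) - s) with hΦ
  have hc : (HahnSeries.single (-(s : ℤ)) (1 : ℂ)) ≠ 0 := HahnSeries.single_ne_zero one_ne_zero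
  have hFΦ : ∀ i k, F i k
      = HahnSeries.single (-(s : ℤ)) (1 : ℂ) * HahnSeries.ofPowerSeries ℤ ℂ (Φ i k) := by
    intro i k
    ext m
    rw [coeff_single_mul_coe, PowerSeries.coeff_coe]
    split_ifs with hm
    · refine HahnSeries.coeff_eq_zero_of_lt_order ?_
      have := hle i k
      omega
    · rw [hΦ, PowerSeries.coeff_mk]
      congr 1
      omega
  refine ⟨s, Φ, hFΦ, ?_, ?_⟩
  · have hdet : F = HahnSeries.single (-(s : ℤ)) (1 : ℂ) • Φ.map (HahnSeries.ofPowerSeries ℤ ℂ) := by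
      ext1 i k
      exact hFΦ i k
    intro h0
    have h1 : F.det ≠ 0 := ((Matrix.isUnit_iff_isUnit_det F).1 hF).ne_zero
    refine h1 ?_
    rw [hdet, Matrix.det_smul]
    have : (Φ.map (HahnSeries.ofPowerSeries ℤ ℂ)).det = HahnSeries.ofPowerSeries ℤ ℂ Φ.det :=
      (RingHom.map_det _ Φ).symm
    rw [this, h0, map_zero, mul_zero]
  · ext1 i k
    have hik := congrFun (congrFun h i) k
    rw [Matrix.add_apply, Matrix.smul_apply, smul_eq_mul, Matrix.map_apply, hFΦ,
      X_sq_mul_derivative_single_mul, Matrix.mul_apply, Matrix.mul_apply] at hik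
    simp only [Matrix.map_apply, hFΦ] at hik
    refine HahnSeries.ofPowerSeries_injective (Γ := ℤ) (mul_left_cancel₀ hc ?_)
    rw [Matrix.add_apply, Matrix.sub_apply, Matrix.smul_apply, Matrix.smul_apply, Matrix.map_apply,
      smul_eq_mul, smul_eq_mul, map_add, mul_add, Matrix.mul_apply, Matrix.mul_apply, map_sum,
      map_sum, Finset.mul_sum, Finset.mul_sum]
    simp only [map_mul _ (Φ _ _) (A₀ _ _), map_mul _ (A _ _) (Φ _ _), ← mul_assoc] at hik ⊢
    rw [hik]
    exact Finset.sum_congr rfl fun j _ => by ring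

/-- The truncation of a matrix of power series. -/
def truncMatrix (T : ℕ) (Φ : Matrix ι ι ℂ⟦X⟧) : Matrix ι ι ℂ⟦X⟧ :=
  Matrix.of fun i k => PowerSeries.mk fun m => if m < T then PowerSeries.coeff m (Φ i k) else 0

theorem coeff_truncMatrix (T : ℕ) (Φ : Matrix ι ι ℂ⟦X⟧) (i k : ι) {m : ℕ} (hm : T ≤ m) :
    PowerSeries.coeff m (truncMatrix T Φ i k) = 0 := by
  rw [truncMatrix, Matrix.of_apply, PowerSeries.coeff_mk, if_neg (by omega)]

theorem exists_eq_truncMatrix_add (T : ℕ) (Φ : Matrix ι ι ℂ⟦X⟧) :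
    ∃ R, Φ = truncMatrix T Φ + (PowerSeries.X ^ T : ℂ⟦X⟧) • R := by
  refine ⟨Matrix.of fun i k => PowerSeries.mk fun m => PowerSeries.coeff (m + T) (Φ i k), ?_⟩
  ext i k m
  rw [Matrix.add_apply, Matrix.smul_apply, smul_eq_mul, map_add, PowerSeries.coeff_X_pow_mul',
    truncMatrix, Matrix.of_apply, Matrix.of_apply, PowerSeries.coeff_mk]
  split_ifs with h1 h2 h2
  · omega
  · simp
  · rw [PowerSeries.coeff_mk, Nat.sub_add_cancel h2, zero_add]
  · omega

/-- A matrix of power series with nonzero determinant is the product of a truncation and of a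
matrix that is tangent to the identity to second order. -/
theorem exists_truncMatrix_mul {Φ : Matrix ι ι ℂ⟦X⟧} (hΦ : Φ.det ≠ 0) :
    ∃ (T : ℕ) (E G S : Matrix ι ι ℂ⟦X⟧), Φ * E = truncMatrix T Φ ∧ E * G = 1 ∧ G * E = 1 ∧
      E = 1 - (PowerSeries.X ^ 2 : ℂ⟦X⟧) • S := by
  obtain ⟨d, q, hq, hdet⟩ : ∃ d q, IsUnit q ∧ Φ.det = PowerSeries.X ^ d * q :=
    ⟨Φ.det.order.toNat, Φ.det.divXPowOrder, by
      rw [PowerSeries.isUnit_iff_constantCoeff, isUnit_iff_ne_zero]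
      exact fun h => hΦ (PowerSeries.constantCoeff_divXPowOrder_eq_zero_iff.1 h),
      PowerSeries.X_pow_order_mul_divXPowOrder.symm⟩
  obtain ⟨q', hq'⟩ := hq.exists_right_inv
  -- As Φ adj(Φ) = x^d q with q a unit, x^d R = Φ q⁻¹ adj(Φ) R. A remainder of order d + 2 is
  -- therefore x² Φ S.
  obtain ⟨R, hR⟩ := exists_eq_truncMatrix_add (d + 2) Φ
  set S := q' • (Φ.adjugate * R) with hS
  set E := 1 - (PowerSeries.X ^ 2 : ℂ⟦X⟧) • S with hE
  have hunit : IsUnit E := by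
    rw [Matrix.isUnit_iff_isUnit_det, PowerSeries.isUnit_iff_constantCoeff]
    have h1 : PowerSeries.constantCoeff E.det = (E.map (PowerSeries.constantCoeff (R := ℂ))).det :=
      RingHom.map_det _ E
    have h2 : E.map (PowerSeries.constantCoeff (R := ℂ)) = 1 := by
      ext i k
      by_cases hik : i = k <;> simp [hE, hik, Matrix.one_apply]
    rw [h1, h2, Matrix.det_one]
    exact isUnit_one
  obtain ⟨u, hu⟩ := hunit
  refine ⟨d + 2, E, ↑u⁻¹, S, ?_, ?_, ?_, rfl⟩
  · have h1 : Φ * (PowerSeries.X ^ 2 : ℂ⟦X⟧) • S = (PowerSeries.X ^ (d + 2) : ℂ⟦X⟧) • R := by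
      rw [hS, Matrix.mul_smul, Matrix.mul_smul, ← Matrix.mul_assoc, Matrix.mul_adjugate,
        Matrix.smul_mul, Matrix.one_mul, smul_smul, smul_smul, hdet]
      congr 1
      linear_combination PowerSeries.X ^ (d + 2) * hq'
    rw [hE, Matrix.mul_sub, Matrix.mul_one, h1]
    exact sub_eq_iff_eq_add.2 hR
  · rw [← hu, Units.mul_inv]
  · rw [← hu, Units.inv_mul]

theorem isConvergent_mul_apply {M N : Matrix ι ι ℂ⟦X⟧} (hM : ∀ i k, IsConvergent (M i k))
    (hN : ∀ i k, IsConvergent (N i k)) (i k : ι) : IsConvergent ((M * N) i k) := by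
  rw [Matrix.mul_apply]
  exact convergentSeries.sum_mem fun j _ => (hM i j).mul (hN j k)

theorem isConvergent_det {M : Matrix ι ι ℂ⟦X⟧} (hM : ∀ i k, IsConvergent (M i k)) :
    IsConvergent M.det := by
  rw [Matrix.det_apply]
  exact convergentSeries.sum_mem fun τ _ =>
    convergentSeries.zsmul_mem (convergentSeries.prod_mem fun i _ => hM _ _) _

theorem isConvergent_adjugate {M : Matrix ι ι ℂ⟦X⟧} (hM : ∀ i k, IsConvergent (M i k)) (i k : ι) :
    IsConvergent (M.adjugate i k) := by
  rw [Matrix.adjugate_apply]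
  refine isConvergent_det fun a b => ?_
  rw [Matrix.updateRow_apply]
  split_ifs
  · by_cases hb : b = i
    · subst hb
      rw [Pi.single_eq_same]
      exact one_mem convergentSeries
    · rw [Pi.single_eq_of_ne hb]
      exact zero_mem convergentSeries
  · exact hM a b

/-- A matrix is convergent if its product with an invertible convergent one is. -/
theorem isConvergent_of_mul_left {p M : Matrix ι ι ℂ⟦X⟧} (hp : ∀ i k, IsConvergent (p i k))
    (hdet : p.det ≠ 0) (h : ∀ i k, IsConvergent ((p * M) i k)) (i k : ι) :
    IsConvergent (M i k) := by
  refine IsConvergent.of_mul (isConvergent_det hp) hdet ?_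
  have h1 : p.det • M = p.adjugate * (p * M) := by
    rw [← Matrix.mul_assoc, Matrix.adjugate_mul, Matrix.smul_mul, Matrix.one_mul]
  have h2 := congrFun (congrFun h1 i) k
  rw [Matrix.smul_apply, smul_eq_mul] at h2
  rw [h2]
  exact isConvergent_mul_apply (isConvergent_adjugate hp) h i k

/-- Used with x replaced by X ^ 2: a gauge tangent to the identity to second order preserves D + xL
modulo x². -/
theorem eq_add_smul_of_gauge {x : ℂ⟦X⟧} {A₀ B E' S : Matrix ι ι ℂ⟦X⟧}
    (h : (1 - x • S) * B = A₀ * (1 - x • S) - x • E') : B = A₀ + x • (S * B - A₀ * S - E') := by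
  rw [Matrix.sub_mul, Matrix.one_mul, Matrix.smul_mul, Matrix.mul_sub, Matrix.mul_one,
    Matrix.mul_smul, sub_eq_iff_eq_add] at h
  refine h.trans ?_
  rw [smul_sub, smul_sub]
  abel

/-- The matrix obtained from A₀ by the gauge E is also obtained from A by the gauge Φ E, up to the
scalar y. -/
theorem mul_eq_of_gauge {x y : ℂ⟦X⟧} {A A₀ B E Φ : Matrix ι ι ℂ⟦X⟧}
    (h : x • Φ.map (derivative ℂ) - y • Φ + Φ * A₀ = A * Φ)
    (hB : E * B = A₀ * E - x • E.map (derivative ℂ)) :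
    Φ * E * B = A * (Φ * E) + y • (Φ * E) - x • (Φ * E).map (derivative ℂ) := by
  have h1 : x • Φ.map (derivative ℂ) = A * Φ - Φ * A₀ + y • Φ := by
    rw [← h]; abel
  rw [map_derivative_mul, smul_add, ← Matrix.smul_mul x, h1, Matrix.mul_assoc, hB]
  simp only [Matrix.add_mul, Matrix.sub_mul, Matrix.mul_sub, Matrix.smul_mul, Matrix.mul_smul,
    Matrix.mul_assoc]
  abel

theorem inverse_solves {x : ℂ⟦X⟧} {A₀ B E G : Matrix ι ι ℂ⟦X⟧} (hEG : E * G = 1) (hGE : G * E = 1)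
    (hB : E * B = A₀ * E - x • E.map (derivative ℂ)) :
    x • G.map (derivative ℂ) + G * A₀ = B * G := by
  have h1 : E.map (derivative ℂ) * G + E * G.map (derivative ℂ) = 0 := by
    rw [← map_derivative_mul, hEG]
    ext1 i k
    by_cases hik : i = k <;> simp [hik]
  have h2 : G.map (derivative ℂ) = -(G * (E.map (derivative ℂ) * G)) := by
    have := congrArg (G * ·) h1
    simp only [Matrix.mul_add, Matrix.mul_zero] at this
    rw [← Matrix.mul_assoc G E, hGE, Matrix.one_mul] at this
    exact eq_neg_of_add_eq_zero_right this
  have h3 : x • E.map (derivative ℂ) = A₀ * E - E * B := by rw [hB, sub_sub_cancel]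
  rw [h2, smul_neg, ← Matrix.mul_smul, ← Matrix.smul_mul, h3, Matrix.sub_mul, Matrix.mul_sub,
    Matrix.mul_assoc A₀, hEG, Matrix.mul_one, Matrix.mul_assoc E, ← Matrix.mul_assoc G E, hGE,
    Matrix.one_mul]
  abel

theorem isConvergent_X_pow (d : ℕ) : IsConvergent (PowerSeries.X ^ d) :=
  isConvergent_of_eventually_zero (d + 1) fun m hm => by
    rw [PowerSeries.coeff_X_pow, if_neg (by omega)]

/-- The formal gauge E need not converge, yet the matrix B' it produces satisfies p B' = A p + s x p
- x² p' with p = Φ E polynomial and det p ≠ 0, so B' does converge. -/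
theorem exists_reduction {A A₀ Φ : Matrix ι ι ℂ⟦X⟧} (hA : ∀ i k, IsConvergent (A i k))
    (hA₀ : ∀ i k, IsConvergent (A₀ i k)) {s : ℕ} (hΦ : Φ.det ≠ 0)
    (h : (PowerSeries.X ^ 2 : ℂ⟦X⟧) • Φ.map (derivative ℂ) - ((s : ℂ⟦X⟧) * PowerSeries.X) • Φ
      + Φ * A₀ = A * Φ) :
    ∃ (T : ℕ) (G B : Matrix ι ι ℂ⟦X⟧), Φ = truncMatrix T Φ * G ∧ (∀ i k, IsConvergent (B i k)) ∧
      (PowerSeries.X ^ 2 : ℂ⟦X⟧) • G.map (derivative ℂ) + G * A₀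
        = (A₀ + (PowerSeries.X ^ 2 : ℂ⟦X⟧) • B) * G := by
  obtain ⟨T, E, G, S, hp, hEG, hGE, hES⟩ := exists_truncMatrix_mul hΦ
  obtain ⟨B', hEB⟩ : ∃ B', E * B' = A₀ * E - (PowerSeries.X ^ 2 : ℂ⟦X⟧) • E.map (derivative ℂ) :=
    ⟨G * (A₀ * E - (PowerSeries.X ^ 2 : ℂ⟦X⟧) • E.map (derivative ℂ)), by
      rw [← Matrix.mul_assoc, hEG, Matrix.one_mul]⟩
  have hB' := eq_add_smul_of_gauge (E' := E.map (derivative ℂ)) (by rw [← hES]; exact hEB)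
  have hpB := mul_eq_of_gauge h hEB
  rw [hp] at hpB
  have hpc : ∀ i k, IsConvergent (truncMatrix T Φ i k) := fun i k =>
    isConvergent_of_eventually_zero T fun m hm => coeff_truncMatrix T Φ i k hm
  have hpc' : ∀ i k, IsConvergent (derivative ℂ (truncMatrix T Φ i k)) := fun i k =>
    isConvergent_of_eventually_zero T fun m hm => by
      rw [PowerSeries.coeff_derivative, coeff_truncMatrix T Φ i k (by omega), zero_mul]
  have hpdet : (truncMatrix T Φ).det ≠ 0 := by
    rw [← hp, Matrix.det_mul]
    refine mul_ne_zero hΦ fun h0 => ?_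
    have := congrArg Matrix.det hEG
    rw [Matrix.det_mul, h0, zero_mul, Matrix.det_one] at this
    exact zero_ne_one this
  have hX : IsConvergent PowerSeries.X := by simpa using isConvergent_X_pow 1
  have hB'c : ∀ i k, IsConvergent (B' i k) := by
    refine isConvergent_of_mul_left hpc hpdet fun i k => ?_
    rw [hpB, Matrix.sub_apply, Matrix.add_apply, Matrix.smul_apply, Matrix.smul_apply,
      Matrix.map_apply, smul_eq_mul, smul_eq_mul]
    exact ((isConvergent_mul_apply hA hpc i k).add
      ((IsConvergent.mul (natCast_mem convergentSeries s) hX).mul (hpc i k))).sub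
      ((isConvergent_X_pow 2).mul (hpc' i k))
  refine ⟨T, G, S * B' - A₀ * S - E.map (derivative ℂ), ?_, fun i k => ?_, ?_⟩
  · rw [← hp, Matrix.mul_assoc, hEG, Matrix.mul_one]
  -- Convergence is read off from x²B = B' - A₀, as the series S in the formula for B need not
  -- converge.
  · refine isConvergent_of_X_pow_mul 2 ?_
    have h1 := eq_sub_of_add_eq' hB'.symm
    have h2 := congrFun (congrFun h1 i) k
    rw [Matrix.smul_apply, smul_eq_mul, Matrix.sub_apply B'] at h2
    rw [h2]
    exact (hB'c i k).sub (hA₀ i k)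
  · rw [← hB']
    exact inverse_solves hEG hGE hEB

end Matrices

/-! ### The convolution equation of a reduced system -/

theorem coeff_ofPowerSeries_mul (f g : ℂ⟦X⟧) {m : ℤ} {N : ℕ} (h : m < N) :
    (HahnSeries.ofPowerSeries ℤ ℂ (f * g)).coeff m
      = ∑ j ∈ Finset.range N, PowerSeries.coeff j f
        * (HahnSeries.ofPowerSeries ℤ ℂ g).coeff (m - j) := by
  rcases lt_or_ge m 0 with hm | hm
  · rw [PowerSeries.coeff_coe, if_pos hm]
    refine (Finset.sum_eq_zero fun j _ => ?_).symm
    rw [PowerSeries.coeff_coe, if_pos (by omega), mul_zero]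
  · obtain ⟨k, rfl⟩ := Int.eq_ofNat_of_zero_le hm
    rw [LaurentSeries.coeff_coe_powerSeries, PowerSeries.coeff_mul,
      Finset.Nat.sum_antidiagonal_eq_sum_range_succ
        fun i j => PowerSeries.coeff i f * PowerSeries.coeff j g]
    rw [← Finset.sum_subset (Finset.range_subset_range.2 (show k + 1 ≤ N by omega))]
    · refine Finset.sum_congr rfl fun j hj => ?_
      rw [← Nat.cast_sub (Finset.mem_range_succ_iff.1 hj), LaurentSeries.coeff_coe_powerSeries]
    · intro j _ hj
      rw [Finset.mem_range] at hj
      rw [PowerSeries.coeff_coe, if_pos (by omega), mul_zero]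

theorem coeff_ofPowerSeries_X_pow_mul (d : ℕ) (f : ℂ⟦X⟧) (m : ℤ) :
    (HahnSeries.ofPowerSeries ℤ ℂ (PowerSeries.X ^ d * f)).coeff m
      = (HahnSeries.ofPowerSeries ℤ ℂ f).coeff (m - d) := by
  rw [map_mul, HahnSeries.ofPowerSeries_X_pow, coeff_single_mul_coe]

theorem coeff_ofPowerSeries_C_mul (c : ℂ) (f : ℂ⟦X⟧) (m : ℤ) :
    (HahnSeries.ofPowerSeries ℤ ℂ (PowerSeries.C c * f)).coeff m
      = c * (HahnSeries.ofPowerSeries ℤ ℂ f).coeff m := by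
  rw [PowerSeries.coeff_coe, PowerSeries.coeff_coe]
  split_ifs <;> simp

section Reduced

variable {ι : Type} [Fintype ι] [DecidableEq ι]

/-- The matrix `D + x L`, where `D` is diagonal. -/
def firstOrderForm (d : ι → ℂ) (L : Matrix ι ι ℂ) : Matrix ι ι ℂ⟦X⟧ :=
  (Matrix.diagonal d).map (PowerSeries.C (R := ℂ))
    + (PowerSeries.X : ℂ⟦X⟧) • L.map (PowerSeries.C (R := ℂ))

/-- The Laurent coefficients of a matrix of power series. -/
def laurentCoeff (G : Matrix ι ι ℂ⟦X⟧) (k : ℤ) : ι × ι → ℂ :=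
  fun x => (HahnSeries.ofPowerSeries ℤ ℂ (G x.1 x.2)).coeff k

theorem laurentCoeff_mul (B G : Matrix ι ι ℂ⟦X⟧) {k : ℤ} {N : ℕ} (h : k < N) (x : ι × ι) :
    laurentCoeff (B * G) k x = ∑ j ∈ Finset.range N, ∑ r, PowerSeries.coeff j (B x.1 r)
      * laurentCoeff G (k - j) (r, x.2) := by
  rw [laurentCoeff, Matrix.mul_apply, map_sum, HahnSeries.coeff_sum, Finset.sum_comm]
  exact Finset.sum_congr rfl fun r _ => coeff_ofPowerSeries_mul _ _ h

theorem firstOrderForm_mul_apply (d : ι → ℂ) (L : Matrix ι ι ℂ) (G : Matrix ι ι ℂ⟦X⟧) (p q : ι) :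
    (firstOrderForm d L * G) p q = PowerSeries.C (d p) * G p q
      + PowerSeries.X ^ 1 * ∑ r, PowerSeries.C (L p r) * G r q := by
  have h : (Matrix.diagonal d).map (PowerSeries.C (R := ℂ))
      = Matrix.diagonal fun i => PowerSeries.C (d i) := Matrix.diagonal_map (map_zero _)
  rw [firstOrderForm, Matrix.add_mul, Matrix.add_apply, h, Matrix.diagonal_mul, Matrix.smul_mul,
    Matrix.smul_apply, smul_eq_mul, Matrix.mul_apply, pow_one]
  rfl

theorem mul_firstOrderForm_apply (d : ι → ℂ) (L : Matrix ι ι ℂ) (G : Matrix ι ι ℂ⟦X⟧) (p q : ι) :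
    (G * firstOrderForm d L) p q = PowerSeries.C (d q) * G p q
      + PowerSeries.X ^ 1 * ∑ r, PowerSeries.C (L r q) * G p r := by
  have h : (Matrix.diagonal d).map (PowerSeries.C (R := ℂ))
      = Matrix.diagonal fun i => PowerSeries.C (d i) := Matrix.diagonal_map (map_zero _)
  rw [firstOrderForm, Matrix.mul_add, Matrix.add_apply, h, Matrix.mul_diagonal, Matrix.mul_smul,
    Matrix.smul_apply, smul_eq_mul, Matrix.mul_apply, pow_one, mul_comm]
  congr 2
  exact Finset.sum_congr rfl fun r _ => mul_comm _ _

/-- The recursion satisfied by the coefficients of a solution of a reduced system. -/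
theorem laurentCoeff_recursion {d : ι → ℂ} {L : Matrix ι ι ℂ} {G B : Matrix ι ι ℂ⟦X⟧}
    (h : (PowerSeries.X ^ 2 : ℂ⟦X⟧) • G.map (derivative ℂ) + G * firstOrderForm d L
      = (firstOrderForm d L + (PowerSeries.X ^ 2 : ℂ⟦X⟧) • B) * G) (k : ℤ) (x : ι × ι) :
    k * laurentCoeff G k x - (d x.1 - d x.2) * laurentCoeff G (k + 1) x
      = (∑ r, L x.1 r * laurentCoeff G k (r, x.2)) - (∑ r, L r x.2 * laurentCoeff G k (x.1, r))
        + laurentCoeff (B * G) (k - 1) x := by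
  obtain ⟨p, q⟩ := x
  have h1 := congrFun (congrFun h p) q
  rw [Matrix.add_apply, Matrix.add_mul, Matrix.add_apply, firstOrderForm_mul_apply,
    mul_firstOrderForm_apply, Matrix.smul_mul, Matrix.smul_apply, Matrix.smul_apply, smul_eq_mul,
    smul_eq_mul, Matrix.map_apply] at h1
  -- In degree k + 1 the diagonal part sees G in degree k + 1, the part xL in degree k and x²B in
  -- degree k - 1.
  have h2 := congrArg (fun f => (HahnSeries.ofPowerSeries ℤ ℂ f).coeff (k + 1)) h1
  simp only [map_add, HahnSeries.coeff_add, coeff_ofPowerSeries_C_mul,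
    coeff_ofPowerSeries_X_pow_mul, map_sum, HahnSeries.coeff_sum, Nat.cast_one, add_sub_cancel_right, Nat.cast_ofNat] at h2
  have h3 : k + 1 - 2 = k - 1 := by ring
  have h4 := coeff_ofPowerSeries_X_sq_mul_derivative (G p q) k
  rw [coeff_ofPowerSeries_X_pow_mul, Nat.cast_ofNat, h3] at h4
  rw [h3, h4] at h2
  simp only [laurentCoeff]
  linear_combination h2

/-- Left multiplication by a matrix. -/
def leftMul (M : Matrix ι ι ℂ) : (ι × ι → ℂ) →L[ℂ] (ι × ι → ℂ) :=
  LinearMap.toContinuousLinearMap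
    { toFun := fun v x => ∑ r, M x.1 r * v (r, x.2)
      map_add' := fun v w => by ext x; simp [mul_add, Finset.sum_add_distrib]
      map_smul' := fun c v => by
        ext x
        simp only [Pi.smul_apply, smul_eq_mul, RingHom.id_apply, Finset.mul_sum]
        exact Finset.sum_congr rfl fun r _ => by ring }

/-- The map `v ↦ t v - v L`. -/
def subRightMul (t : ℂ) (L : Matrix ι ι ℂ) : (ι × ι → ℂ) →L[ℂ] (ι × ι → ℂ) :=
  LinearMap.toContinuousLinearMap
    { toFun := fun v x => t * v x - ∑ r, L r x.2 * v (x.1, r)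
      map_add' := fun v w => by ext x; simp [mul_add, Finset.sum_add_distrib]; ring
      map_smul' := fun c v => by
        ext x
        simp only [Pi.smul_apply, smul_eq_mul, RingHom.id_apply, mul_sub, Finset.mul_sum]
        congr 1
        · ring
        · exact Finset.sum_congr rfl fun r _ => by ring }

theorem leftMul_apply (M : Matrix ι ι ℂ) (v : ι × ι → ℂ) (x : ι × ι) :
    leftMul M v x = ∑ r, M x.1 r * v (r, x.2) := rfl

theorem norm_leftMul_le {M : Matrix ι ι ℂ} {b : ℝ} (hb : 0 ≤ b) (h : ∀ i k, ‖M i k‖ ≤ b) :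
    ‖leftMul M‖ ≤ Fintype.card ι * b := by
  refine ContinuousLinearMap.opNorm_le_bound _ (by positivity) fun v => ?_
  refine (pi_norm_le_iff_of_nonneg (by positivity)).2 fun x => ?_
  rw [leftMul_apply]
  refine (norm_sum_le _ _).trans ((Finset.sum_le_card_nsmul _ _ (b * ‖v‖) fun r _ => ?_).trans_eq ?_)
  · rw [norm_mul]
    exact mul_le_mul (h _ _) (norm_le_pi_norm v _) (norm_nonneg _) hb
  · rw [nsmul_eq_mul, Finset.card_univ, mul_assoc]

/-- The matrix of the coefficients of degree `m`. -/
def coeffMatrix (B : Matrix ι ι ℂ⟦X⟧) (m : ℕ) : Matrix ι ι ℂ := B.map (PowerSeries.coeff m)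

/-- The kernel of the convolution equation of a reduced system. -/
def reducedKernel (t : ℤ) (L : Matrix ι ι ℂ) (B : Matrix ι ι ℂ⟦X⟧) :
    ℕ → (ι × ι → ℂ) →L[ℂ] (ι × ι → ℂ)
  | 0 => leftMul L + subRightMul t L
  | m + 1 => leftMul (coeffMatrix B m)

/-- The right-hand side of the convolution equation of a reduced system. -/
def reducedSource (t : ℤ) (B G : Matrix ι ι ℂ⟦X⟧) (m : ℕ) : ι × ι → ℂ :=
  ∑ i ∈ Finset.range ((-t).toNat + 1),
    leftMul (coeffMatrix B (m - 1 + i)) (laurentCoeff G (-t - i))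

/-- The recursion in degree l + 1 - t, where the summand -t moves into the kernel. In B G, the
coefficients of x^t G of positive degree form the convolution; those of degree at most 0, which the
Borel transform drops, form the source. -/
theorem reduced_eqn {d : ι → ℂ} {L : Matrix ι ι ℂ} {G B : Matrix ι ι ℂ⟦X⟧}
    (h : (PowerSeries.X ^ 2 : ℂ⟦X⟧) • G.map (derivative ℂ) + G * firstOrderForm d L
      = (firstOrderForm d L + (PowerSeries.X ^ 2 : ℂ⟦X⟧) • B) * G) (t : ℤ) (l : ℕ) (x : ι × ι) :
    ((l : ℂ) + 1) * laurentCoeff G (l + 1 - t) x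
        - (d x.1 - d x.2) * laurentCoeff G ((l + 1 : ℕ) + 1 - t) x
      = reducedSource t B G (l + 1) x + ∑ j ∈ Finset.range (l + 1),
        reducedKernel t L B (l - j) (laurentCoeff G (j + 1 - t)) x := by
  have h1 := laurentCoeff_recursion h (l + 1 - t) x
  have e1 : ((l + 1 : ℕ) : ℤ) + 1 - t = l + 1 - t + 1 := by push_cast; ring
  have h2 : laurentCoeff (B * G) (l + 1 - t - 1) x
      = ∑ j ∈ Finset.range l, reducedKernel t L B (l - j) (laurentCoeff G (j + 1 - t)) x
        + reducedSource t B G (l + 1) x := by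
    -- The first l terms use G in degrees l - t down to 1 - t; the others start at -t and reach all
    -- nonnegative degrees below.
    rw [laurentCoeff_mul B G (N := l + ((-t).toNat + 1)) (by push_cast; omega),
      Finset.sum_range_add, ← Finset.sum_range_reflect, reducedSource, Finset.sum_apply]
    congr 1
    · refine Finset.sum_congr rfl fun j hj => ?_
      have hj := Finset.mem_range.1 hj
      have e2 : l - j = (l - 1 - j) + 1 := by omega
      have e3 : (l : ℤ) + 1 - t - 1 - ((l - 1 - j : ℕ) : ℤ) = j + 1 - t := by omega
      rw [e2, e3]
      rfl
    · refine Finset.sum_congr rfl fun i _ => ?_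
      have e3 : (l : ℤ) + 1 - t - 1 - ((l + i : ℕ) : ℤ) = -t - i := by push_cast; ring
      rw [e3, Nat.add_sub_cancel]
      rfl
  rw [Finset.sum_range_succ, Nat.sub_self, e1]
  have h3 : reducedKernel t L B 0 (laurentCoeff G (l + 1 - t)) x
      = (∑ r, L x.1 r * laurentCoeff G (l + 1 - t) (r, x.2)) + (t * laurentCoeff G (l + 1 - t) x
        - ∑ r, L r x.2 * laurentCoeff G (l + 1 - t) (x.1, r)) := rfl
  rw [h3]
  push_cast at h1
  linear_combination h1 + h2

/-- The entries of a solution of a reduced system, multiplied by a power of `x`, are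
summable-resurgent. -/
theorem isSummableResurgentSeries_of_reduced {d : ι → ℂ} {L : Matrix ι ι ℂ}
    (hL : ∀ i k, d i ≠ d k → L i k = 0) {G B : Matrix ι ι ℂ⟦X⟧} (hB : ∀ i k, IsConvergent (B i k))
    (h : (PowerSeries.X ^ 2 : ℂ⟦X⟧) • G.map (derivative ℂ) + G * firstOrderForm d L
      = (firstOrderForm d L + (PowerSeries.X ^ 2 : ℂ⟦X⟧) • B) * G)
    {Ω : Set ℂ} (hΩ : Ω.Finite) (h0 : (0 : ℂ) ∈ Ω) (hd : ∀ i k, d i - d k ∈ Ω) (t : ℤ) (i k : ι) :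
    IsSummableResurgentSeries Ω
      (HahnSeries.single t (1 : ℂ) * HahnSeries.ofPowerSeries ℤ ℂ (G i k)) := by
  obtain ⟨β, c, hβ, hc, hb⟩ := exists_common_bound (f := fun x : ι × ι => B x.1 x.2)
    fun x => hB x.1 x.2
  have hc0 : 0 < c := zero_lt_one.trans_le hc
  set τ := (-t).toNat + 1 with hτ
  set γ := ∑ i ∈ Finset.range τ, ‖laurentCoeff G (-t - i)‖ with hγ
  have hγ0 : 0 ≤ γ := Finset.sum_nonneg fun _ _ => norm_nonneg _
  have hmul : ∀ m, ‖leftMul (coeffMatrix B m)‖ ≤ Fintype.card ι * (β * c ^ m) := fun m =>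
    norm_leftMul_le (by positivity) fun i k => hb (i, k) m
  set κ₀ := ‖leftMul L + subRightMul (t : ℂ) L‖
  -- The summands bound the kernel in degree 0, the kernel in higher degrees, and the source, where
  -- c ^ τ covers the shift of the indices.
  set κ := 1 + κ₀ + Fintype.card ι * β + Fintype.card ι * β * c ^ τ * γ with hκ
  have hκ₀ : 0 ≤ κ₀ := norm_nonneg _
  have h1 : 0 ≤ Fintype.card ι * β := by positivity
  have h2 : 0 ≤ Fintype.card ι * β * c ^ τ * γ := by positivity
  refine ConvolutionEquation.isSummableResurgentSeries (ι := ι × ι)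
    { ω := fun x => d x.1 - d x.2
      K := reducedKernel t L B
      C := reducedSource t B G
      u := fun l => laurentCoeff G (l + 1 - t)
      κ := κ
      c := c
      κ_pos := by positivity
      one_le := hc
      norm_K_le := ?_
      norm_C_le := ?_
      eqn := reduced_eqn h t
      decoupled := ?_ } hΩ h0 (fun x => hd x.1 x.2) (i, k) (fun l => coeff_single_mul_coe _ _ _)
  · rintro (_ | m)
    · rw [pow_zero, mul_one]
      exact le_trans (le_refl κ₀) (by rw [hκ]; linarith)
    · refine (hmul m).trans ?_
      rw [← mul_assoc]
      exact mul_le_mul (by rw [hκ]; linarith) (pow_le_pow_right₀ hc m.le_succ) (by positivity)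
        (by positivity)
  · intro m
    have h3 : ‖reducedSource t B G m‖ ≤ Fintype.card ι * β * c ^ (m + τ) * γ := by
      rw [hγ, Finset.mul_sum]
      refine norm_sum_le_of_le _ fun i hi => ?_
      refine (ContinuousLinearMap.le_opNorm _ _).trans ?_
      refine mul_le_mul_of_nonneg_right ((hmul _).trans ?_) (norm_nonneg _)
      rw [← mul_assoc]
      refine mul_le_mul_of_nonneg_left (pow_le_pow_right₀ hc ?_) h1
      have := Finset.mem_range.1 hi
      omega
    refine h3.trans ?_
    rw [pow_add, show (Fintype.card ι : ℝ) * β * (c ^ m * c ^ τ) * γ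
      = Fintype.card ι * β * c ^ τ * γ * c ^ m by ring]
    exact mul_le_mul_of_nonneg_right (by rw [hκ]; linarith) (by positivity)
  -- By `hL`, nonzero entries of L link only indices with equal d, so v ↦ Lv and v ↦ vL do not mix
  -- pairs with d p = d q with the others.
  · rintro ⟨p, q⟩ hpq v hv
    simp only [sub_eq_zero] at hpq hv
    have h3 : reducedKernel t L B 0 v (p, q)
      = (∑ r, L p r * v (r, q)) + (t * v (p, q) - ∑ r, L r q * v (p, r)) := rfl
    rw [h3, hv (p, q) hpq, mul_zero, Finset.sum_eq_zero, Finset.sum_eq_zero, sub_zero, add_zero]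
    · intro r _
      by_cases hr : d r = d q
      · rw [hv (p, r) (hpq.trans hr.symm), mul_zero]
      · rw [hL r q hr, zero_mul]
    · intro r _
      by_cases hr : d p = d r
      · rw [hv (r, q) (hr.symm.trans hpq), mul_zero]
      · rw [hL p r hr, zero_mul]

end Reduced

/-! ### Level-one systems -/

theorem normalForm_eq {J : ℕ} (n : Fin J → ℕ) (a lam : Fin J → ℂ) :
    normalForm n a lam = firstOrderForm (fun p : Idx n => a p.1) (exponentMatrix n lam) := by
  have h : stokesMatrix n a = Matrix.diagonal fun p : Idx n => a p.1 := by
    rw [stokesMatrix]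
    simp only [Matrix.smul_one_eq_diagonal]
    exact Matrix.blockDiagonal'_diagonal _
  rw [normalForm, firstOrderForm, h]

theorem exponentMatrix_apply_ne {J : ℕ} (n : Fin J → ℕ) (lam : Fin J → ℂ) {p q : Idx n}
    (h : p.1 ≠ q.1) : exponentMatrix n lam p q = 0 :=
  Matrix.blockDiagonal'_apply_ne _ _ _ h

theorem isConvergent_normalForm {J : ℕ} (n : Fin J → ℕ) (a lam : Fin J → ℂ) (p q : Idx n) :
    IsConvergent (normalForm n a lam p q) := by
  refine isConvergent_of_eventually_zero 2 fun m hm => ?_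
  obtain ⟨k, rfl⟩ := Nat.exists_eq_add_of_le' hm
  rw [normalForm, Matrix.add_apply, Matrix.smul_apply, Matrix.map_apply, Matrix.map_apply,
    smul_eq_mul, map_add, PowerSeries.coeff_succ_X_mul, PowerSeries.coeff_C, PowerSeries.coeff_C,
    if_neg (by omega), if_neg (by omega), add_zero]

theorem finite_stokesDifferences {J : ℕ} (a : Fin J → ℂ) : (stokesDifferences a).Finite := by
  refine (Set.finite_range fun x : Fin J × Fin J => a x.1 - a x.2).subset ?_
  rintro _ ⟨j, k, rfl⟩
  exact ⟨(j, k), rfl⟩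

theorem eq_sum_X_pow {f : ℂ⟦X⟧} {T : ℕ} (hf : ∀ m ≥ T, PowerSeries.coeff m f = 0) :
    f = ∑ j ∈ Finset.range T, PowerSeries.X ^ j * PowerSeries.C (PowerSeries.coeff j f) := by
  ext m
  simp only [map_sum, PowerSeries.coeff_X_pow_mul', PowerSeries.coeff_C]
  by_cases hm : m < T
  · rw [Finset.sum_eq_single m]
    · simp
    · intro j _ hj
      split_ifs <;> first | rfl | omega
    · intro h
      exact absurd (Finset.mem_range.2 hm) h
  · rw [hf m (not_lt.1 hm), Finset.sum_eq_zero]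
    intro j hj
    have := Finset.mem_range.1 hj
    split_ifs <;> first | rfl | omega

theorem isSummableResurgentSeries_sum {Ω : Set ℂ} {κ : Type*} (s : Finset κ) {f : κ → ℂ⸨X⸩}
    (h0 : IsSummableResurgentSeries Ω 0) (h : ∀ j ∈ s, IsSummableResurgentSeries Ω (f j)) :
    IsSummableResurgentSeries Ω (∑ j ∈ s, f j) :=
  Finset.sum_induction f _ (fun _ _ => IsSummableResurgentSeries.add) h0 h

/-- The product x^t p g is a finite linear combination of the series x^{t+j} g, so no convolution of
resurgent functions is needed. -/
theorem isSummableResurgentSeries_polynomial_mul {Ω : Set ℂ} {p g : ℂ⟦X⟧} {T : ℕ}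
    (hp : ∀ m ≥ T, PowerSeries.coeff m p = 0)
    (hg : ∀ t : ℤ, IsSummableResurgentSeries Ω
      (HahnSeries.single t (1 : ℂ) * HahnSeries.ofPowerSeries ℤ ℂ g)) (t : ℤ) :
    IsSummableResurgentSeries Ω
      (HahnSeries.single t (1 : ℂ) * HahnSeries.ofPowerSeries ℤ ℂ (p * g)) := by
  have h : HahnSeries.single t (1 : ℂ) * HahnSeries.ofPowerSeries ℤ ℂ (p * g)
      = ∑ j ∈ Finset.range T, PowerSeries.coeff j p
        • (HahnSeries.single (t + j) (1 : ℂ) * HahnSeries.ofPowerSeries ℤ ℂ g) := by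
    ext m
    conv_lhs => rw [eq_sum_X_pow hp, Finset.sum_mul]
    rw [coeff_single_mul_coe, map_sum, HahnSeries.coeff_sum, HahnSeries.coeff_sum]
    refine Finset.sum_congr rfl fun j _ => ?_
    rw [mul_assoc, coeff_ofPowerSeries_X_pow_mul, coeff_ofPowerSeries_C_mul, HahnSeries.coeff_smul,
      smul_eq_mul, coeff_single_mul_coe, sub_sub]
  rw [h]
  exact isSummableResurgentSeries_sum _ (isSummableResurgentSeries_zero (hg 0)) fun j _ =>
    (hg _).smul _

end LevelOne

end

/-! ### The main theorem -/

theorem mainTheorem2 {J : ℕ} (n : Fin J → ℕ) (hn : ∀ j, 0 < n j)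
    (a lam : Fin J → ℂ) (hlevel : ∃ j k, a j ≠ a k)
    (A : Matrix (LevelOne.Idx n) (LevelOne.Idx n) (PowerSeries ℂ))
    (hA : ∀ i k, LevelOne.IsConvergent (A i k))
    (hA0 : A.map PowerSeries.constantCoeff ≠ 0)
    (F : Matrix (LevelOne.Idx n) (LevelOne.Idx n) (LaurentSeries ℂ))
    (hF : LevelOne.IsFormalFundamentalSolution A a lam F) :
    ∀ i k, LevelOne.IsSummableResurgentSeries (LevelOne.stokesDifferences a) (F i k) := by
  intro i k
  obtain ⟨hF1, hF2⟩ := hF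
  obtain ⟨s, Φ, hFΦ, hdet, hΦ⟩ := LevelOne.exists_powerSeries_solution hF1 hF2
  obtain ⟨T, G, B, hTG, hB, hG⟩ :=
    LevelOne.exists_reduction hA (LevelOne.isConvergent_normalForm n a lam) hdet hΦ
  rw [LevelOne.normalForm_eq] at hG
  -- Arbitrary shifts t are needed: F carries the factor x^{-s} and the truncation contributes
  -- powers x^j.
  have hres : ∀ (t : ℤ) l, LevelOne.IsSummableResurgentSeries (LevelOne.stokesDifferences a)
      (HahnSeries.single t (1 : ℂ) * HahnSeries.ofPowerSeries ℤ ℂ (G l k)) := fun t l =>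
    LevelOne.isSummableResurgentSeries_of_reduced (d := fun p : LevelOne.Idx n => a p.1)
      (L := LevelOne.exponentMatrix n lam)
      (fun p q hpq => LevelOne.exponentMatrix_apply_ne n lam fun h => hpq (congrArg a h)) hB hG
      (LevelOne.finite_stokesDifferences a) ⟨i.1, i.1, (sub_self _).symm⟩
      (fun p q => ⟨p.1, q.1, rfl⟩) t l k
  have hΦik : Φ i k = ∑ l, LevelOne.truncMatrix T Φ i l * G l k := by
    conv_lhs => rw [hTG, Matrix.mul_apply]
  rw [hFΦ, hΦik, map_sum, Finset.mul_sum]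
  exact LevelOne.isSummableResurgentSeries_sum _
    (LevelOne.isSummableResurgentSeries_zero (hres 0 k)) fun l _ =>
    LevelOne.isSummableResurgentSeries_polynomial_mul
      (fun m hm => LevelOne.coeff_truncMatrix T Φ i l hm) (fun t => hres t l) _
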